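/- **Setting.** Fix pairwise disjoint sets of real, integer and trace variables, a designated real variable $\mu$ (the global time), and a set of channel names with one fixed element $ch_0$. *Program terms* $\theta$ are polynomials in real variables with rational coefficients; $\chi$ ranges over first-order real arithmetic over such terms. *Real, integer, channel and trace terms* are $$\eta ::= x\mid c\mid \eta+\eta\mid \eta\cdot\eta\mid \mathrm{val}(te[i])\mid \mathrm{stamp}(te[i]),\quad i ::= n\mid 0\mid 1\mid i+i\mid |te|,\quad ce::=ch\mid\mathrm{chan}(te[i]),$$ $$te ::= h\mid \epsilon\mid \langle ch,\theta_1,\theta_2\rangle\mid te\cdot te\mid te\downarrow Y\quad(Y\text{ a finite set of channels, }c\in\mathbb Q).$$ *Programs* are $$\alpha,\beta ::= x:=\theta\mid x:=*\mid \{x'=\theta\,\&\,\chi\}\mid\ ?\chi\mid \alpha;\beta\mid\alpha\cup\beta\mid\alpha^*\mid ch(h)!\theta\mid ch(h)?x\mid \alpha\parallel\beta,$$ where in $x:=\theta$ (simultaneous assignment to distinct variables) and $x'=\theta$ the $x$, $\theta$ may be vectors. *Formulas* are built from equalities of terms of equal sort, $\ge$ on real and on integer terms, the prefix relation $\preceq$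 on trace terms, $\neg,\wedge,\vee,\to$, quantifiers over variables of every sort, boxes $[\alpha]\psi$ and ac-boxes $[\alpha]_{\{A,C\}}\psi$. $\top$ is $0=0$ and $\alpha^0$ is $?\top$. **Static semantics.** $BV(\alpha)$ are the variables assigned, evolved (every evolution also binds $\mu$), received into, or used as recorder $h$. $MBV$ (must-bound) equals $BV$ on atomic programs, $\cap$ on choice, $\cup$ on $;$ and $\parallel$, and $\emptyset$ on $\alpha^*$. $FV$ is as usual, with $FV(x'=\theta\,\&\,\chi)=\{x,\mu\}\cup FV(\theta)\cup FV(\chi)$, $\{h,\mu\}\subseteq FV(ch(h)!\theta)$, $FV(ch(h)?x)=\{h,\mu\}$, $FV(\alpha;\beta)=FV(\alpha)\cup(FV(\beta)\setminus MBV(\alpha))$, $FV([\alpha]\psi)=FV(\alpha)\cup(FV(\psi)\setminus MBV(\alpha))$, and $FV([\alpha]_{\{A,C\}}\psi)=FV([\alpha]\psi)\cup FV(A)\cup FV(C)$. $CN(\alpha)$ is the set of channels on which $\alpha$ sends or receives. For terms and formulas, $CN$ is the union over all immediate subterms and subformulas (in boxes: of $\psi$, $A$, $C$ only), with $CN(h)=$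 all channels, $CN(\langle ch,\theta_1,\theta_2\rangle)=\emptyset$, $CN(te\downarrow Y)=CN(te)\cap Y$. $V=FV\cup BV$. **Well-formedness.** A formula is well-formed if: each differential equation system has one right-hand side per variable, and $1$ for $\mu$ if it lists $\mu$; no receive writes $\mu$; in every $\alpha\parallel\beta$ the sets $V(\alpha)\cap BV(\beta)$ and $V(\beta)\cap BV(\alpha)$ contain only $\mu$ and trace variables, and neither $\alpha$ nor $\beta$ contains an assignment $\mu:=\theta$ or $\mu:=*$; and every $[\alpha]_{\{A,C\}}\psi$ satisfies: $(FV(A)\cup FV(C))\cap BV(\alpha)$ contains only trace variables. **Semantics.** A state $v$ maps real variables to $\mathbb R$, integer variables to $\mathbb N$ and trace variables to finite sequences of events $\langle ch,a,s\rangle$ ($a,s\in\mathbb R$). A recorded trace is a finite sequence of events $\langle h,ch,a,s\rangle$; $v\cdot\tau$ appends to each $v(h)$ the events of $\tau$ recorded by $h$. Terms have the expected values ($te[i]$ counts from $0$; out of range, value and timestamp are $0$ and the channel is $ch_0$). $[\![\alpha]\!]$ is a set of triples $(v,\tau,w)$, with $w$ a state or $\bot$ (unfinished): - Assignments, tests and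 evolutions have all $(v,\epsilon,\bot)$ and their usual runs with $\tau=\epsilon$; evolutions run for some duration $d\ge0$ along a solution on $[0,d]$ of $x'=\theta$, $\mu'=1$ that satisfies $\chi$ throughout and keeps all other variables constant (for $d=0$ only $\chi$ is required). - $ch(h)!\theta$ has $(v,\epsilon,\bot)$, $(v,e,\bot)$, $(v,e,v)$ with $e=\langle h,ch,\theta(v),v(\mu)\rangle$; $ch(h)?x$ has the same with any real $a$ in place of $\theta(v)$ and final state $v[x\mapsto a]$. - $[\![\alpha\cup\beta]\!]$ is the union. $[\![\alpha;\beta]\!]=[\![\alpha]\!]\circ[\![\beta]\!]$, where $U\circ M$ consists of all $(v,\tau,\bot)$ with some $(v,\tau,w)\in U$ and all $(v,\tau_1\tau_2,w)$ with $(v,\tau_1,u)\in U$, $u\ne\bot$, $(u,\tau_2,w)\in M$. $[\![\alpha^*]\!]=\bigcup_n[\![\alpha]\!]^n$ with $U^0=[\![?\top]\!]$, $U^{n+1}=U\circ U^n$. - $[\![\alpha\parallel\beta]\!]$ consists of the $(v,\tau,w)$ with $(v,\tau\downarrow CN(\alpha),w_\alpha)\in[\![\alpha]\!]$ and $(v,\tau\downarrow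 CN(\beta),w_\beta)\in[\![\beta]\!]$, where $\tau$ has only channels of $\alpha$ or $\beta$ and non-decreasing timestamps, $w_\alpha(\mu)=w_\beta(\mu)$ if both are states, and $w=\bot$ if one of them is $\bot$, otherwise $w$ equals $w_\alpha$ on $BV(\alpha)$ and $w_\beta$ elsewhere. First-order formulas have their usual meaning, quantifiers ranging over $\mathbb R$, $\mathbb N$ or all finite event sequences. $v\models[\alpha]\psi$ iff $w\cdot\tau\models\psi$ for all $(v,\tau,w)\in[\![\alpha]\!]$ with $w\neq\bot$. $v\models[\alpha]_{\{A,C\}}\psi$ iff for all $(v,\tau,w)\in[\![\alpha]\!]$: (commit) if $v\cdot\tau'\models A$ for all proper prefixes $\tau'$ of $\tau$, then $v\cdot\tau\models C$; (post) if $w\ne\bot$ and $v\cdot\tau'\models A$ for all prefixes $\tau'$ of $\tau$ including $\tau$, then $w\cdot\tau\models\psi$. A formula is valid if it holds in all states. **Theorem (soundness).** Every well-formed instance of the following axioms is valid. - assign: $[x:=\theta]\psi(x)\leftrightarrow\psi(\theta)$, where $\psi(\theta)$ replaces all free occurrences of $x$ and the substitution is admissible: no variable is captured, no replaced free variable may or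 may not be bound depending on the run, and $\mu$, which communication and evolution read implicitly, is not replaced there - nondetAssign: $[x:=*]\psi\leftrightarrow\forall x\,\psi$ - test: $[?\chi]\psi\leftrightarrow(\chi\to\psi)$ - boxesDual: $[\alpha]\psi\leftrightarrow[\alpha]_{\{\top,\top\}}\psi$ - acComposition: $[\alpha;\beta]_{\{A,C\}}\psi\leftrightarrow[\alpha]_{\{A,C\}}[\beta]_{\{A,C\}}\psi$ - acChoice: $[\alpha\cup\beta]_{\{A,C\}}\psi\leftrightarrow[\alpha]_{\{A,C\}}\psi\wedge[\beta]_{\{A,C\}}\psi$ - acIteration: $[\alpha^*]_{\{A,C\}}\psi\leftrightarrow[\alpha^0]_{\{A,C\}}\psi\wedge[\alpha]_{\{A,C\}}[\alpha^*]_{\{A,C\}}\psi$ - acInduction: $[\alpha^*]_{\{A,C\}}\psi\leftrightarrow[\alpha^0]_{\{A,C\}}\psi\wedge[\alpha^*]_{\{A,\top\}}(\psi\to[\alpha]_{\{A,C\}}\psi)$ - gtime: $[x'=\theta\,\&\,\chi]\psi\leftrightarrow[\mu'=1,x'=\theta\,\&\,\chi]\psi$ - solution: $[x'=\theta(x)]\psi\leftrightarrow\forall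 t\,(t\ge0\to[x:=y(t)]\psi)$, if $\mu\in x$, $t$ is neither in $x$ nor free in $\theta$ or $\psi$, and the program terms $y(t)$ satisfy $y'(t)=\theta(y(t))$ for $t\ge 0$ and $y(0)=x$ for all values of the variables - send: $[ch(h)!\theta]\psi(h)\leftrightarrow\forall h_0\,(h_0=h\cdot\langle ch,\theta,\mu\rangle\to\psi(h_0))$, if $h_0$ is fresh, where $\psi(h_0)$ replaces $h$ by $h_0$ in $\psi$, recorders in programs included, outside the scope of quantifiers over $h$ - acCom: $[ch(h)!\theta]_{\{A,C\}}\psi\leftrightarrow C\wedge(A\to[ch(h)!\theta](C\wedge(A\to\psi)))$ - comDual: $[ch(h)?x]_{\{A,C\}}\psi\leftrightarrow[x:=*][ch(h)!x]_{\{A,C\}}\psi$ - K: $(\forall\bar z\,\mathsf K)\wedge[\alpha]_{\{A_1\wedge A_2,C_1\wedge C_2\}}\psi\to[\alpha]_{\{A,C_1\wedge C_2\}}\psi$, where $\mathsf K=(A\wedge C_1\to A_2)\wedge(A\wedge C_2\to A_1)$ and $\bar z$ lists $FV(\mathsf K)$ - acDropComp: $[\alpha]_{\{A,C\}}\psi\to[\alpha\parallel\beta]_{\{A,C\}}\psi$,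 if $\beta$ does not interfere: $FV(\psi)\cap BV(\beta)$ contains only $\mu$ and trace variables, $FV(A)\cap BV(\beta)$ and $FV(C)\cap BV(\beta)$ contain only trace variables, and $CN(\varphi)\cap CN(\beta)\subseteq CN(\alpha)$ for $\varphi\in\{A,C,\psi\}$ - acNoCom: $[\alpha]_{\{A,C\}}\psi\leftrightarrow C\wedge(A\to[\alpha]\psi)$, if $CN(\alpha)=\emptyset$ - acWeak: $[\alpha]_{\{A,C\}}\psi\leftrightarrow C\wedge[\alpha]_{\{A,C\}}(C\wedge(A\to\psi))$ - acBoxesDist: $[\alpha]_{\{A,C_1\wedge C_2\}}(\psi_1\wedge\psi_2)\leftrightarrow[\alpha]_{\{A,C_1\}}\psi_1\wedge[\alpha]_{\{A,C_2\}}\psi_2$ Moreover the following rules preserve validity, for well-formed conclusions: acMono, from $A_2\to A_1$, $C_1\to C_2$ and $\psi_1\to\psi_2$ infer $[\alpha]_{\{A_1,C_1\}}\psi_1\to[\alpha]_{\{A_2,C_2\}}\psi_2$; and acG, from $C\wedge\psi$ infer $[\alpha]_{\{A,C\}}\psi$. -/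

import Mathlib

namespace DLCHP

universe u

/-- The vocabulary: real, integer and trace variables, channel names, the designated real variable
`mu` for the global time, and the channel name that `chan` returns on the empty trace. -/
structure Sig where
  RVar : Type u
  NVar : Type u
  TVar : Type u
  Chan : Type u
  mu : RVar
  someChan : Chan

/-- All variables: the disjoint union of the three sorts. -/
inductive Var (S : Sig.{u}) : Type u
  | r : S.RVar → Var S
  | n : S.NVar → Var S
  | t : S.TVar → Var S

/-- The set of all trace variables. -/
def TV (S : Sig.{u}) : Set (Var S) := {z | ∃ h, z = Var.t h}

/-! ### Terms -/

/-- Polynomials in the real variables with rational coefficients: the terms of programs. -/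
inductive Poly (S : Sig.{u}) : Type u
  | var : S.RVar → Poly S
  | const : ℚ → Poly S
  | add : Poly S → Poly S → Poly S
  | mul : Poly S → Poly S → Poly S

/-- Trace terms. -/
inductive TTerm (S : Sig.{u}) : Type u
  | var : S.TVar → TTerm S
  | eps : TTerm S
  | item : S.Chan → Poly S → Poly S → TTerm S
  | cat : TTerm S → TTerm S → TTerm S
  | proj : TTerm S → Finset S.Chan → TTerm S

/-- Integer terms. -/
inductive ITerm (S : Sig.{u}) : Type u
  | var : S.NVar → ITerm S
  | zero : ITerm S
  | one : ITerm S
  | add : ITerm S → ITerm S → ITerm S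
  | len : TTerm S → ITerm S

/-- Real terms. -/
inductive RTerm (S : Sig.{u}) : Type u
  | var : S.RVar → RTerm S
  | const : ℚ → RTerm S
  | add : RTerm S → RTerm S → RTerm S
  | mul : RTerm S → RTerm S → RTerm S
  | val : TTerm S → ITerm S → RTerm S
  | stamp : TTerm S → ITerm S → RTerm S

/-- Channel terms. -/
inductive CTerm (S : Sig.{u}) : Type u
  | ch : S.Chan → CTerm S
  | chan : TTerm S → ITerm S → CTerm S

/-! ### Programs and formulas -/

/-- Formulas of first-order real arithmetic. -/
inductive FolRA (S : Sig.{u}) : Type u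
  | eq : Poly S → Poly S → FolRA S
  | ge : Poly S → Poly S → FolRA S
  | not : FolRA S → FolRA S
  | and : FolRA S → FolRA S → FolRA S
  | or : FolRA S → FolRA S → FolRA S
  | imp : FolRA S → FolRA S → FolRA S
  | all : S.RVar → FolRA S → FolRA S
  | ex : S.RVar → FolRA S → FolRA S

/-- The formula true. -/
def FolRA.tt {S : Sig.{u}} : FolRA S := .eq (.const 0) (.const 0)

/-- Communicating hybrid programs. In `assign` and `ode`, the list of pairs `(x, θ)` is the
(vectorial) simultaneous assignment `x := θ`, respectively the system `x' = θ`.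
`send ch h θ` is `ch(h)!θ` and `recv ch h x` is `ch(h)?x`. -/
inductive Prog (S : Sig.{u}) : Type u
  | assign : List (S.RVar × Poly S) → Prog S
  | nondet : S.RVar → Prog S
  | ode : List (S.RVar × Poly S) → FolRA S → Prog S
  | test : FolRA S → Prog S
  | seq : Prog S → Prog S → Prog S
  | choice : Prog S → Prog S → Prog S
  | star : Prog S → Prog S
  | send : S.Chan → S.TVar → Poly S → Prog S
  | recv : S.Chan → S.TVar → S.RVar → Prog S
  | par : Prog S → Prog S → Prog S

/-- Formulas. `acbox α A C ψ` is the ac-box `[α]{A,C}ψ`. -/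
inductive Fml (S : Sig.{u}) : Type u
  | eqR : RTerm S → RTerm S → Fml S
  | eqI : ITerm S → ITerm S → Fml S
  | eqC : CTerm S → CTerm S → Fml S
  | eqT : TTerm S → TTerm S → Fml S
  | geR : RTerm S → RTerm S → Fml S
  | geI : ITerm S → ITerm S → Fml S
  | leT : TTerm S → TTerm S → Fml S
  | not : Fml S → Fml S
  | and : Fml S → Fml S → Fml S
  | or : Fml S → Fml S → Fml S
  | imp : Fml S → Fml S → Fml S
  | all : Var S → Fml S → Fml S
  | ex : Var S → Fml S → Fml S
  | box : Prog S → Fml S → Fml S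
  | acbox : Prog S → Fml S → Fml S → Fml S → Fml S

variable {S : Sig.{u}}

/-- Polynomials are real terms. -/
def Poly.toR : Poly S → RTerm S
  | .var x => .var x
  | .const q => .const q
  | .add p q => .add p.toR q.toR
  | .mul p q => .mul p.toR q.toR

/-- Formulas of real arithmetic are formulas. -/
def FolRA.toFml : FolRA S → Fml S
  | .eq p q => .eqR p.toR q.toR
  | .ge p q => .geR p.toR q.toR
  | .not a => .not a.toFml
  | .and a b => .and a.toFml b.toFml
  | .or a b => .or a.toFml b.toFml
  | .imp a b => .imp a.toFml b.toFml
  | .all x a => .all (.r x) a.toFml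
  | .ex x a => .ex (.r x) a.toFml

/-- The formula true. -/
def Fml.tt : Fml S := FolRA.tt.toFml

/-- Bi-implication. -/
def Fml.iff (a b : Fml S) : Fml S := .and (.imp a b) (.imp b a)

/-- `∀ z₁ … zₙ. φ`. -/
def Fml.allList (zs : List (Var S)) (a : Fml S) : Fml S := zs.foldr Fml.all a

/-! ### Static semantics -/

def Poly.fv : Poly S → Set S.RVar
  | .var x => {x}
  | .const _ => ∅
  | .add p q => p.fv ∪ q.fv
  | .mul p q => p.fv ∪ q.fv

/-- Free variables of a polynomial, as a set of variables. -/
def Poly.FV (p : Poly S) : Set (Var S) := Var.r '' p.fv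

def TTerm.FV : TTerm S → Set (Var S)
  | .var h => {.t h}
  | .eps => ∅
  | .item _ p q => p.FV ∪ q.FV
  | .cat a b => a.FV ∪ b.FV
  | .proj a _ => a.FV

def ITerm.FV : ITerm S → Set (Var S)
  | .var i => {.n i}
  | .zero => ∅
  | .one => ∅
  | .add a b => a.FV ∪ b.FV
  | .len a => a.FV

def RTerm.FV : RTerm S → Set (Var S)
  | .var x => {.r x}
  | .const _ => ∅
  | .add a b => a.FV ∪ b.FV
  | .mul a b => a.FV ∪ b.FV
  | .val a i => a.FV ∪ i.FV
  | .stamp a i => a.FV ∪ i.FV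

def CTerm.FV : CTerm S → Set (Var S)
  | .ch _ => ∅
  | .chan a i => a.FV ∪ i.FV

/-- Accessed channels of terms. -/
def TTerm.CN : TTerm S → Set S.Chan
  | .var _ => Set.univ
  | .eps => ∅
  | .item _ _ _ => ∅
  | .cat a b => a.CN ∪ b.CN
  | .proj a C => a.CN ∩ (C : Set S.Chan)

def ITerm.CN : ITerm S → Set S.Chan
  | .var _ => ∅
  | .zero => ∅
  | .one => ∅
  | .add a b => a.CN ∪ b.CN
  | .len a => a.CN

def RTerm.CN : RTerm S → Set S.Chan
  | .var _ => ∅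
  | .const _ => ∅
  | .add a b => a.CN ∪ b.CN
  | .mul a b => a.CN ∪ b.CN
  | .val a i => a.CN ∪ i.CN
  | .stamp a i => a.CN ∪ i.CN

def CTerm.CN : CTerm S → Set S.Chan
  | .ch _ => ∅
  | .chan a i => a.CN ∪ i.CN

def FolRA.FV : FolRA S → Set (Var S)
  | .eq p q => p.FV ∪ q.FV
  | .ge p q => p.FV ∪ q.FV
  | .not a => a.FV
  | .and a b => a.FV ∪ b.FV
  | .or a b => a.FV ∪ b.FV
  | .imp a b => a.FV ∪ b.FV
  | .all x a => a.FV \ {.r x}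
  | .ex x a => a.FV \ {.r x}

/-- The left-hand sides of a list of assignments or differential equations. -/
def lhs (l : List (S.RVar × Poly S)) : Set (Var S) := {z | ∃ p ∈ l, z = Var.r p.1}

/-- The free variables of the right-hand sides. -/
def rhsFV (l : List (S.RVar × Poly S)) : Set (Var S) := {z | ∃ p ∈ l, z ∈ p.2.FV}

/-- Bound variables. -/
def Prog.BV : Prog S → Set (Var S)
  | .assign l => lhs l
  | .nondet x => {.r x}
  | .ode l _ => lhs l ∪ {.r S.mu}
  | .test _ => ∅
  | .seq a b => a.BV ∪ b.BV
  | .choice a b => a.BV ∪ b.BV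
  | .star a => a.BV
  | .send _ h _ => {.t h}
  | .recv _ h x => {.t h, .r x}
  | .par a b => a.BV ∪ b.BV

/-- Must-bound variables. -/
def Prog.MBV : Prog S → Set (Var S)
  | .assign l => lhs l
  | .nondet x => {.r x}
  | .ode l _ => lhs l ∪ {.r S.mu}
  | .test _ => ∅
  | .seq a b => a.MBV ∪ b.MBV
  | .choice a b => a.MBV ∩ b.MBV
  | .star _ => ∅
  | .send _ h _ => {.t h}
  | .recv _ h x => {.t h, .r x}
  | .par a b => a.MBV ∪ b.MBV

/-- Free variables of programs. -/
def Prog.FV : Prog S → Set (Var S)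
  | .assign l => rhsFV l
  | .nondet _ => ∅
  | .ode l χ => lhs l ∪ {.r S.mu} ∪ rhsFV l ∪ χ.FV
  | .test χ => χ.FV
  | .seq a b => a.FV ∪ (b.FV \ a.MBV)
  | .choice a b => a.FV ∪ b.FV
  | .star a => a.FV
  | .send _ h p => {.t h, .r S.mu} ∪ p.FV
  | .recv _ h _ => {.t h, .r S.mu}
  | .par a b => a.FV ∪ b.FV

/-- All variables, read or written, of a program. -/
def Prog.V (a : Prog S) : Set (Var S) := a.FV ∪ a.BV

/-- Channel names of programs. -/
def Prog.CN : Prog S → Set S.Chan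
  | .assign _ => ∅
  | .nondet _ => ∅
  | .ode _ _ => ∅
  | .test _ => ∅
  | .seq a b => a.CN ∪ b.CN
  | .choice a b => a.CN ∪ b.CN
  | .star a => a.CN
  | .send c _ _ => {c}
  | .recv c _ _ => {c}
  | .par a b => a.CN ∪ b.CN

/-- Free variables of formulas. -/
def Fml.FV : Fml S → Set (Var S)
  | .eqR a b => a.FV ∪ b.FV
  | .eqI a b => a.FV ∪ b.FV
  | .eqC a b => a.FV ∪ b.FV
  | .eqT a b => a.FV ∪ b.FV
  | .geR a b => a.FV ∪ b.FV
  | .geI a b => a.FV ∪ b.FV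
  | .leT a b => a.FV ∪ b.FV
  | .not a => a.FV
  | .and a b => a.FV ∪ b.FV
  | .or a b => a.FV ∪ b.FV
  | .imp a b => a.FV ∪ b.FV
  | .all z a => a.FV \ {z}
  | .ex z a => a.FV \ {z}
  | .box α a => α.FV ∪ (a.FV \ α.MBV)
  | .acbox α A C a => (α.FV ∪ (a.FV \ α.MBV)) ∪ A.FV ∪ C.FV

/-- Accessed channels of formulas. -/
def Fml.CN : Fml S → Set S.Chan
  | .eqR a b => a.CN ∪ b.CN
  | .eqI a b => a.CN ∪ b.CN
  | .eqC a b => a.CN ∪ b.CN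
  | .eqT a b => a.CN ∪ b.CN
  | .geR a b => a.CN ∪ b.CN
  | .geI a b => a.CN ∪ b.CN
  | .leT a b => a.CN ∪ b.CN
  | .not a => a.CN
  | .and a b => a.CN ∪ b.CN
  | .or a b => a.CN ∪ b.CN
  | .imp a b => a.CN ∪ b.CN
  | .all _ a => a.CN
  | .ex _ a => a.CN
  | .box _ a => a.CN
  | .acbox _ A C a => a.CN ∪ A.CN ∪ C.CN

/-! ### Well-formedness -/

/-- The program contains an assignment (deterministic, nondeterministic, or by a receive) to the
global time. Continuous evolution does not count. -/
def Prog.AssignsTime : Prog S → Prop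
  | .assign l => Var.r S.mu ∈ lhs l
  | .nondet x => x = S.mu
  | .ode _ _ => False
  | .test _ => False
  | .seq a b => a.AssignsTime ∨ b.AssignsTime
  | .choice a b => a.AssignsTime ∨ b.AssignsTime
  | .star a => a.AssignsTime
  | .send _ _ _ => False
  | .recv _ _ x => x = S.mu
  | .par a b => a.AssignsTime ∨ b.AssignsTime

/-- Well-formed programs: an assignment has pairwise distinct targets; a differential equation system
has one right-hand side per variable, and the right-hand side of the global time is `1`; a receive
does not write the global time; parallel programs share no state (global time and trace variables
excepted) and do not assign the global time. -/
def Prog.WF : Prog S → Prop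
  | .assign l => (l.map Prod.fst).Nodup
  | .nondet _ => True
  | .ode l _ => (∀ x p q, (x, p) ∈ l → (x, q) ∈ l → p = q) ∧ ∀ p, (S.mu, p) ∈ l → p = .const 1
  | .test _ => True
  | .seq a b => a.WF ∧ b.WF
  | .choice a b => a.WF ∧ b.WF
  | .star a => a.WF
  | .send _ _ _ => True
  | .recv _ _ x => x ≠ S.mu
  | .par a b => a.WF ∧ b.WF ∧ ¬ a.AssignsTime ∧ ¬ b.AssignsTime ∧
      a.V ∩ b.BV ⊆ {.r S.mu} ∪ TV S ∧ b.V ∩ a.BV ⊆ {.r S.mu} ∪ TV S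

/-- Well-formed formulas: all programs are well-formed, and in every ac-box `[α]{A,C}ψ` the
formulas `A` and `C` do not refer to the state and time of `α`. -/
def Fml.WF : Fml S → Prop
  | .eqR _ _ => True
  | .eqI _ _ => True
  | .eqC _ _ => True
  | .eqT _ _ => True
  | .geR _ _ => True
  | .geI _ _ => True
  | .leT _ _ => True
  | .not a => a.WF
  | .and a b => a.WF ∧ b.WF
  | .or a b => a.WF ∧ b.WF
  | .imp a b => a.WF ∧ b.WF
  | .all _ a => a.WF
  | .ex _ a => a.WF
  | .box α a => α.WF ∧ a.WF
  | .acbox α A C a => α.WF ∧ A.WF ∧ C.WF ∧ a.WF ∧ (A.FV ∪ C.FV) ∩ α.BV ⊆ TV S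

/-! ### Traces and states -/

/-- A (raw) communication event: channel, value, timestamp. -/
structure Event (S : Sig.{u}) : Type u where
  ch : S.Chan
  val : ℝ
  time : ℝ

/-- Raw traces. -/
abbrev Trace (S : Sig.{u}) := List (Event S)

/-- Recorded traces: every event carries its recorder variable. -/
abbrev RecTrace (S : Sig.{u}) := List (S.TVar × Event S)

/-- States. -/
@[ext] structure State (S : Sig.{u}) : Type u where
  r : S.RVar → ℝ
  n : S.NVar → ℕ
  t : S.TVar → Trace S

open Classical in
/-- Updated states, one for each sort of variable. -/
noncomputable def State.setR (v : State S) (x : S.RVar) (d : ℝ) : State S :=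
  { v with r := Function.update v.r x d }

open Classical in
noncomputable def State.setN (v : State S) (i : S.NVar) (d : ℕ) : State S :=
  { v with n := Function.update v.n i d }

open Classical in
noncomputable def State.setT (v : State S) (h : S.TVar) (d : Trace S) : State S :=
  { v with t := Function.update v.t h d }

open Classical in
/-- Projection of a raw trace onto a set of channels. -/
noncomputable def Trace.proj (τ : Trace S) (C : Set S.Chan) : Trace S :=
  τ.filter (fun e => decide (e.ch ∈ C))

open Classical in
/-- Projection of a recorded trace onto a set of channels. -/
noncomputable def RecTrace.proj (τ : RecTrace S) (C : Set S.Chan) : RecTrace S :=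
  τ.filter (fun e => decide (e.2.ch ∈ C))

open Classical in
/-- `τ(h)`: the raw versions of the events recorded by `h`. -/
noncomputable def RecTrace.sub (τ : RecTrace S) (h : S.TVar) : Trace S :=
  (τ.filter (fun e => decide (e.1 = h))).map Prod.snd

/-- State-trace concatenation `v · τ`. -/
noncomputable def State.app (v : State S) (τ : RecTrace S) : State S :=
  { v with t := fun h => v.t h ++ RecTrace.sub τ h }

/-- Chronological recorded traces. -/
def RecTrace.Chronological (τ : RecTrace S) : Prop :=
  List.Pairwise (fun a b => a.2.time ≤ b.2.time) τ

/-! ### Semantics of terms -/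

/-- Value of a polynomial. -/
noncomputable def Poly.eval (v : S.RVar → ℝ) : Poly S → ℝ
  | .var x => v x
  | .const q => (q : ℝ)
  | .add p q => p.eval v + q.eval v
  | .mul p q => p.eval v * q.eval v

noncomputable def TTerm.eval (v : State S) : TTerm S → Trace S
  | .var h => v.t h
  | .eps => []
  | .item c p q => [⟨c, p.eval v.r, q.eval v.r⟩]
  | .cat a b => a.eval v ++ b.eval v
  | .proj a C => Trace.proj (a.eval v) (C : Set S.Chan)

noncomputable def ITerm.eval (v : State S) : ITerm S → ℕ
  | .var i => v.n i
  | .zero => 0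
  | .one => 1
  | .add a b => a.eval v + b.eval v
  | .len a => (a.eval v).length

/-- Value, timestamp and channel of the `k`-th event (counted from 0); out of range, these are `0`,
`0` and the fixed channel name. -/
noncomputable def Trace.valAt (τ : Trace S) (k : ℕ) : ℝ := (τ[k]?).elim 0 Event.val

noncomputable def Trace.timeAt (τ : Trace S) (k : ℕ) : ℝ := (τ[k]?).elim 0 Event.time

def Trace.chanAt (τ : Trace S) (k : ℕ) : S.Chan := (τ[k]?).elim S.someChan Event.ch

noncomputable def RTerm.eval (v : State S) : RTerm S → ℝ
  | .var x => v.r x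
  | .const q => (q : ℝ)
  | .add a b => a.eval v + b.eval v
  | .mul a b => a.eval v * b.eval v
  | .val a i => Trace.valAt (a.eval v) (i.eval v)
  | .stamp a i => Trace.timeAt (a.eval v) (i.eval v)

noncomputable def CTerm.eval (v : State S) : CTerm S → S.Chan
  | .ch c => c
  | .chan a i => Trace.chanAt (a.eval v) (i.eval v)

/-- Satisfaction of formulas of real arithmetic. -/
def FolRA.Sat : FolRA S → State S → Prop
  | .eq p q, v => p.eval v.r = q.eval v.r
  | .ge p q, v => p.eval v.r ≥ q.eval v.r
  | .not a, v => ¬ a.Sat v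
  | .and a b, v => a.Sat v ∧ b.Sat v
  | .or a b, v => a.Sat v ∨ b.Sat v
  | .imp a b, v => a.Sat v → b.Sat v
  | .all x a, v => ∀ d : ℝ, a.Sat (v.setR x d)
  | .ex x a, v => ∃ d : ℝ, a.Sat (v.setR x d)

/-! ### Semantics of programs -/

/-- Computations: initial state, communication, final state; `none` is `⊥` (unfinished). -/
abbrev Comp (S : Sig.{u}) := State S × RecTrace S × Option (State S)

/-- The order `⪯` on observable behavior. -/
def ObsLE (o' o : RecTrace S × Option (State S)) : Prop :=
  (o'.2 = o.2 ∧ o'.1 = o.1) ∨ (o'.2 = none ∧ o'.1 <+: o.1)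

/-- The computations `(v, ε, ⊥)`. -/
def leastComps (S : Sig.{u}) : Set (Comp S) := {c | c.2.1 = [] ∧ c.2.2 = none}

/-- `U_⊥`. -/
def botOp (U : Set (Comp S)) : Set (Comp S) :=
  {c | c.2.2 = none ∧ ∃ w, (c.1, c.2.1, w) ∈ U}

/-- `U ▹ M`. -/
def contOp (U M : Set (Comp S)) : Set (Comp S) :=
  {c | ∃ τ₁ τ₂ u, (c.1, τ₁, some u) ∈ U ∧ (u, τ₂, c.2.2) ∈ M ∧ c.2.1 = τ₁ ++ τ₂}

/-- `U ∘ M = U_⊥ ∪ (U ▹ M)`. -/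
def seqOp (U M : Set (Comp S)) : Set (Comp S) := botOp U ∪ contOp U M

/-- Semantic iteration. -/
def iterOp (U : Set (Comp S)) : ℕ → Set (Comp S)
  | 0 => leastComps S ∪ {c | c.2.1 = [] ∧ c.2.2 = some c.1}
  | k + 1 => seqOp U (iterOp U k)

/-- Simultaneous substitution determined by a list of pairs; the identity off the list. -/
noncomputable def listSub : List (S.RVar × Poly S) → S.RVar → Poly S
  | [], x => .var x
  | p :: l, x => open Classical in if x = p.1 then p.2 else listSub l x

/-- The state reached by a simultaneous assignment. -/
noncomputable def State.assign (v : State S) (l : List (S.RVar × Poly S)) : State S :=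
  { v with r := fun x => (listSub l x).eval v.r }

/-- `φ : [0, d] → states` solves `mu' = 1, x' = θ & χ`. -/
def SolvesODE (l : List (S.RVar × Poly S)) (χ : FolRA S) (d : ℝ) (φ : ℝ → State S) : Prop :=
  ∀ s ∈ Set.Icc (0 : ℝ) d,
    HasDerivWithinAt (fun s' => (φ s').r S.mu) 1 (Set.Icc 0 d) s ∧
    (∀ p ∈ l, HasDerivWithinAt (fun s' => (φ s').r p.1) (p.2.eval (φ s).r) (Set.Icc 0 d) s) ∧
    χ.Sat (φ s) ∧
    (∀ y, Var.r y ∉ lhs l ∪ {.r S.mu} → (φ s).r y = (φ 0).r y) ∧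
    (φ s).n = (φ 0).n ∧ (φ s).t = (φ 0).t

open Classical in
/-- Merge of two states: values from the first on `B`, from the second off `B`. -/
noncomputable def mergeState (B : Set (Var S)) (w w' : State S) : State S where
  r := fun x => if Var.r x ∈ B then w.r x else w'.r x
  n := fun i => if Var.n i ∈ B then w.n i else w'.n i
  t := fun h => if Var.t h ∈ B then w.t h else w'.t h

/-- Merge of final states; `⊥` as soon as one of them is `⊥`. -/
noncomputable def merge (B : Set (Var S)) : Option (State S) → Option (State S) → Option (State S)
  | some w, some w' => some (mergeState B w w')
  | _, _ => none

/-- Two final states agree on the global time (vacuous if one of them is `⊥`). -/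
def SameTime (o o' : Option (State S)) : Prop :=
  ∀ w w', o = some w → o' = some w' → w.r S.mu = w'.r S.mu

/-- Denotational semantics of programs. -/
noncomputable def Prog.sem : Prog S → Set (Comp S)
  | .assign l => leastComps S ∪ {c | c.2.1 = [] ∧ c.2.2 = some (c.1.assign l)}
  | .nondet x => leastComps S ∪ {c | c.2.1 = [] ∧ ∃ a : ℝ, c.2.2 = some (c.1.setR x a)}
  | .ode l χ => leastComps S ∪ {c | c.2.1 = [] ∧ ∃ d : ℝ, 0 ≤ d ∧ ∃ φ : ℝ → State S,
      SolvesODE l χ d φ ∧ c.1 = φ 0 ∧ c.2.2 = some (φ d)}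
  | .test χ => leastComps S ∪ {c | c.2.1 = [] ∧ c.2.2 = some c.1 ∧ χ.Sat c.1}
  | .seq a b => seqOp a.sem b.sem
  | .choice a b => a.sem ∪ b.sem
  | .star a => ⋃ k : ℕ, iterOp a.sem k
  | .send ch h p => {c | ObsLE c.2 ([(h, ⟨ch, p.eval c.1.r, c.1.r S.mu⟩)], some c.1)}
  | .recv ch h x => {c | ∃ a : ℝ, ObsLE c.2 ([(h, ⟨ch, a, c.1.r S.mu⟩)], some (c.1.setR x a))}
  | .par a b => {c | ∃ w₁ w₂,
      (c.1, RecTrace.proj c.2.1 a.CN, w₁) ∈ a.sem ∧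
      (c.1, RecTrace.proj c.2.1 b.CN, w₂) ∈ b.sem ∧
      SameTime w₁ w₂ ∧
      RecTrace.Chronological c.2.1 ∧
      c.2.1 = RecTrace.proj c.2.1 (a.CN ∪ b.CN) ∧
      c.2.2 = merge a.BV w₁ w₂}

/-! ### Semantics of formulas -/

/-- Satisfaction. -/
def Fml.Sat : Fml S → State S → Prop
  | .eqR a b, v => a.eval v = b.eval v
  | .eqI a b, v => a.eval v = b.eval v
  | .eqC a b, v => a.eval v = b.eval v
  | .eqT a b, v => a.eval v = b.eval v
  | .geR a b, v => a.eval v ≥ b.eval v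
  | .geI a b, v => a.eval v ≥ b.eval v
  | .leT a b, v => a.eval v <+: b.eval v
  | .not a, v => ¬ a.Sat v
  | .and a b, v => a.Sat v ∧ b.Sat v
  | .or a b, v => a.Sat v ∨ b.Sat v
  | .imp a b, v => a.Sat v → b.Sat v
  | .all (.r x) a, v => ∀ d : ℝ, a.Sat (v.setR x d)
  | .all (.n i) a, v => ∀ d : ℕ, a.Sat (v.setN i d)
  | .all (.t h) a, v => ∀ d : Trace S, a.Sat (v.setT h d)
  | .ex (.r x) a, v => ∃ d : ℝ, a.Sat (v.setR x d)
  | .ex (.n i) a, v => ∃ d : ℕ, a.Sat (v.setN i d)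
  | .ex (.t h) a, v => ∃ d : Trace S, a.Sat (v.setT h d)
  | .box α a, v => ∀ τ w, (v, τ, some w) ∈ α.sem → a.Sat (w.app τ)
  | .acbox α A C a, v => ∀ τ o, (v, τ, o) ∈ α.sem →
      ((∀ τ', τ' <+: τ → τ' ≠ τ → A.Sat (v.app τ')) → C.Sat (v.app τ)) ∧
      (∀ w, o = some w → (∀ τ', τ' <+: τ → A.Sat (v.app τ')) → a.Sat (w.app τ))

/-- Validity: truth in all states. -/
def Fml.Valid (a : Fml S) : Prop := ∀ v, a.Sat v

/-! ### Substitution of polynomials for real variables -/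

/-- A substitution; it is the identity on `x` if `σ x = .var x`. -/
abbrev Sub (S : Sig.{u}) := S.RVar → Poly S

open Classical in
/-- `σ` made the identity on `X`. -/
noncomputable def Sub.off (σ : Sub S) (X : Set (Var S)) : Sub S :=
  fun x => if Var.r x ∈ X then .var x else σ x

/-- No capture: a variable that is replaced and is free (in `F`) is not itself in `B`, and its
replacement mentions no variable in `B`. -/
def Sub.NoCapture (σ : Sub S) (F B : Set (Var S)) : Prop :=
  ∀ x, Var.r x ∈ F → σ x ≠ .var x → Var.r x ∉ B ∧ (σ x).FV ∩ B = ∅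

def Poly.subst (σ : Sub S) : Poly S → Poly S
  | .var x => σ x
  | .const q => .const q
  | .add p q => .add (p.subst σ) (q.subst σ)
  | .mul p q => .mul (p.subst σ) (q.subst σ)

def TTerm.subst (σ : Sub S) : TTerm S → TTerm S
  | .var h => .var h
  | .eps => .eps
  | .item c p q => .item c (p.subst σ) (q.subst σ)
  | .cat a b => .cat (a.subst σ) (b.subst σ)
  | .proj a C => .proj (a.subst σ) C

def ITerm.subst (σ : Sub S) : ITerm S → ITerm S
  | .var i => .var i
  | .zero => .zero
  | .one => .one
  | .add a b => .add (a.subst σ) (b.subst σ)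
  | .len a => .len (a.subst σ)

def RTerm.subst (σ : Sub S) : RTerm S → RTerm S
  | .var x => (σ x).toR
  | .const q => .const q
  | .add a b => .add (a.subst σ) (b.subst σ)
  | .mul a b => .mul (a.subst σ) (b.subst σ)
  | .val a i => .val (a.subst σ) (i.subst σ)
  | .stamp a i => .stamp (a.subst σ) (i.subst σ)

def CTerm.subst (σ : Sub S) : CTerm S → CTerm S
  | .ch c => .ch c
  | .chan a i => .chan (a.subst σ) (i.subst σ)

/-- Replaces the free occurrences only. -/
noncomputable def FolRA.subst : Sub S → FolRA S → FolRA S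
  | σ, .eq p q => .eq (p.subst σ) (q.subst σ)
  | σ, .ge p q => .ge (p.subst σ) (q.subst σ)
  | σ, .not a => .not (a.subst σ)
  | σ, .and a b => .and (a.subst σ) (b.subst σ)
  | σ, .or a b => .or (a.subst σ) (b.subst σ)
  | σ, .imp a b => .imp (a.subst σ) (b.subst σ)
  | σ, .all x a => .all x (a.subst (σ.off {.r x}))
  | σ, .ex x a => .ex x (a.subst (σ.off {.r x}))

/-- Admissibility: no variable is captured. -/
def FolRA.Adm : Sub S → FolRA S → Prop
  | _, .eq _ _ => True
  | _, .ge _ _ => True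
  | σ, .not a => a.Adm σ
  | σ, .and a b => a.Adm σ ∧ b.Adm σ
  | σ, .or a b => a.Adm σ ∧ b.Adm σ
  | σ, .imp a b => a.Adm σ ∧ b.Adm σ
  | σ, .all x a => a.Adm (σ.off {.r x}) ∧ σ.NoCapture (a.FV \ {.r x}) {.r x}
  | σ, .ex x a => a.Adm (σ.off {.r x}) ∧ σ.NoCapture (a.FV \ {.r x}) {.r x}

/-- Replaces the free occurrences; after a program, the variables it must bind are no longer
replaced. -/
noncomputable def Prog.subst : Sub S → Prog S → Prog S
  | σ, .assign l => .assign (l.map fun p => (p.1, p.2.subst σ))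
  | _, .nondet x => .nondet x
  | σ, .ode l χ => .ode (l.map fun p => (p.1, p.2.subst σ)) (χ.subst σ)
  | σ, .test χ => .test (χ.subst σ)
  | σ, .seq a b => .seq (a.subst σ) (b.subst (σ.off a.MBV))
  | σ, .choice a b => .choice (a.subst σ) (b.subst σ)
  | σ, .star a => .star (a.subst σ)
  | σ, .send c h p => .send c h (p.subst σ)
  | _, .recv c h x => .recv c h x
  | σ, .par a b => .par (a.subst σ) (b.subst σ)

/-- Admissibility for programs. Communication reads the global time implicitly, hence the global
time must not be replaced there. -/
def Prog.Adm : Sub S → Prog S → Prop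
  | _, .assign _ => True
  | _, .nondet _ => True
  | σ, .ode l χ => χ.Adm σ ∧ σ.NoCapture (Prog.ode l χ).FV (Prog.ode l χ).BV
  | σ, .test χ => χ.Adm σ
  | σ, .seq a b => a.Adm σ ∧ b.Adm (σ.off a.MBV) ∧ σ.NoCapture (b.FV \ a.MBV) a.BV
  | σ, .choice a b => a.Adm σ ∧ b.Adm σ
  | σ, .star a => a.Adm σ ∧ σ.NoCapture a.FV a.BV
  | σ, .send _ _ _ => σ S.mu = .var S.mu
  | σ, .recv _ _ _ => σ S.mu = .var S.mu
  | σ, .par a b => a.Adm σ ∧ b.Adm σ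

noncomputable def Fml.subst : Sub S → Fml S → Fml S
  | σ, .eqR a b => .eqR (a.subst σ) (b.subst σ)
  | σ, .eqI a b => .eqI (a.subst σ) (b.subst σ)
  | σ, .eqC a b => .eqC (a.subst σ) (b.subst σ)
  | σ, .eqT a b => .eqT (a.subst σ) (b.subst σ)
  | σ, .geR a b => .geR (a.subst σ) (b.subst σ)
  | σ, .geI a b => .geI (a.subst σ) (b.subst σ)
  | σ, .leT a b => .leT (a.subst σ) (b.subst σ)
  | σ, .not a => .not (a.subst σ)
  | σ, .and a b => .and (a.subst σ) (b.subst σ)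
  | σ, .or a b => .or (a.subst σ) (b.subst σ)
  | σ, .imp a b => .imp (a.subst σ) (b.subst σ)
  | σ, .all z a => .all z (a.subst (σ.off {z}))
  | σ, .ex z a => .ex z (a.subst (σ.off {z}))
  | σ, .box α a => .box (α.subst σ) (a.subst (σ.off α.MBV))
  | σ, .acbox α A C a => .acbox (α.subst σ) (A.subst σ) (C.subst σ) (a.subst (σ.off α.MBV))

/-- Admissibility for formulas. -/
def Fml.Adm : Sub S → Fml S → Prop
  | _, .eqR _ _ => True
  | _, .eqI _ _ => True
  | _, .eqC _ _ => True
  | _, .eqT _ _ => True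
  | _, .geR _ _ => True
  | _, .geI _ _ => True
  | _, .leT _ _ => True
  | σ, .not a => a.Adm σ
  | σ, .and a b => a.Adm σ ∧ b.Adm σ
  | σ, .or a b => a.Adm σ ∧ b.Adm σ
  | σ, .imp a b => a.Adm σ ∧ b.Adm σ
  | σ, .all z a => a.Adm (σ.off {z}) ∧ σ.NoCapture (a.FV \ {z}) {z}
  | σ, .ex z a => a.Adm (σ.off {z}) ∧ σ.NoCapture (a.FV \ {z}) {z}
  | σ, .box α a => α.Adm σ ∧ a.Adm (σ.off α.MBV) ∧ σ.NoCapture (a.FV \ α.MBV) α.BV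
  | σ, .acbox α A C a => α.Adm σ ∧ A.Adm σ ∧ C.Adm σ ∧ a.Adm (σ.off α.MBV) ∧
      σ.NoCapture (a.FV \ α.MBV) α.BV

/-! ### Renaming of a trace variable -/

open Classical in
/-- The trace variable `h` becomes `k`. -/
noncomputable def renVar (h k g : S.TVar) : S.TVar := if g = h then k else g

noncomputable def TTerm.ren (h k : S.TVar) : TTerm S → TTerm S
  | .var g => .var (renVar h k g)
  | .eps => .eps
  | .item c p q => .item c p q
  | .cat a b => .cat (a.ren h k) (b.ren h k)
  | .proj a C => .proj (a.ren h k) C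

noncomputable def ITerm.ren (h k : S.TVar) : ITerm S → ITerm S
  | .var i => .var i
  | .zero => .zero
  | .one => .one
  | .add a b => .add (a.ren h k) (b.ren h k)
  | .len a => .len (a.ren h k)

noncomputable def RTerm.ren (h k : S.TVar) : RTerm S → RTerm S
  | .var x => .var x
  | .const q => .const q
  | .add a b => .add (a.ren h k) (b.ren h k)
  | .mul a b => .mul (a.ren h k) (b.ren h k)
  | .val a i => .val (a.ren h k) (i.ren h k)
  | .stamp a i => .stamp (a.ren h k) (i.ren h k)

noncomputable def CTerm.ren (h k : S.TVar) : CTerm S → CTerm S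
  | .ch c => .ch c
  | .chan a i => .chan (a.ren h k) (i.ren h k)

/-- In programs, the recorder variables of the communication statements are renamed. -/
noncomputable def Prog.ren (h k : S.TVar) : Prog S → Prog S
  | .assign l => .assign l
  | .nondet x => .nondet x
  | .ode l χ => .ode l χ
  | .test χ => .test χ
  | .seq a b => .seq (a.ren h k) (b.ren h k)
  | .choice a b => .choice (a.ren h k) (b.ren h k)
  | .star a => .star (a.ren h k)
  | .send c g p => .send c (renVar h k g) p
  | .recv c g x => .recv c (renVar h k g) x
  | .par a b => .par (a.ren h k) (b.ren h k)

open Classical in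
/-- In formulas, occurrences in the scope of a quantifier over `h` are not renamed. -/
noncomputable def Fml.ren (h k : S.TVar) : Fml S → Fml S
  | .eqR a b => .eqR (a.ren h k) (b.ren h k)
  | .eqI a b => .eqI (a.ren h k) (b.ren h k)
  | .eqC a b => .eqC (a.ren h k) (b.ren h k)
  | .eqT a b => .eqT (a.ren h k) (b.ren h k)
  | .geR a b => .geR (a.ren h k) (b.ren h k)
  | .geI a b => .geI (a.ren h k) (b.ren h k)
  | .leT a b => .leT (a.ren h k) (b.ren h k)
  | .not a => .not (a.ren h k)
  | .and a b => .and (a.ren h k) (b.ren h k)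
  | .or a b => .or (a.ren h k) (b.ren h k)
  | .imp a b => .imp (a.ren h k) (b.ren h k)
  | .all z a => if z = .t h then .all z a else .all z (a.ren h k)
  | .ex z a => if z = .t h then .ex z a else .ex z (a.ren h k)
  | .box α a => .box (α.ren h k) (a.ren h k)
  | .acbox α A C a => .acbox (α.ren h k) (A.ren h k) (C.ren h k) (a.ren h k)

/-- All variables that occur in a formula, free or bound. -/
def Fml.vars : Fml S → Set (Var S)
  | .eqR a b => a.FV ∪ b.FV
  | .eqI a b => a.FV ∪ b.FV
  | .eqC a b => a.FV ∪ b.FV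
  | .eqT a b => a.FV ∪ b.FV
  | .geR a b => a.FV ∪ b.FV
  | .geI a b => a.FV ∪ b.FV
  | .leT a b => a.FV ∪ b.FV
  | .not a => a.vars
  | .and a b => a.vars ∪ b.vars
  | .or a b => a.vars ∪ b.vars
  | .imp a b => a.vars ∪ b.vars
  | .all z a => {z} ∪ a.vars
  | .ex z a => {z} ∪ a.vars
  | .box α a => α.V ∪ a.vars
  | .acbox α A C a => α.V ∪ A.vars ∪ C.vars ∪ a.vars

/-! ### The calculus -/

/-- `β` does not interfere with `[α]{A,C}ψ`. -/
structure NonInterfering (α β : Prog S) (A C ψ : Fml S) : Prop where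
  post : ψ.FV ∩ β.BV ⊆ {.r S.mu} ∪ TV S
  assumption : A.FV ∩ β.BV ⊆ TV S
  commitment : C.FV ∩ β.BV ⊆ TV S
  chanA : A.CN ∩ β.CN ⊆ α.CN
  chanC : C.CN ∩ β.CN ⊆ α.CN
  chanPost : ψ.CN ∩ β.CN ⊆ α.CN

/-- The compositionality condition `(A ∧ C₁ → A₂) ∧ (A ∧ C₂ → A₁)`. -/
def compCond (A A₁ A₂ C₁ C₂ : Fml S) : Fml S :=
  .and (.imp (.and A C₁) A₂) (.imp (.and A C₂) A₁)

open Classical in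
/-- The polynomials `ys` (in the time variable `t` and the initial values) solve `x' = θ`, given by
`l`, as a symbolic initial value problem: `y(0) = x` and `y'(t) = θ(y(t))`. -/
def IsSolution (l : List (S.RVar × Poly S)) (ys : List (Poly S)) (t : S.RVar) : Prop :=
  let y : Sub S := listSub ((l.map Prod.fst).zip ys)
  ∀ v : S.RVar → ℝ, ∀ p ∈ l,
    (y p.1).eval (Function.update v t 0) = v p.1 ∧
    ∀ s : ℝ, 0 ≤ s →
      HasDerivAt (fun s' => (y p.1).eval (Function.update v t s'))
        (p.2.eval (fun z => (y z).eval (Function.update v t s))) s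

/-- `α⁰`, the test of true. -/
def progZero : Prog S := .test .tt

/-- The axioms. -/
inductive Ax : Fml S → Prop
  | assign (l : List (S.RVar × Poly S)) (ψ : Fml S) (h : ψ.Adm (listSub l)) :
      Ax (.iff (.box (.assign l) ψ) (ψ.subst (listSub l)))
  | nondetAssign (x : S.RVar) (ψ : Fml S) :
      Ax (.iff (.box (.nondet x) ψ) (.all (.r x) ψ))
  | test (χ : FolRA S) (ψ : Fml S) :
      Ax (.iff (.box (.test χ) ψ) (.imp χ.toFml ψ))
  | boxesDual (α : Prog S) (ψ : Fml S) :
      Ax (.iff (.box α ψ) (.acbox α .tt .tt ψ))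
  | acComposition (α β : Prog S) (A C ψ : Fml S) :
      Ax (.iff (.acbox (.seq α β) A C ψ) (.acbox α A C (.acbox β A C ψ)))
  | acChoice (α β : Prog S) (A C ψ : Fml S) :
      Ax (.iff (.acbox (.choice α β) A C ψ) (.and (.acbox α A C ψ) (.acbox β A C ψ)))
  | acIteration (α : Prog S) (A C ψ : Fml S) :
      Ax (.iff (.acbox (.star α) A C ψ)
        (.and (.acbox progZero A C ψ) (.acbox α A C (.acbox (.star α) A C ψ))))
  | acInduction (α : Prog S) (A C ψ : Fml S) :
      Ax (.iff (.acbox (.star α) A C ψ)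
        (.and (.acbox progZero A C ψ) (.acbox (.star α) A .tt (.imp ψ (.acbox α A C ψ)))))
  | gtime (l : List (S.RVar × Poly S)) (χ : FolRA S) (ψ : Fml S) :
      Ax (.iff (.box (.ode l χ) ψ) (.box (.ode ((S.mu, .const 1) :: l) χ) ψ))
  | solution (l : List (S.RVar × Poly S)) (ys : List (Poly S)) (t : S.RVar) (ψ : Fml S)
      (hlen : ys.length = l.length) (hmu : Var.r S.mu ∈ lhs l)
      (ht : Var.r t ∉ lhs l ∪ rhsFV l ∪ ψ.FV) (hsol : IsSolution l ys t) :
      Ax (.iff (.box (.ode l .tt) ψ)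
        (.all (.r t) (.imp (.geR (.var t) (.const 0))
          (.box (.assign ((l.map Prod.fst).zip ys)) ψ))))
  | send (c : S.Chan) (h h₀ : S.TVar) (p : Poly S) (ψ : Fml S)
      (hne : h₀ ≠ h) (hfresh : Var.t h₀ ∉ ψ.vars) :
      Ax (.iff (.box (.send c h p) ψ)
        (.all (.t h₀) (.imp
          (.eqT (.var h₀) (.cat (.var h) (.item c p (.var S.mu)))) (ψ.ren h h₀))))
  | acCom (c : S.Chan) (h : S.TVar) (p : Poly S) (A C ψ : Fml S) :
      Ax (.iff (.acbox (.send c h p) A C ψ)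
        (.and C (.imp A (.box (.send c h p) (.and C (.imp A ψ))))))
  | comDual (c : S.Chan) (h : S.TVar) (x : S.RVar) (A C ψ : Fml S) :
      Ax (.iff (.acbox (.recv c h x) A C ψ)
        (.box (.nondet x) (.acbox (.send c h (.var x)) A C ψ)))
  | K (α : Prog S) (A A₁ A₂ C₁ C₂ ψ : Fml S) (zs : List (Var S))
      (hzs : ∀ z, z ∈ zs ↔ z ∈ (compCond A A₁ A₂ C₁ C₂).FV) :
      Ax (.imp
        (.and (.allList zs (compCond A A₁ A₂ C₁ C₂)) (.acbox α (.and A₁ A₂) (.and C₁ C₂) ψ))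
        (.acbox α A (.and C₁ C₂) ψ))
  | acDropComp (α β : Prog S) (A C ψ : Fml S) (h : NonInterfering α β A C ψ) :
      Ax (.imp (.acbox α A C ψ) (.acbox (.par α β) A C ψ))
  | acNoCom (α : Prog S) (A C ψ : Fml S) (h : α.CN = ∅) :
      Ax (.iff (.acbox α A C ψ) (.and C (.imp A (.box α ψ))))
  | acWeak (α : Prog S) (A C ψ : Fml S) :
      Ax (.iff (.acbox α A C ψ) (.and C (.acbox α A C (.and C (.imp A ψ)))))
  | acBoxesDist (α : Prog S) (A C₁ C₂ ψ₁ ψ₂ : Fml S) :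
      Ax (.iff (.acbox α A (.and C₁ C₂) (.and ψ₁ ψ₂))
        (.and (.acbox α A C₁ ψ₁) (.acbox α A C₂ ψ₂)))

/-- The proof rules: `Rule Γ φ` says that `φ` follows from the premises `Γ`. -/
inductive Rule : List (Fml S) → Fml S → Prop
  | acMono (α : Prog S) (A₁ A₂ C₁ C₂ ψ₁ ψ₂ : Fml S) :
      Rule [.imp A₂ A₁, .imp C₁ C₂, .imp ψ₁ ψ₂]
        (.imp (.acbox α A₁ C₁ ψ₁) (.acbox α A₂ C₂ ψ₂))
  | acG (α : Prog S) (A C ψ : Fml S) :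
      Rule [.and C ψ] (.acbox α A C ψ)

end DLCHP

namespace DLCHP

universe u

variable {S : Sig.{u}}

/-! ### Traces and states -/

/-! Unfolding the boxes turns every axiom into a statement about the runs `(v, τ, w)` of its
programs. What makes these statements easy is that a run leaves the integer and trace variables of
the state alone: communication is collected in `τ` and appended only when a formula is evaluated.
Hence `w` differs from `v` at most in bound real variables (`Prog.frame`), and `A` and `C`, which by
well-formedness mention none of these, may be read in `v` or in `w` (`Fml.sat_frame`). Programs do
not read traces either, so a run from `v · τ` is a run from `v` with `τ` appended to its final state
(`Prog.mem_sem_app`).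

With these facts, acComposition reduces to splitting the prefixes of `τ₁ ++ τ₂`, and the loop axioms
to unrolling `α*` at its front or extending it at its end. K is an induction on the length of the
communication. It works because a commitment depends on the assumptions at earlier prefixes only,
and because every prefix of a communication belongs to an unfinished run
(`Prog.prefix_none_mem_sem`).

The axioms that compare different states rest on three further results. The substitution lemma
`Fml.sat_subst` matches the runs of `α.subst σ` and `α` by a bisimulation that preserves
communication; it yields assign. It compares traces only on the channels that a formula accesses, so
its instance for the identity substitution, `Fml.sat_congr_proj`, is a coincidence property up to
unseen channels. That is the core of acDropComp: a run of `α ∥ β` projects to a run of `α`, and the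
events lost are invisible to `A`, `C` and `ψ`. The renaming lemma `Fml.sat_ren` yields send.
Finally, polynomial vector fields are locally Lipschitz, so `SolvesODE.unique` identifies every
evolution with the symbolic one, which yields solution. -/

@[simp] theorem RecTrace.sub_nil (h : S.TVar) : RecTrace.sub ([] : RecTrace S) h = [] := rfl

@[simp] theorem RecTrace.sub_append (τ τ' : RecTrace S) (h : S.TVar) :
    RecTrace.sub (τ ++ τ') h = RecTrace.sub τ h ++ RecTrace.sub τ' h := by
  simp [RecTrace.sub]

@[simp] theorem Trace.proj_append (τ τ' : Trace S) (C : Set S.Chan) :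
    Trace.proj (τ ++ τ') C = Trace.proj τ C ++ Trace.proj τ' C := by
  simp [Trace.proj]

@[simp] theorem Trace.proj_univ (τ : Trace S) : Trace.proj τ Set.univ = τ := by
  simp [Trace.proj]

theorem Trace.proj_proj (τ : Trace S) (C D : Set S.Chan) :
    Trace.proj (Trace.proj τ C) D = Trace.proj τ (C ∩ D) := by
  simp only [Trace.proj, List.filter_filter]
  congr 1; funext e
  by_cases h1 : e.ch ∈ C <;> by_cases h2 : e.ch ∈ D <;> simp [h1, h2]

theorem Trace.proj_eq_of_subset {τ τ' : Trace S} {C D : Set S.Chan} (hDC : D ⊆ C)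
    (h : Trace.proj τ C = Trace.proj τ' C) : Trace.proj τ D = Trace.proj τ' D := by
  rw [← Set.inter_eq_self_of_subset_right hDC, ← Trace.proj_proj, h, Trace.proj_proj]

theorem RecTrace.proj_prefix {τ τ' : RecTrace S} (h : τ' <+: τ) (C : Set S.Chan) :
    RecTrace.proj τ' C <+: RecTrace.proj τ C := h.filter _

/-- Discarding events on channels outside `C` does not matter for a projection onto `D`, if no such
event is on a channel of `D`. -/
theorem RecTrace.proj_sub_proj (τ : RecTrace S) (h : S.TVar) {C D : Set S.Chan}
    (hτ : ∀ e ∈ τ, e.2.ch ∈ D → e.2.ch ∈ C) :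
    Trace.proj (RecTrace.sub (RecTrace.proj τ C) h) D = Trace.proj (RecTrace.sub τ h) D := by
  simp only [Trace.proj, RecTrace.sub, RecTrace.proj, List.filter_map, List.filter_filter]
  congr 1
  apply List.filter_congr
  intro e he
  have := hτ e he
  by_cases h1 : e.2.ch ∈ D <;> by_cases h2 : e.1 = h <;> simp_all

/-- Every prefix of a projection is the projection of a prefix. -/
theorem RecTrace.exists_prefix_proj (τ σ : RecTrace S) (C : Set S.Chan)
    (h : σ <+: RecTrace.proj τ C) :
    ∃ τ', τ' <+: τ ∧ RecTrace.proj τ' C = σ := by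
  obtain ⟨ρ, hρ⟩ := h
  obtain ⟨τ₁, τ₂, rfl, h1, -⟩ := List.filter_eq_append_iff.1 hρ.symm
  exact ⟨τ₁, List.prefix_append _ _, h1⟩

/-- The case split behind sequential composition: a prefix either ends within the first part or
contains all of it. Both cases cover `b` itself, which is harmless. -/
theorem prefix_append_iff {α : Type*} {a b c : List α} :
    a <+: b ++ c ↔ a <+: b ∨ ∃ d, d <+: c ∧ a = b ++ d := by
  constructor
  · intro h
    rcases le_total a.length b.length with hl | hl
    · exact .inl (List.prefix_of_prefix_length_le h (List.prefix_append b c) hl)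
    · obtain ⟨d, rfl⟩ := List.prefix_of_prefix_length_le (List.prefix_append b c) h hl
      exact .inr ⟨d, (List.prefix_append_right_inj b).1 h, rfl⟩
  · rintro (h | ⟨d, h, rfl⟩)
    · exact h.trans (List.prefix_append b c)
    · exact (List.prefix_append_right_inj b).2 h

@[simp] theorem State.app_nil (v : State S) : v.app [] = v := by
  ext <;> simp [State.app]

theorem State.app_app (v : State S) (τ τ' : RecTrace S) :
    (v.app τ).app τ' = v.app (τ ++ τ') := by
  simp [State.app, List.append_assoc]

@[simp] theorem State.app_r (v : State S) (τ : RecTrace S) : (v.app τ).r = v.r := rfl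
@[simp] theorem State.app_n (v : State S) (τ : RecTrace S) : (v.app τ).n = v.n := rfl
@[simp] theorem State.app_t (v : State S) (τ : RecTrace S) (h : S.TVar) :
    (v.app τ).t h = v.t h ++ RecTrace.sub τ h := rfl

theorem State.assign_r (v : State S) (l : List (S.RVar × Poly S)) (x : S.RVar) :
    (v.assign l).r x = (listSub l x).eval v.r := rfl
@[simp] theorem State.setT_r (v : State S) (h : S.TVar) (d : Trace S) : (v.setT h d).r = v.r := rfl
@[simp] theorem State.setT_n (v : State S) (h : S.TVar) (d : Trace S) : (v.setT h d).n = v.n := rfl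
@[simp] theorem State.setR_self (v : State S) (x : S.RVar) (d : ℝ) : (v.setR x d).r x = d := by
  simp [State.setR]
@[simp] theorem State.setN_self (v : State S) (x : S.NVar) (d : ℕ) : (v.setN x d).n x = d := by
  simp [State.setN]
@[simp] theorem State.setT_self (v : State S) (h : S.TVar) (d : Trace S) :
    (v.setT h d).t h = d := by
  simp [State.setT]
theorem State.setR_ne (v : State S) {x y : S.RVar} (d : ℝ) (h : y ≠ x) :
    (v.setR x d).r y = v.r y := by
  simp [State.setR, h]
theorem State.setN_ne (v : State S) {x y : S.NVar} (d : ℕ) (h : y ≠ x) :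
    (v.setN x d).n y = v.n y := by
  simp [State.setN, h]
theorem State.setT_ne (v : State S) {x y : S.TVar} (d : Trace S) (h : y ≠ x) :
    (v.setT x d).t y = v.t y := by
  simp [State.setT, h]

theorem listSub_of_not_mem {l : List (S.RVar × Poly S)} {x : S.RVar} (h : Var.r x ∉ lhs l) :
    listSub l x = .var x := by
  induction l with
  | nil => rfl
  | cons p l ih =>
    have h1 : x ≠ p.1 := fun e => h ⟨p, by simp, by rw [e]⟩
    have h2 : Var.r x ∉ lhs l := fun ⟨q, hq, e⟩ => h ⟨q, by simp [hq], e⟩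
    simp [listSub, h1, ih h2]

theorem listSub_mem {l : List (S.RVar × Poly S)} {x : S.RVar} (h : Var.r x ∈ lhs l) :
    (x, listSub l x) ∈ l := by
  induction l with
  | nil => obtain ⟨p, hp, -⟩ := h; simp at hp
  | cons p l ih =>
    by_cases h1 : x = p.1
    · simp [listSub, h1]
    · obtain ⟨q, hq, e⟩ := h
      have hq' : q ∈ l := by
        rcases List.mem_cons.1 hq with rfl | hq
        · exact absurd (Var.r.inj e) h1
        · exact hq
      simp only [listSub, h1, if_false]
      exact List.mem_cons_of_mem _ (ih ⟨q, hq', e⟩)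

/-! ### Elementary properties of the program semantics -/

theorem mem_seqOp {U M : Set (Comp S)} {v : State S} {τ : RecTrace S} {o : Option (State S)} :
    (v, τ, o) ∈ seqOp U M ↔ (o = none ∧ ∃ w, (v, τ, w) ∈ U) ∨
      ∃ τ₁ τ₂ u, (v, τ₁, some u) ∈ U ∧ (u, τ₂, o) ∈ M ∧ τ = τ₁ ++ τ₂ := Iff.rfl

theorem mem_iterOp_zero {U : Set (Comp S)} {v : State S} {τ : RecTrace S}
    {o : Option (State S)} :
    (v, τ, o) ∈ iterOp U 0 ↔ τ = [] ∧ (o = none ∨ o = some v) := by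
  simp only [iterOp, leastComps, Set.mem_union, Set.mem_ofPred_eq]; tauto

theorem mem_sem_star {α : Prog S} {c : Comp S} :
    c ∈ (Prog.star α).sem ↔ ∃ k, c ∈ iterOp α.sem k := by
  simp [Prog.sem]

theorem mem_sem_assign {l : List (S.RVar × Poly S)} {v : State S} {τ : RecTrace S}
    {o : Option (State S)} :
    (v, τ, o) ∈ (Prog.assign l).sem ↔ τ = [] ∧ (o = none ∨ o = some (v.assign l)) := by
  simp only [Prog.sem, leastComps, Set.mem_union, Set.mem_ofPred_eq]; tauto

theorem mem_sem_nondet {x : S.RVar} {v : State S} {τ : RecTrace S} {o : Option (State S)} :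
    (v, τ, o) ∈ (Prog.nondet x).sem ↔ τ = [] ∧ (o = none ∨ ∃ a, o = some (v.setR x a)) := by
  simp only [Prog.sem, leastComps, Set.mem_union, Set.mem_ofPred_eq]; tauto

theorem mem_sem_test {χ : FolRA S} {v : State S} {τ : RecTrace S} {o : Option (State S)} :
    (v, τ, o) ∈ (Prog.test χ).sem ↔ τ = [] ∧ (o = none ∨ (o = some v ∧ χ.Sat v)) := by
  simp only [Prog.sem, leastComps, Set.mem_union, Set.mem_ofPred_eq]; tauto

theorem mem_sem_ode {l : List (S.RVar × Poly S)} {χ : FolRA S} {v : State S} {τ : RecTrace S}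
    {o : Option (State S)} :
    (v, τ, o) ∈ (Prog.ode l χ).sem ↔ τ = [] ∧ (o = none ∨ ∃ d : ℝ, 0 ≤ d ∧ ∃ φ : ℝ → State S,
      SolvesODE l χ d φ ∧ v = φ 0 ∧ o = some (φ d)) := by
  simp only [Prog.sem, leastComps, Set.mem_union, Set.mem_ofPred_eq]; rw [← and_or_left]

theorem obsLE_singleton {e : S.TVar × Event S} {w : State S} {τ : RecTrace S}
    {o : Option (State S)} :
    ObsLE (τ, o) ([e], some w) ↔
      (τ = [] ∧ o = none) ∨ (τ = [e] ∧ (o = none ∨ o = some w)) := by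
  simp only [ObsLE, List.prefix_cons_iff, List.prefix_nil]
  constructor
  · rintro (⟨rfl, rfl⟩ | ⟨rfl, rfl | ⟨t, rfl, rfl⟩⟩) <;> simp
  · rintro (⟨rfl, rfl⟩ | ⟨rfl, rfl | rfl⟩) <;> simp

theorem mem_sem_send {c : S.Chan} {h : S.TVar} {p : Poly S} {v : State S} {τ : RecTrace S}
    {o : Option (State S)} :
    (v, τ, o) ∈ (Prog.send c h p).sem ↔ (τ = [] ∧ o = none) ∨
      (τ = [(h, ⟨c, p.eval v.r, v.r S.mu⟩)] ∧ (o = none ∨ o = some v)) := by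
  simp only [Prog.sem, Set.mem_ofPred_eq, obsLE_singleton]

theorem mem_sem_recv {c : S.Chan} {h : S.TVar} {x : S.RVar} {v : State S} {τ : RecTrace S}
    {o : Option (State S)} :
    (v, τ, o) ∈ (Prog.recv c h x).sem ↔ ∃ a : ℝ, (τ = [] ∧ o = none) ∨
      (τ = [(h, ⟨c, a, v.r S.mu⟩)] ∧ (o = none ∨ o = some (v.setR x a))) := by
  simp only [Prog.sem, Set.mem_ofPred_eq, obsLE_singleton]

theorem mem_sem_par {a b : Prog S} {v : State S} {τ : RecTrace S} {o : Option (State S)} :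
    (v, τ, o) ∈ (Prog.par a b).sem ↔ ∃ w₁ w₂,
      (v, RecTrace.proj τ a.CN, w₁) ∈ a.sem ∧ (v, RecTrace.proj τ b.CN, w₂) ∈ b.sem ∧
      SameTime w₁ w₂ ∧ RecTrace.Chronological τ ∧ τ = RecTrace.proj τ (a.CN ∪ b.CN) ∧
      o = merge a.BV w₁ w₂ := by
  simp only [Prog.sem, Set.mem_ofPred_eq]

theorem mem_sem_seq {a b : Prog S} {v : State S} {τ : RecTrace S} {o : Option (State S)} :
    (v, τ, o) ∈ (Prog.seq a b).sem ↔ (o = none ∧ ∃ w, (v, τ, w) ∈ a.sem) ∨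
      ∃ τ₁ τ₂ u, (v, τ₁, some u) ∈ a.sem ∧ (u, τ₂, o) ∈ b.sem ∧ τ = τ₁ ++ τ₂ := Iff.rfl

theorem mem_sem_choice {a b : Prog S} {c : Comp S} :
    c ∈ (Prog.choice a b).sem ↔ c ∈ a.sem ∨ c ∈ b.sem := Iff.rfl

theorem merge_eq_some {B : Set (Var S)} {o o' : Option (State S)} {w : State S} :
    merge B o o' = some w ↔ ∃ w₁ w₂, o = some w₁ ∧ o' = some w₂ ∧ w = mergeState B w₁ w₂ := by
  cases o <;> cases o' <;> simp [merge, eq_comm]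

/-! ### What a run can change, prefix closure, and the channels and recorders it uses -/

/-- `w` differs from `v` at most in the real variables in `B`. -/
structure Frame (B : Set (Var S)) (v w : State S) : Prop where
  r : ∀ x, Var.r x ∉ B → w.r x = v.r x
  n : w.n = v.n
  t : w.t = v.t

theorem Frame.mono {B B' : Set (Var S)} {v w : State S} (h : Frame B v w) (hB : B ⊆ B') :
    Frame B' v w := ⟨fun x hx => h.r x fun h' => hx (hB h'), h.n, h.t⟩

theorem Frame.trans {B : Set (Var S)} {v w z : State S} (h : Frame B v w) (h' : Frame B w z) :
    Frame B v z :=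
  ⟨fun x hx => (h'.r x hx).trans (h.r x hx), h'.n.trans h.n, h'.t.trans h.t⟩

theorem Frame.refl (B : Set (Var S)) (v : State S) : Frame B v v := ⟨fun _ _ => rfl, rfl, rfl⟩

/-- Programs change bound variables only. -/
theorem Prog.frame {α : Prog S} {v w : State S} {τ : RecTrace S}
    (h : (v, τ, some w) ∈ α.sem) : Frame α.BV v w := by
  induction α generalizing v τ w with
  | assign l =>
    obtain ⟨-, h | h⟩ := mem_sem_assign.1 h
    · cases h
    · cases h
      refine ⟨fun x hx => ?_, rfl, rfl⟩
      rw [State.assign_r, listSub_of_not_mem hx]; rfl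
  | nondet x =>
    obtain ⟨-, h | ⟨a, h⟩⟩ := mem_sem_nondet.1 h
    · cases h
    · cases h
      exact ⟨fun y hy => State.setR_ne _ _ fun e => hy (by simp [Prog.BV, e]), rfl, rfl⟩
  | ode l χ =>
    obtain ⟨-, ho | ⟨d, hd, φ, hφ, rfl, ho⟩⟩ := mem_sem_ode.1 h
    · cases ho
    · obtain rfl := Option.some.inj ho
      obtain ⟨-, -, -, h1, h2, h3⟩ := hφ d ⟨hd, le_rfl⟩
      exact ⟨h1, h2, h3⟩
  | test χ =>
    obtain ⟨-, h | ⟨h, -⟩⟩ := mem_sem_test.1 h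
    · cases h
    · cases h; exact Frame.refl _ _
  | seq a b iha ihb =>
    obtain ⟨h, -⟩ | ⟨τ₁, τ₂, u, h1, h2, -⟩ := mem_sem_seq.1 h
    · cases h
    · exact ((iha h1).mono Set.subset_union_left).trans ((ihb h2).mono Set.subset_union_right)
  | choice a b iha ihb =>
    obtain h | h := h
    · exact (iha h).mono Set.subset_union_left
    · exact (ihb h).mono Set.subset_union_right
  | star a iha =>
    obtain ⟨k, h⟩ := mem_sem_star.1 h
    induction k generalizing v τ with
    | zero =>
      obtain ⟨-, h | h⟩ := mem_iterOp_zero.1 h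
      · cases h
      · cases h; exact Frame.refl _ _
    | succ k ih =>
      obtain ⟨h, -⟩ | ⟨τ₁, τ₂, u, h1, h2, -⟩ := mem_seqOp.1 h
      · cases h
      · exact (iha h1).trans (ih (mem_sem_star.2 ⟨k, h2⟩) h2)
  | send c h' p =>
    obtain ⟨-, h⟩ | ⟨-, h | h⟩ := mem_sem_send.1 h
    · cases h
    · cases h
    · cases h; exact Frame.refl _ _
  | recv c h' x =>
    obtain ⟨a, ⟨-, h⟩ | ⟨-, h | h⟩⟩ := mem_sem_recv.1 h
    · cases h
    · cases h
    · cases h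
      exact ⟨fun y hy => State.setR_ne _ _ fun e => hy (by simp [Prog.BV, e]), rfl, rfl⟩
  | par a b iha ihb =>
    obtain ⟨w₁, w₂, h1, h2, -, -, -, h⟩ := mem_sem_par.1 h
    obtain ⟨w₁, w₂, rfl, rfl, rfl⟩ := merge_eq_some.1 h.symm
    have f1 := iha h1
    have f2 := ihb h2
    refine ⟨fun x hx => ?_, ?_, ?_⟩
    · have : Var.r x ∉ a.BV ∧ Var.r x ∉ b.BV := by
        simpa [Prog.BV] using hx
      simp [mergeState, this.1, f2.r x this.2]
    -- Both final states have the integers and traces of `v`, so here it does not matter from which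
    -- of them the merge takes its values.
    · funext i; simp [mergeState, f1.n, f2.n]
    · funext i; simp [mergeState, f1.t, f2.t]

/-- The empty communication has no proper prefixes, so through this run every ac-box asserts its
commitment in the initial state unconditionally. -/
theorem Prog.nil_none_mem_sem (α : Prog S) (v : State S) : (v, [], none) ∈ α.sem := by
  induction α with
  | assign l => exact mem_sem_assign.2 ⟨rfl, .inl rfl⟩
  | nondet x => exact mem_sem_nondet.2 ⟨rfl, .inl rfl⟩
  | ode l χ => exact mem_sem_ode.2 ⟨rfl, .inl rfl⟩
  | test χ => exact mem_sem_test.2 ⟨rfl, .inl rfl⟩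
  | seq a b iha ihb => exact mem_sem_seq.2 (.inl ⟨rfl, _, iha⟩)
  | choice a b iha ihb => exact .inl iha
  | star a iha => exact mem_sem_star.2 ⟨0, mem_iterOp_zero.2 ⟨rfl, .inl rfl⟩⟩
  | send c h p => exact mem_sem_send.2 (.inl ⟨rfl, rfl⟩)
  | recv c h x => exact mem_sem_recv.2 ⟨0, .inl ⟨rfl, rfl⟩⟩
  | par a b iha ihb =>
    exact mem_sem_par.2 ⟨none, none, iha, ihb, by simp [SameTime], List.Pairwise.nil, rfl, rfl⟩

/-- Communication is prefix-closed. -/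
theorem Prog.prefix_none_mem_sem {α : Prog S} {v : State S} {τ τ' : RecTrace S}
    {o : Option (State S)} (h : (v, τ, o) ∈ α.sem) (hp : τ' <+: τ) :
    (v, τ', none) ∈ α.sem := by
  induction α generalizing v τ τ' o with
  | assign l =>
    obtain ⟨rfl, -⟩ := mem_sem_assign.1 h
    rw [List.prefix_nil.1 hp]; exact Prog.nil_none_mem_sem _ _
  | nondet x =>
    obtain ⟨rfl, -⟩ := mem_sem_nondet.1 h
    rw [List.prefix_nil.1 hp]; exact Prog.nil_none_mem_sem _ _
  | ode l χ =>
    obtain ⟨rfl, -⟩ := mem_sem_ode.1 h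
    rw [List.prefix_nil.1 hp]; exact Prog.nil_none_mem_sem _ _
  | test χ =>
    obtain ⟨rfl, -⟩ := mem_sem_test.1 h
    rw [List.prefix_nil.1 hp]; exact Prog.nil_none_mem_sem _ _
  | seq a b iha ihb =>
    obtain ⟨-, w, h⟩ | ⟨τ₁, τ₂, u, h1, h2, rfl⟩ := mem_sem_seq.1 h
    · exact mem_sem_seq.2 (.inl ⟨rfl, _, iha h hp⟩)
    · obtain hp | ⟨τ₃, hp', rfl⟩ := prefix_append_iff.1 hp
      · exact mem_sem_seq.2 (.inl ⟨rfl, _, iha h1 hp⟩)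
      · exact mem_sem_seq.2 (.inr ⟨_, _, u, h1, ihb h2 hp', rfl⟩)
  | choice a b iha ihb => exact h.imp (iha · hp) (ihb · hp)
  | star a iha =>
    obtain ⟨k, h⟩ := mem_sem_star.1 h
    refine mem_sem_star.2 ⟨k, ?_⟩
    clear * - h iha hp
    induction k generalizing v τ τ' with
    | zero =>
      obtain ⟨rfl, -⟩ := mem_iterOp_zero.1 h
      exact mem_iterOp_zero.2 ⟨List.prefix_nil.1 hp, .inl rfl⟩
    | succ k ih =>
      obtain ⟨-, w, h⟩ | ⟨τ₁, τ₂, u, h1, h2, rfl⟩ := mem_seqOp.1 h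
      · exact mem_seqOp.2 (.inl ⟨rfl, _, iha h hp⟩)
      · obtain hp | ⟨τ₃, hp', rfl⟩ := prefix_append_iff.1 hp
        · exact mem_seqOp.2 (.inl ⟨rfl, _, iha h1 hp⟩)
        · exact mem_seqOp.2 (.inr ⟨_, _, u, h1, ih hp' h2, rfl⟩)
  | send c h' p =>
    obtain ⟨rfl, -⟩ | ⟨rfl, -⟩ := mem_sem_send.1 h
    · rw [List.prefix_nil.1 hp]; exact Prog.nil_none_mem_sem _ _
    · obtain rfl | rfl := (by simpa [List.prefix_cons_iff] using hp : τ' = [] ∨ τ' = _)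
      · exact Prog.nil_none_mem_sem _ _
      · exact mem_sem_send.2 (.inr ⟨rfl, .inl rfl⟩)
  | recv c h' x =>
    obtain ⟨a, ⟨rfl, -⟩ | ⟨rfl, -⟩⟩ := mem_sem_recv.1 h
    · rw [List.prefix_nil.1 hp]; exact Prog.nil_none_mem_sem _ _
    · obtain rfl | rfl := (by simpa [List.prefix_cons_iff] using hp : τ' = [] ∨ τ' = _)
      · exact Prog.nil_none_mem_sem _ _
      · exact mem_sem_recv.2 ⟨a, .inr ⟨rfl, .inl rfl⟩⟩
  | par a b iha ihb =>
    obtain ⟨w₁, w₂, h1, h2, -, hc, hτ, -⟩ := mem_sem_par.1 h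
    -- Projection preserves prefixes, so both components can be cut off; for unfinished components
    -- the synchronization of final times is vacuous.
    refine mem_sem_par.2 ⟨none, none, iha h1 (RecTrace.proj_prefix hp _),
      ihb h2 (RecTrace.proj_prefix hp _), by simp [SameTime], hc.sublist hp.sublist, ?_, rfl⟩
    symm
    refine List.filter_eq_self.2 fun e he => ?_
    exact List.filter_eq_self.1 hτ.symm e (hp.subset he)

/-- This makes all runs silent if `α.CN = ∅`, which is what acNoCom rests on. -/
theorem Prog.ch_mem_CN {α : Prog S} {v : State S} {τ : RecTrace S}
    {o : Option (State S)} (h : (v, τ, o) ∈ α.sem) : ∀ e ∈ τ, e.2.ch ∈ α.CN := by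
  induction α generalizing v τ o with
  | assign l => obtain ⟨rfl, -⟩ := mem_sem_assign.1 h; simp
  | nondet x => obtain ⟨rfl, -⟩ := mem_sem_nondet.1 h; simp
  | ode l χ => obtain ⟨rfl, -⟩ := mem_sem_ode.1 h; simp
  | test χ => obtain ⟨rfl, -⟩ := mem_sem_test.1 h; simp
  | seq a b iha ihb =>
    obtain ⟨-, w, h⟩ | ⟨τ₁, τ₂, u, h1, h2, rfl⟩ := mem_sem_seq.1 h
    · exact fun e he => .inl (iha h e he)
    · intro e he
      exact (List.mem_append.1 he).imp (iha h1 e) (ihb h2 e)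
  | choice a b iha ihb => exact fun e he => h.imp (iha · e he) (ihb · e he)
  | star a iha =>
    obtain ⟨k, h⟩ := mem_sem_star.1 h
    induction k generalizing v τ with
    | zero => obtain ⟨rfl, -⟩ := mem_iterOp_zero.1 h; simp
    | succ k ih =>
      obtain ⟨-, w, h⟩ | ⟨τ₁, τ₂, u, h1, h2, rfl⟩ := mem_seqOp.1 h
      · exact iha h
      · intro e he
        exact (List.mem_append.1 he).elim (iha h1 e) (ih (mem_sem_star.2 ⟨k, h2⟩) h2 e)
  | send c h' p => obtain ⟨rfl, -⟩ | ⟨rfl, -⟩ := mem_sem_send.1 h <;> simp [Prog.CN]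
  | recv c h' x => obtain ⟨a, ⟨rfl, -⟩ | ⟨rfl, -⟩⟩ := mem_sem_recv.1 h <;> simp [Prog.CN]
  | par a b iha ihb =>
    obtain ⟨w₁, w₂, -, -, -, -, hτ, -⟩ := mem_sem_par.1 h
    intro e he
    simpa [Prog.CN] using List.filter_eq_self.1 hτ.symm e he

theorem Prog.MBV_subset_BV (α : Prog S) : α.MBV ⊆ α.BV := by
  induction α with
  | seq a b iha ihb => exact Set.union_subset_union iha ihb
  | choice a b iha ihb => exact fun x hx => .inl (iha hx.1)
  | par a b iha ihb => exact Set.union_subset_union iha ihb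
  | star a iha => exact Set.empty_subset _
  | _ => exact subset_rfl

/-- Sending and receiving extend the history of a recorder instead of overwriting it, so recorders
count as free. Removing must-bound variables behind a program therefore loses no trace variable, as
`FmlRel.next` requires. -/
theorem Prog.t_mem_FV_of_mem_MBV {α : Prog S} {h : S.TVar} (hh : Var.t h ∈ α.MBV) :
    Var.t h ∈ α.FV := by
  induction α with
  | assign l => obtain ⟨p, -, e⟩ := hh; cases e
  | nondet x => cases hh
  | ode l χ =>
    obtain ⟨p, -, e⟩ | e := hh
    · cases e
    · cases e
  | test χ => exact hh.elim
  | seq a b iha ihb =>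
    by_cases ha : Var.t h ∈ a.MBV
    · exact .inl (iha ha)
    · exact .inr ⟨ihb (hh.resolve_left ha), ha⟩
  | choice a b iha ihb => exact .inl (iha hh.1)
  | star a iha => exact hh.elim
  | send c g p => exact .inl (.inl hh)
  | recv c g x =>
    obtain hh | hh := hh
    · exact .inl hh
    · cases hh
  | par a b iha ihb => exact hh.imp iha ihb

/-! ### Substitution and coincidence for programs -/

theorem Poly.mem_FV {p : Poly S} {x : S.RVar} : Var.r x ∈ p.FV ↔ x ∈ p.fv := by
  simp [Poly.FV]

theorem Poly.eval_congr {p : Poly S} {v u : S.RVar → ℝ} (h : ∀ x, Var.r x ∈ p.FV → v x = u x) :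
    p.eval v = p.eval u := by
  simp only [Poly.mem_FV] at h
  induction p with
  | var x => exact h x rfl
  | const q => rfl
  | add p q ihp ihq =>
    exact congrArg₂ (· + ·) (ihp fun x hx => h x (.inl hx)) (ihq fun x hx => h x (.inr hx))
  | mul p q ihp ihq =>
    exact congrArg₂ (· * ·) (ihp fun x hx => h x (.inl hx)) (ihq fun x hx => h x (.inr hx))

theorem Poly.eval_subst (p : Poly S) (σ : Sub S) (v : S.RVar → ℝ) :
    (p.subst σ).eval v = p.eval fun x => (σ x).eval v := by
  induction p with
  | var x => rfl
  | const q => rfl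
  | add p q ihp ihq => exact congrArg₂ (· + ·) ihp ihq
  | mul p q ihp ihq => exact congrArg₂ (· * ·) ihp ihq

/-- On `X`, the state `u` has the values of the substituted terms in `v`. -/
def SubRel (σ : Sub S) (X : Set (Var S)) (v u : State S) : Prop :=
  ∀ x, Var.r x ∈ X → u.r x = (σ x).eval v.r

theorem SubRel.mono {σ : Sub S} {X Y : Set (Var S)} {v u : State S} (h : SubRel σ X v u)
    (hY : Y ⊆ X) : SubRel σ Y v u := fun x hx => h x (hY hx)

theorem SubRel.eval {σ : Sub S} {X : Set (Var S)} {v u : State S} (h : SubRel σ X v u)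
    {p : Poly S} (hp : p.FV ⊆ X) : (p.subst σ).eval v.r = p.eval u.r := by
  rw [Poly.eval_subst]
  exact Poly.eval_congr fun x hx => (h x (hp hx)).symm

theorem Sub.off_of_mem {σ : Sub S} {X : Set (Var S)} {x : S.RVar} (h : Var.r x ∈ X) :
    σ.off X x = .var x := by simp [Sub.off, h]

theorem Sub.off_of_not_mem {σ : Sub S} {X : Set (Var S)} {x : S.RVar} (h : Var.r x ∉ X) :
    σ.off X x = σ x := by simp [Sub.off, h]

/-- Passing under a quantifier over a real variable. -/
theorem SubRel.setR {σ : Sub S} {F : Set (Var S)} {v u : State S} {x : S.RVar}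
    (h : SubRel σ (F \ {.r x}) v u) (hc : σ.NoCapture (F \ {.r x}) {.r x}) (d : ℝ) :
    SubRel (σ.off {.r x}) F (v.setR x d) (u.setR x d) := by
  intro y hy
  by_cases hyx : y = x
  · subst hyx
    rw [Sub.off_of_mem (Set.mem_singleton _)]; simp [Poly.eval]
  · have hy' : Var.r y ∈ F \ {Var.r x} := ⟨hy, fun e => hyx (Var.r.inj e)⟩
    rw [Sub.off_of_not_mem hy'.2, State.setR_ne _ _ hyx, h y hy']
    by_cases hσ : σ y = .var y
    · rw [hσ]; simp [Poly.eval, State.setR_ne _ _ hyx]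
    · refine Poly.eval_congr fun z hz => (State.setR_ne _ _ ?_).symm
      rintro rfl
      have : Var.r z ∈ (σ y).FV ∩ {Var.r z} := ⟨hz, rfl⟩
      rw [(hc y hy' hσ).2] at this
      exact this

theorem FolRA.sat_subst {χ : FolRA S} {σ : Sub S} {v u : State S} (ha : χ.Adm σ)
    (h : SubRel σ χ.FV v u) : (χ.subst σ).Sat v ↔ χ.Sat u := by
  induction χ generalizing σ v u with
  | eq p q =>
    simp only [FolRA.subst, FolRA.Sat, h.eval (p := p) Set.subset_union_left,
      h.eval (p := q) Set.subset_union_right]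
  | ge p q =>
    simp only [FolRA.subst, FolRA.Sat, h.eval (p := p) Set.subset_union_left,
      h.eval (p := q) Set.subset_union_right]
  | not a ih => exact not_congr (ih ha h)
  | and a b iha ihb =>
    exact and_congr (iha ha.1 (h.mono Set.subset_union_left))
      (ihb ha.2 (h.mono Set.subset_union_right))
  | or a b iha ihb =>
    exact or_congr (iha ha.1 (h.mono Set.subset_union_left))
      (ihb ha.2 (h.mono Set.subset_union_right))
  | imp a b iha ihb =>
    exact imp_congr (iha ha.1 (h.mono Set.subset_union_left))
      (ihb ha.2 (h.mono Set.subset_union_right))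
  | all x a ih => exact forall_congr' fun d => ih ha.1 (SubRel.setR h ha.2 d)
  | ex x a ih => exact exists_congr fun d => ih ha.1 (SubRel.setR h ha.2 d)

/-! ### Simulations between program semantics -/

/-- Every computation in `U` can be simulated in `V`. -/
def Sim (R Q : State S → State S → Prop) (U V : Set (Comp S)) : Prop :=
  ∀ v u τ o, R v u → (v, τ, o) ∈ U → ∃ o', (u, τ, o') ∈ V ∧ Option.Rel Q o o'

/-- `Option.Rel` makes a finished run answered by a finished one, so the second program always has a
related state to start from. -/
theorem Sim.seqOp {R Q T : State S → State S → Prop} {U V U' V' : Set (Comp S)}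
    (h : Sim R Q U V) (h' : Sim Q T U' V') : Sim R T (seqOp U U') (seqOp V V') := by
  rintro v u τ o hR hU
  obtain ⟨rfl, w, hw⟩ | ⟨τ₁, τ₂, w, h1, h2, rfl⟩ := mem_seqOp.1 hU
  · obtain ⟨o', h1, -⟩ := h v u τ w hR hw
    exact ⟨none, mem_seqOp.2 (.inl ⟨rfl, _, h1⟩), .none⟩
  · obtain ⟨o', h3, h4⟩ := h v u τ₁ _ hR h1
    cases h4 with
    | some hQ =>
      obtain ⟨o'', h5, h6⟩ := h' _ _ _ _ hQ h2
      exact ⟨o'', mem_seqOp.2 (.inr ⟨_, _, _, h3, h5, rfl⟩), h6⟩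

theorem Sim.iterOp {R : State S → State S → Prop} {U V : Set (Comp S)}
    (h : Sim R R U V) (k : ℕ) : Sim R R (iterOp U k) (iterOp V k) := by
  induction k with
  | zero =>
    intro v u τ o hR hU
    obtain ⟨rfl, rfl | rfl⟩ := mem_iterOp_zero.1 hU
    · exact ⟨none, mem_iterOp_zero.2 ⟨rfl, .inl rfl⟩, .none⟩
    · exact ⟨some u, mem_iterOp_zero.2 ⟨rfl, .inr rfl⟩, .some hR⟩
  | succ k ih => exact h.seqOp ih

/-- Simulations in both directions. -/
def Bisim (R Q : State S → State S → Prop) (U V : Set (Comp S)) : Prop :=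
  Sim R Q U V ∧ Sim (flip R) (flip Q) V U

theorem Bisim.seqOp {R Q T : State S → State S → Prop} {U V U' V' : Set (Comp S)}
    (h : Bisim R Q U V) (h' : Bisim Q T U' V') : Bisim R T (seqOp U U') (seqOp V V') :=
  ⟨h.1.seqOp h'.1, h.2.seqOp h'.2⟩

/-- In `hQ` the final states are known to be reached by runs. Through this the frame property can
strengthen the relation between them. -/
theorem Bisim.mono {R R' Q Q' : State S → State S → Prop} {U V : Set (Comp S)}
    (h : Bisim R Q U V) (hR : ∀ v u, R' v u → R v u)
    (hQ : ∀ v u τ w w', R' v u → (v, τ, some w) ∈ U → (u, τ, some w') ∈ V → Q w w' → Q' w w') :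
    Bisim R' Q' U V := by
  constructor
  · intro v u τ o hvu hU
    obtain ⟨o', h1, h2⟩ := h.1 v u τ o (hR _ _ hvu) hU
    refine ⟨o', h1, ?_⟩
    cases h2 with
    | none => exact .none
    | some h2 => exact .some (hQ _ _ _ _ _ hvu hU h1 h2)
  · intro u v τ o hvu hU
    obtain ⟨o', h1, h2⟩ := h.2 u v τ o (hR _ _ hvu) hU
    refine ⟨o', h1, ?_⟩
    cases h2 with
    | none => exact .none
    | some h2 => exact .some (hQ _ _ _ _ _ hvu h1 hU h2)

theorem Bisim.star {R : State S → State S → Prop} {a b : Prog S}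
    (h : Bisim R R a.sem b.sem) : Bisim R R (Prog.star a).sem (Prog.star b).sem := by
  constructor
  · intro v u τ o hR hU
    obtain ⟨k, hk⟩ := mem_sem_star.1 hU
    obtain ⟨o', h1, h2⟩ := h.1.iterOp k v u τ o hR hk
    exact ⟨o', mem_sem_star.2 ⟨k, h1⟩, h2⟩
  · intro v u τ o hR hU
    obtain ⟨k, hk⟩ := mem_sem_star.1 hU
    obtain ⟨o', h1, h2⟩ := h.2.iterOp k v u τ o hR hk
    exact ⟨o', mem_sem_star.2 ⟨k, h1⟩, h2⟩

theorem Bisim.choice {R Q : State S → State S → Prop} {a b a' b' : Prog S}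
    (h : Bisim R Q a.sem a'.sem) (h' : Bisim R Q b.sem b'.sem) :
    Bisim R Q (Prog.choice a b).sem (Prog.choice a' b').sem := by
  constructor
  · rintro v u τ o hR (hU | hU)
    · obtain ⟨o', h1, h2⟩ := h.1 v u τ o hR hU
      exact ⟨o', .inl h1, h2⟩
    · obtain ⟨o', h1, h2⟩ := h'.1 v u τ o hR hU
      exact ⟨o', .inr h1, h2⟩
  · rintro v u τ o hR (hU | hU)
    · obtain ⟨o', h1, h2⟩ := h.2 v u τ o hR hU
      exact ⟨o', .inl h1, h2⟩
    · obtain ⟨o', h1, h2⟩ := h'.2 v u τ o hR hU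
      exact ⟨o', .inr h1, h2⟩

/-- Since the channel names agree, equal communications have equal projections, and each component
is answered separately. What concerns both components at once, the common final time and the merged
state, is left to `hQ`. -/
theorem Sim.par {R Qa Qb Q : State S → State S → Prop} {a b a' b' : Prog S}
    (ha : Sim R Qa a.sem a'.sem) (hb : Sim R Qb b.sem b'.sem)
    (hca : a'.CN = a.CN) (hcb : b'.CN = b.CN) (hB : a'.BV = a.BV)
    (hQ : ∀ v u τ₁ τ₂ w₁ w₂ w₁' w₂', R v u →
      (v, τ₁, some w₁) ∈ a.sem → (v, τ₂, some w₂) ∈ b.sem →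
      (u, τ₁, some w₁') ∈ a'.sem → (u, τ₂, some w₂') ∈ b'.sem →
      Qa w₁ w₁' → Qb w₂ w₂' → w₁.r S.mu = w₂.r S.mu →
      w₁'.r S.mu = w₂'.r S.mu ∧ Q (mergeState a.BV w₁ w₂) (mergeState a.BV w₁' w₂')) :
    Sim R Q (Prog.par a b).sem (Prog.par a' b').sem := by
  intro v u τ o hR h
  obtain ⟨w₁, w₂, h1, h2, h3, h4, h5, rfl⟩ := mem_sem_par.1 h
  obtain ⟨w₁', h1', r1⟩ := ha _ _ _ _ hR h1
  obtain ⟨w₂', h2', r2⟩ := hb _ _ _ _ hR h2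
  refine ⟨merge a.BV w₁' w₂', mem_sem_par.2 ⟨w₁', w₂', by rwa [hca], by rwa [hcb], ?_, h4,
    by rwa [hca, hcb], by rw [hB]⟩, ?_⟩
  · rintro z₁ z₂ rfl rfl
    cases r1 with
    | some r1 => cases r2 with
      | some r2 => exact (hQ _ _ _ _ _ _ _ _ hR h1 h2 h1' h2' r1 r2 (h3 _ _ rfl rfl)).1
  · cases r1 with
    | none => exact .none
    | some r1 => cases r2 with
      | none => exact .none
      | some r2 => exact .some (hQ _ _ _ _ _ _ _ _ hR h1 h2 h1' h2' r1 r2 (h3 _ _ rfl rfl)).2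

theorem Bisim.par {R Qa Qb Q : State S → State S → Prop} {a b a' b' : Prog S}
    (ha : Bisim R Qa a.sem a'.sem) (hb : Bisim R Qb b.sem b'.sem)
    (hca : a'.CN = a.CN) (hcb : b'.CN = b.CN) (hB : a'.BV = a.BV)
    (hQ : ∀ v u τ₁ τ₂ w₁ w₂ w₁' w₂', R v u →
      (v, τ₁, some w₁) ∈ a.sem → (v, τ₂, some w₂) ∈ b.sem →
      (u, τ₁, some w₁') ∈ a'.sem → (u, τ₂, some w₂') ∈ b'.sem →
      Qa w₁ w₁' → Qb w₂ w₂' → (w₁.r S.mu = w₂.r S.mu ↔ w₁'.r S.mu = w₂'.r S.mu) ∧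
        Q (mergeState a.BV w₁ w₂) (mergeState a.BV w₁' w₂')) :
    Bisim R Q (Prog.par a b).sem (Prog.par a' b').sem := by
  refine ⟨ha.1.par hb.1 hca hcb hB ?_, ha.2.par hb.2 hca.symm hcb.symm hB.symm ?_⟩
  · intro v u τ₁ τ₂ w₁ w₂ w₁' w₂' hR h1 h2 h3 h4 q1 q2 e
    obtain ⟨h5, h6⟩ := hQ v u τ₁ τ₂ w₁ w₂ w₁' w₂' hR h1 h2 h3 h4 q1 q2
    exact ⟨h5.1 e, h6⟩
  · intro u v τ₁ τ₂ w₁' w₂' w₁ w₂ hR h3 h4 h1 h2 q1 q2 e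
    obtain ⟨h5, h6⟩ := hQ v u τ₁ τ₂ w₁ w₂ w₁' w₂' hR h1 h2 h3 h4 q1 q2
    exact ⟨h5.2 e, by rw [hB]; exact h6⟩

/-! ### Substitution in programs -/

theorem lhs_map_subst (l : List (S.RVar × Poly S)) (σ : Sub S) :
    lhs (l.map fun p => (p.1, p.2.subst σ)) = lhs l := by
  ext z; simp [lhs]

@[simp] theorem Prog.BV_subst (α : Prog S) (σ : Sub S) : (α.subst σ).BV = α.BV := by
  induction α generalizing σ <;> simp_all [Prog.subst, Prog.BV, lhs_map_subst]

@[simp] theorem Prog.CN_subst (α : Prog S) (σ : Sub S) : (α.subst σ).CN = α.CN := by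
  induction α generalizing σ <;> simp_all [Prog.subst, Prog.CN]

theorem listSub_map_subst {l : List (S.RVar × Poly S)} {σ : Sub S} {x : S.RVar}
    (hx : Var.r x ∈ lhs l) :
    listSub (l.map fun p => (p.1, p.2.subst σ)) x = (listSub l x).subst σ := by
  induction l with
  | nil => obtain ⟨p, hp, -⟩ := hx; simp at hp
  | cons p l ih =>
    by_cases h1 : x = p.1
    · simp [listSub, h1]
    · obtain ⟨q, hq, e⟩ := hx
      have hq' : q ∈ l := by
        rcases List.mem_cons.1 hq with rfl | hq
        · exact absurd (Var.r.inj e) h1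
        · exact hq
      simpa [listSub, h1] using ih ⟨q, hq', e⟩

/-- The relation between the final states of a program after and before substitution. -/
def PostRel (σ : Sub S) (X M : Set (Var S)) (w w' : State S) : Prop :=
  ∀ x, (Var.r x ∈ M ∨ (Var.r x ∈ X ∧ σ x = .var x)) → w'.r x = w.r x

/-- The relation between states that a subsequent program or formula with free variables `F`
starts from. -/
theorem SubRel.next {σ : Sub S} {X F M B : Set (Var S)} {v u w w' : State S}
    (h : SubRel σ X v u) (hw : Frame B v w) (hw' : Frame B u w')
    (hp : PostRel σ X M w w') (hF : F \ M ⊆ X) (hc : σ.NoCapture (F \ M) B) :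
    SubRel (σ.off M) ({z | z ∈ M ∨ ∃ x, z = Var.r x ∧ z ∈ X ∧ σ x = .var x} ∪ F) w w' := by
  intro x hx
  by_cases hM : Var.r x ∈ M
  · rw [Sub.off_of_mem hM]; exact hp x (.inl hM)
  rw [Sub.off_of_not_mem hM]
  by_cases hσ : σ x = .var x
  · rw [hσ]
    refine hp x (.inr ⟨?_, hσ⟩)
    obtain (h | ⟨y, -, h, -⟩) | h := hx
    · exact absurd h hM
    · exact h
    · exact hF ⟨h, hM⟩
  · have hxF : Var.r x ∈ F \ M := by
      obtain (h | ⟨y, e, -, h⟩) | h := hx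
      · exact absurd h hM
      · cases e; exact absurd h hσ
      · exact ⟨h, hM⟩
    -- A variable that is replaced and still free is not bound, nor are the variables of its
    -- replacement: both values are those before the run.
    obtain ⟨h1, h2⟩ := hc x hxF hσ
    rw [hw'.r x h1, h x (hF hxF)]
    refine Poly.eval_congr fun z hz => (hw.r z fun hzB => ?_).symm
    have : Var.r z ∈ (σ x).FV ∩ B := ⟨hz, hzB⟩
    rw [h2] at this; exact this

/-- Without assignments only evolution can bind the global time, and evolution has it among its free
variables. -/
theorem Prog.mu_mem_FV {α : Prog S} (hn : ¬ α.AssignsTime) (hB : Var.r S.mu ∈ α.BV) :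
    Var.r S.mu ∈ α.FV := by
  induction α with
  | assign l => exact absurd hB hn
  | nondet x => exact absurd (Var.r.inj hB).symm hn
  | ode l χ => exact .inl (.inl hB)
  | test χ => exact hB.elim
  | seq a b iha ihb =>
    obtain ⟨h1, h2⟩ := not_or.1 hn
    by_cases ha : Var.r S.mu ∈ a.BV
    · exact .inl (iha h1 ha)
    · exact .inr ⟨ihb h2 (hB.resolve_left ha), fun h => ha (a.MBV_subset_BV h)⟩
  | choice a b iha ihb =>
    obtain ⟨h1, h2⟩ := not_or.1 hn
    exact hB.imp (iha h1) (ihb h2)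
  | star a iha => exact iha hn hB
  | send c h p => cases hB
  | recv c h x =>
    obtain h | h := hB
    · cases h
    · exact absurd (Var.r.inj h).symm hn
  | par a b iha ihb =>
    obtain ⟨h1, h2⟩ := not_or.1 hn
    exact hB.imp (iha h1) (ihb h2)

/-- A program that lets time pass does not admit the replacement of the global time. -/
theorem Prog.Adm.mu_eq {α : Prog S} {σ : Sub S} (ha : α.Adm σ) (hn : ¬ α.AssignsTime)
    (hB : Var.r S.mu ∈ α.BV) : σ S.mu = .var S.mu := by
  induction α generalizing σ with
  | assign l => exact absurd hB hn
  | nondet x => exact absurd (Var.r.inj hB).symm hn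
  | ode l χ =>
    by_contra h
    exact (ha.2 S.mu (Prog.mu_mem_FV hn hB) h).1 hB
  | test χ => exact hB.elim
  | seq a b iha ihb =>
    obtain ⟨h1, h2⟩ := not_or.1 hn
    by_cases hB' : Var.r S.mu ∈ a.BV
    · exact iha ha.1 h1 hB'
    · have := ihb ha.2.1 h2 (hB.resolve_left hB')
      rwa [Sub.off_of_not_mem fun h => hB' (a.MBV_subset_BV h)] at this
  | choice a b iha ihb =>
    obtain ⟨h1, h2⟩ := not_or.1 hn
    exact hB.elim (iha ha.1 h1) (ihb ha.2 h2)
  | star a iha => exact iha ha.1 hn hB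
  | send c h p => cases hB
  | recv c h x =>
    obtain h | h := hB
    · cases h
    · exact absurd (Var.r.inj h).symm hn
  | par a b iha ihb =>
    obtain ⟨h1, h2⟩ := not_or.1 hn
    exact hB.elim (iha ha.1 h1) (ihb ha.2 h2)

/-- Transfer of a flow from the state `φ 0` to another start state: the variables in `B` follow
`φ`, the others keep their values in `u`. -/
noncomputable def transferFlow (B : Set (Var S)) (u : State S) (φ : ℝ → State S) (s : ℝ) :
    State S :=
  open Classical in { u with r := fun x => if Var.r x ∈ B then (φ s).r x else u.r x }

theorem transferFlow_r_of_mem {B : Set (Var S)} {u : State S} {φ : ℝ → State S} {s : ℝ}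
    {x : S.RVar} (h : Var.r x ∈ B) : (transferFlow B u φ s).r x = (φ s).r x := by
  simp [transferFlow, h]

theorem transferFlow_r_of_not_mem {B : Set (Var S)} {u : State S} {φ : ℝ → State S} {s : ℝ}
    {x : S.RVar} (h : Var.r x ∉ B) : (transferFlow B u φ s).r x = u.r x := by
  simp [transferFlow, h]

theorem transferFlow_zero {B : Set (Var S)} {u : State S} {φ : ℝ → State S}
    (h : ∀ x, Var.r x ∈ B → (φ 0).r x = u.r x) : transferFlow B u φ 0 = u := by
  ext x
  · by_cases hx : Var.r x ∈ B
    · rw [transferFlow_r_of_mem hx, h x hx]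
    · rw [transferFlow_r_of_not_mem hx]
  all_goals rfl

/-- The derivative conditions concern the evolving variables, on which the transferred flow is `φ`.
That the right-hand sides and the domain constraint survive the change of the other variables is
assumed in `hp` and `hχ`. -/
theorem SolvesODE.transfer {l l' : List (S.RVar × Poly S)} {χ χ' : FolRA S} {d : ℝ}
    {φ : ℝ → State S} (h : SolvesODE l χ d φ) (u : State S)
    (hl : lhs l' = lhs l)
    (hp : ∀ p' ∈ l', ∃ p ∈ l, p.1 = p'.1 ∧ ∀ s ∈ Set.Icc (0 : ℝ) d,
      p'.2.eval (transferFlow (lhs l ∪ {.r S.mu}) u φ s).r = p.2.eval (φ s).r)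
    (hχ : ∀ s ∈ Set.Icc (0 : ℝ) d, χ'.Sat (transferFlow (lhs l ∪ {.r S.mu}) u φ s)) :
    SolvesODE l' χ' d (transferFlow (lhs l ∪ {.r S.mu}) u φ) := by
  have key : ∀ x, Var.r x ∈ lhs l ∪ {Var.r S.mu} →
      (fun s => (transferFlow (lhs l ∪ {.r S.mu}) u φ s).r x) = fun s => (φ s).r x :=
    fun x hx => funext fun s => transferFlow_r_of_mem hx
  intro s hs
  obtain ⟨h1, h2, h3, h4, h5, h6⟩ := h s hs
  refine ⟨?_, ?_, hχ s hs, ?_, rfl, rfl⟩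
  · rw [key _ (.inr rfl)]; exact h1
  · intro p' hp'
    obtain ⟨p, hpl, e, h7⟩ := hp p' hp'
    rw [key _ (.inl ⟨p, hpl, by rw [e]⟩), h7 s hs, ← e]
    exact h2 p hpl
  · intro y hy
    rw [hl] at hy
    rw [transferFlow_r_of_not_mem hy, transferFlow_r_of_not_mem hy]

/-- Evolving variables are free as well as bound, so the absence of capture forbids replacing them
(`hid`), and the replacements of the other free variables read no evolving variable (`hcap`). The
replacements are thus constant along a flow, and a flow of either system, transferred to the other
start state, solves the other system. -/
theorem SubRel.bisim_ode {σ : Sub S} {l : List (S.RVar × Poly S)} {χ : FolRA S} {X : Set (Var S)}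
    (ha : (Prog.ode l χ).Adm σ) (hX : (Prog.ode l χ).FV ⊆ X) :
    Bisim (SubRel σ X) (PostRel σ X (Prog.ode l χ).MBV)
      ((Prog.ode l χ).subst σ).sem (Prog.ode l χ).sem := by
  set B : Set (Var S) := lhs l ∪ {.r S.mu} with hBdef
  have hBX : B ⊆ X := fun z hz => hX (.inl (.inl hz))
  have hid : ∀ x, Var.r x ∈ B → σ x = .var x := by
    intro x hx
    by_contra h
    exact (ha.2 x (.inl (.inl hx)) h).1 hx
  have hcap : ∀ x, Var.r x ∈ (Prog.ode l χ).FV → Var.r x ∉ B → ∀ z, Var.r z ∈ (σ x).FV →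
      Var.r z ∉ B := by
    intro x hx hxB z hz hzB
    by_cases h : σ x = .var x
    · rw [h] at hz
      have : z = x := by simpa [Poly.FV, Poly.fv] using hz
      exact hxB (this ▸ hzB)
    · have : Var.r z ∈ (σ x).FV ∩ B := ⟨hz, hzB⟩
      have h2 := (ha.2 x hx h).2
      rw [show (Prog.ode l χ).BV = B from rfl] at h2
      rw [h2] at this; exact this
  have hl := lhs_map_subst l σ
  have hrhs : ∀ p ∈ l, p.2.FV ⊆ (Prog.ode l χ).FV := fun p hp z hz => .inl (.inr ⟨p, hp, hz⟩)
  have hχF : χ.FV ⊆ (Prog.ode l χ).FV := fun z hz => .inr hz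
  constructor
  · intro v u τ o hR h
    obtain ⟨rfl, rfl | ⟨d, hd, φ, hφ, rfl, rfl⟩⟩ := mem_sem_ode.1 h
    · exact ⟨none, mem_sem_ode.2 ⟨rfl, .inl rfl⟩, .none⟩
    have hrel : ∀ s ∈ Set.Icc (0 : ℝ) d,
        SubRel σ (Prog.ode l χ).FV (φ s) (transferFlow B u φ s) := by
      intro s hs x hx
      by_cases hxB : Var.r x ∈ B
      · rw [transferFlow_r_of_mem hxB, hid x hxB]; rfl
      · rw [transferFlow_r_of_not_mem hxB, hR x (hX hx)]
        refine Poly.eval_congr fun z hz => ?_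
        have := (hφ s hs).2.2.2.1 z (by rw [hl]; exact hcap x hx hxB z hz)
        exact this.symm
    refine ⟨some (transferFlow B u φ d), mem_sem_ode.2 ⟨rfl, .inr ⟨d, hd, _,
      ?_, ?_, rfl⟩⟩, .some ?_⟩
    · have := hφ.transfer (l' := l) (χ' := χ) u hl.symm
      rw [hl] at this
      refine this ?_ ?_
      · intro p hp
        exact ⟨(p.1, p.2.subst σ), List.mem_map.2 ⟨p, hp, rfl⟩, rfl, fun s hs =>
          ((hrel s hs).eval (hrhs p hp)).symm⟩
      · exact fun s hs => (FolRA.sat_subst ha.1 ((hrel s hs).mono hχF)).1 (hφ s hs).2.2.1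
    · refine (transferFlow_zero fun x hx => ?_).symm
      rw [hR x (hBX hx), hid x hx]; rfl
    · intro x hx
      by_cases hxB : Var.r x ∈ B
      · exact transferFlow_r_of_mem hxB
      · obtain hx | ⟨hxX, hσ⟩ := hx
        · exact absurd hx hxB
        · have := (hφ d ⟨hd, le_rfl⟩).2.2.2.1 x (by rw [hl]; exact hxB)
          rw [transferFlow_r_of_not_mem hxB, this, hR x hxX, hσ]; rfl
  · intro u v τ o hR h
    obtain ⟨rfl, rfl | ⟨d, hd, φ, hφ, rfl, rfl⟩⟩ := mem_sem_ode.1 h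
    · exact ⟨none, mem_sem_ode.2 ⟨rfl, .inl rfl⟩, .none⟩
    have hR' : SubRel σ X v (φ 0) := hR
    have hrel : ∀ s ∈ Set.Icc (0 : ℝ) d,
        SubRel σ (Prog.ode l χ).FV (transferFlow B v φ s) (φ s) := by
      intro s hs x hx
      by_cases hxB : Var.r x ∈ B
      · rw [hid x hxB]; exact (transferFlow_r_of_mem hxB).symm
      · rw [(hφ s hs).2.2.2.1 x hxB, hR' x (hX hx)]
        exact Poly.eval_congr fun z hz => (transferFlow_r_of_not_mem (hcap x hx hxB z hz)).symm
    refine ⟨some (transferFlow B v φ d), mem_sem_ode.2 ⟨rfl, .inr ⟨d, hd, _,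
      ?_, ?_, rfl⟩⟩, .some ?_⟩
    · refine hφ.transfer v hl ?_ ?_
      · intro p' hp'
        obtain ⟨p, hp, rfl⟩ := List.mem_map.1 hp'
        exact ⟨p, hp, rfl, fun s hs => (hrel s hs).eval (hrhs p hp)⟩
      · exact fun s hs => (FolRA.sat_subst ha.1 ((hrel s hs).mono hχF)).2 (hφ s hs).2.2.1
    · refine (transferFlow_zero fun x hx => ?_).symm
      rw [hR' x (hBX hx), hid x hx]; rfl
    · intro x hx
      by_cases hxB : Var.r x ∈ B
      · exact (transferFlow_r_of_mem hxB).symm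
      · obtain hx | ⟨hxX, hσ⟩ := hx
        · exact absurd hx hxB
        · rw [transferFlow_r_of_not_mem hxB, (hφ d ⟨hd, le_rfl⟩).2.2.2.1 x hxB, hR' x hxX, hσ]
          rfl

/-- The substitution lemma for programs. -/
theorem SubRel.bisim {α : Prog S} {σ : Sub S} {X : Set (Var S)} (hwf : α.WF) (ha : α.Adm σ)
    (hX : α.FV ⊆ X) :
    Bisim (SubRel σ X) (PostRel σ X α.MBV) (α.subst σ).sem α.sem := by
  induction α generalizing σ X with
  | assign l =>
    have key : ∀ v u, SubRel σ X v u → PostRel σ X (Prog.assign l).MBV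
        (v.assign (l.map fun p => (p.1, p.2.subst σ))) (u.assign l) := by
      intro v u hR x hx
      rw [State.assign_r, State.assign_r]
      by_cases hxl : Var.r x ∈ lhs l
      · rw [listSub_map_subst hxl]
        exact (hR.eval fun z hz => hX ⟨_, listSub_mem hxl, hz⟩).symm
      · obtain hx | ⟨hxX, hσ⟩ := hx
        · exact absurd hx hxl
        · rw [listSub_of_not_mem hxl, listSub_of_not_mem (by rwa [lhs_map_subst])]
          have := hR x hxX
          rw [hσ] at this; exact this
    constructor
    · intro v u τ o hR h
      obtain ⟨rfl, rfl | rfl⟩ := mem_sem_assign.1 h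
      · exact ⟨none, mem_sem_assign.2 ⟨rfl, .inl rfl⟩, .none⟩
      · exact ⟨_, mem_sem_assign.2 ⟨rfl, .inr rfl⟩, .some (key v u hR)⟩
    · intro u v τ o hR h
      obtain ⟨rfl, rfl | rfl⟩ := mem_sem_assign.1 h
      · exact ⟨none, mem_sem_assign.2 ⟨rfl, .inl rfl⟩, .none⟩
      · exact ⟨_, mem_sem_assign.2 ⟨rfl, .inr rfl⟩, .some (key v u hR)⟩
  | nondet x =>
    have key : ∀ v u a, SubRel σ X v u → PostRel σ X (Prog.nondet x).MBV
        (v.setR x a) (u.setR x a) := by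
      intro v u a hR y hy
      by_cases hyx : y = x
      · subst hyx; simp
      · obtain hy | ⟨hyX, hσ⟩ := hy
        · exact absurd (Var.r.inj hy) hyx
        · rw [State.setR_ne _ _ hyx, State.setR_ne _ _ hyx, hR y hyX, hσ]; rfl
    constructor
    · intro v u τ o hR h
      obtain ⟨rfl, rfl | ⟨a, rfl⟩⟩ := mem_sem_nondet.1 h
      · exact ⟨none, mem_sem_nondet.2 ⟨rfl, .inl rfl⟩, .none⟩
      · exact ⟨_, mem_sem_nondet.2 ⟨rfl, .inr ⟨a, rfl⟩⟩, .some (key v u a hR)⟩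
    · intro u v τ o hR h
      obtain ⟨rfl, rfl | ⟨a, rfl⟩⟩ := mem_sem_nondet.1 h
      · exact ⟨none, mem_sem_nondet.2 ⟨rfl, .inl rfl⟩, .none⟩
      · exact ⟨_, mem_sem_nondet.2 ⟨rfl, .inr ⟨a, rfl⟩⟩, .some (key v u a hR)⟩
  | ode l χ => exact SubRel.bisim_ode ha hX
  | test χ =>
    have key : ∀ v u, SubRel σ X v u → PostRel σ X (Prog.test χ).MBV v u := by
      rintro v u hR y (hy | ⟨hyX, hσ⟩)
      · exact hy.elim
      · rw [hR y hyX, hσ]; rfl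
    constructor
    · intro v u τ o hR h
      obtain ⟨rfl, rfl | ⟨rfl, hs⟩⟩ := mem_sem_test.1 h
      · exact ⟨none, mem_sem_test.2 ⟨rfl, .inl rfl⟩, .none⟩
      · exact ⟨_, mem_sem_test.2 ⟨rfl, .inr ⟨rfl, (FolRA.sat_subst ha (hR.mono hX)).1 hs⟩⟩,
          .some (key v u hR)⟩
    · intro u v τ o hR h
      obtain ⟨rfl, rfl | ⟨rfl, hs⟩⟩ := mem_sem_test.1 h
      · exact ⟨none, mem_sem_test.2 ⟨rfl, .inl rfl⟩, .none⟩
      · exact ⟨_, mem_sem_test.2 ⟨rfl, .inr ⟨rfl, (FolRA.sat_subst ha (SubRel.mono hR hX)).2 hs⟩⟩,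
          .some (key v u hR)⟩
  | seq a b iha ihb =>
    -- Behind `a` the relation holds on the variables that `a` must bind, on the unreplaced ones in
    -- `X`, and on those free in `b`. The run of `b` needs the last kind only; the other two are
    -- kept to describe the final states.
    set Y : Set (Var S) :=
      {z | z ∈ a.MBV ∨ ∃ x, z = Var.r x ∧ z ∈ X ∧ σ x = .var x} ∪ b.FV with hY
    have h1 : Bisim (SubRel σ X) (SubRel (σ.off a.MBV) Y) (a.subst σ).sem a.sem := by
      refine (iha hwf.1 ha.1 (Set.subset_union_left.trans hX)).mono (fun _ _ h => h) ?_
      intro v u τ w w' hR hw hw' hp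
      refine hR.next (B := a.BV) ?_ (Prog.frame hw') hp (Set.subset_union_right.trans hX) ha.2.2
      have := Prog.frame hw
      rwa [Prog.BV_subst] at this
    have h2 := ihb (X := Y) hwf.2 ha.2.1 Set.subset_union_right
    refine (h1.seqOp h2).mono (fun _ _ h => h) ?_
    intro v u τ w w' hR hw hw' hp x hx
    obtain (hx | hx) | ⟨hxX, hσ⟩ := hx
    · exact hp x (.inr ⟨.inl (.inl hx), Sub.off_of_mem hx⟩)
    · exact hp x (.inl hx)
    · refine hp x (.inr ⟨.inl (.inr ⟨x, rfl, hxX, hσ⟩), ?_⟩)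
      simp [Sub.off, hσ]
  | choice a b iha ihb =>
    have h1 := iha (X := X) hwf.1 ha.1 (Set.subset_union_left.trans hX)
    have h2 := ihb (X := X) hwf.2 ha.2 (Set.subset_union_right.trans hX)
    refine Bisim.choice (h1.mono (fun _ _ h => h) ?_) (h2.mono (fun _ _ h => h) ?_)
    · exact fun v u τ w w' hR hw hw' hp x hx => hp x (hx.imp (fun h => h.1) id)
    · exact fun v u τ w w' hR hw hw' hp x hx => hp x (hx.imp (fun h => h.2) id)
  | star a iha =>
    -- The relation must be a loop invariant. A replaced variable outside `a.FV` may be overwritten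
    -- by the body and is given up. This costs nothing: a loop must bind no variable, so `PostRel`
    -- speaks about unreplaced variables only.
    set Y : Set (Var S) := {z | ∃ x, z = Var.r x ∧ z ∈ X ∧ σ x = .var x} ∪ a.FV with hY
    have hYX : Y ⊆ X := by
      rintro z (⟨x, -, h, -⟩ | h)
      · exact h
      · exact hX h
    have h1 : Bisim (SubRel σ Y) (SubRel σ Y) (a.subst σ).sem a.sem := by
      refine (iha hwf ha.1 Set.subset_union_right).mono (fun _ _ h => h) ?_
      intro v u τ w w' hR hw hw' hp x hx
      by_cases hσ : σ x = .var x
      · rw [hσ]; exact hp x (.inr ⟨hx, hσ⟩)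
      · have hxF : Var.r x ∈ a.FV := by
          obtain ⟨y, e, -, h⟩ | h := hx
          · cases e; exact absurd h hσ
          · exact h
        obtain ⟨h3, h4⟩ := ha.2 x hxF hσ
        rw [(Prog.frame hw').r x h3, hR x hx]
        refine Poly.eval_congr fun z hz => ((Prog.frame hw).r z fun hzB => ?_).symm
        rw [Prog.BV_subst] at hzB
        have : Var.r z ∈ (σ x).FV ∩ a.BV := ⟨hz, hzB⟩
        rw [h4] at this; exact this
    refine h1.star.mono (fun _ _ h => h.mono hYX) ?_
    rintro v u τ w w' hR hw hw' hp x (hx | ⟨hxX, hσ⟩)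
    · exact hx.elim
    · rw [hp x (.inl ⟨x, rfl, hxX, hσ⟩), hσ]; rfl
  | send c h p =>
    have hev : ∀ v u, SubRel σ X v u →
        (⟨c, (p.subst σ).eval v.r, v.r S.mu⟩ : Event S) = ⟨c, p.eval u.r, u.r S.mu⟩ := by
      intro v u hR
      have := hR S.mu (hX (.inl (.inr rfl)))
      rw [hR.eval (Set.subset_union_right.trans hX), this, show σ S.mu = _ from ha]; rfl
    have key : ∀ v u, SubRel σ X v u → PostRel σ X (Prog.send c h p).MBV v u := by
      rintro v u hR y (hy | ⟨hyX, hσ⟩)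
      · cases hy
      · rw [hR y hyX, hσ]; rfl
    constructor
    · intro v u τ o hR hs
      obtain ⟨rfl, rfl⟩ | ⟨rfl, rfl | rfl⟩ := mem_sem_send.1 hs
      · exact ⟨none, Prog.nil_none_mem_sem _ _, .none⟩
      · exact ⟨none, mem_sem_send.2 (.inr ⟨by rw [hev v u hR], .inl rfl⟩), .none⟩
      · exact ⟨some u, mem_sem_send.2 (.inr ⟨by rw [hev v u hR], .inr rfl⟩), .some (key v u hR)⟩
    · intro u v τ o hR hs
      obtain ⟨rfl, rfl⟩ | ⟨rfl, rfl | rfl⟩ := mem_sem_send.1 hs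
      · exact ⟨none, Prog.nil_none_mem_sem _ _, .none⟩
      · exact ⟨none, mem_sem_send.2 (.inr ⟨by rw [hev v u hR], .inl rfl⟩), .none⟩
      · exact ⟨some v, mem_sem_send.2 (.inr ⟨by rw [hev v u hR], .inr rfl⟩), .some (key v u hR)⟩
  | recv c h x =>
    have hmu : ∀ v u, SubRel σ X v u → u.r S.mu = v.r S.mu := by
      intro v u hR
      rw [hR S.mu (hX (.inr rfl)), show σ S.mu = _ from ha]; rfl
    have key : ∀ v u a, SubRel σ X v u → PostRel σ X (Prog.recv c h x).MBV
        (v.setR x a) (u.setR x a) := by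
      intro v u a hR y hy
      by_cases hyx : y = x
      · subst hyx; simp
      · obtain (hy | hy) | ⟨hyX, hσ⟩ := hy
        · cases hy
        · exact absurd (Var.r.inj hy) hyx
        · rw [State.setR_ne _ _ hyx, State.setR_ne _ _ hyx, hR y hyX, hσ]; rfl
    constructor
    · intro v u τ o hR hs
      obtain ⟨a, ⟨rfl, rfl⟩ | ⟨rfl, rfl | rfl⟩⟩ := mem_sem_recv.1 hs
      · exact ⟨none, Prog.nil_none_mem_sem _ _, .none⟩
      · exact ⟨none, mem_sem_recv.2 ⟨a, .inr ⟨by rw [hmu v u hR], .inl rfl⟩⟩, .none⟩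
      · exact ⟨_, mem_sem_recv.2 ⟨a, .inr ⟨by rw [hmu v u hR], .inr rfl⟩⟩,
          .some (key v u a hR)⟩
    · intro u v τ o hR hs
      obtain ⟨a, ⟨rfl, rfl⟩ | ⟨rfl, rfl | rfl⟩⟩ := mem_sem_recv.1 hs
      · exact ⟨none, Prog.nil_none_mem_sem _ _, .none⟩
      · exact ⟨none, mem_sem_recv.2 ⟨a, .inr ⟨by rw [hmu v u hR], .inl rfl⟩⟩, .none⟩
      · exact ⟨_, mem_sem_recv.2 ⟨a, .inr ⟨by rw [hmu v u hR], .inr rfl⟩⟩,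
          .some (key v u a hR)⟩
  | par a b iha ihb =>
    obtain ⟨wa, wb, na, nb, -, hba⟩ := hwf
    have h1 := iha (X := X) wa ha.1 (Set.subset_union_left.trans hX)
    have h2 := ihb (X := X) wb ha.2 (Set.subset_union_right.trans hX)
    have ca : (a.subst σ).BV = a.BV := Prog.BV_subst a σ
    have cb : (b.subst σ).BV = b.BV := Prog.BV_subst b σ
    rw [show (Prog.par a b).subst σ = .par (a.subst σ) (b.subst σ) from rfl]
    refine h1.par h2 (Prog.CN_subst a σ).symm (Prog.CN_subst b σ).symm ca.symm ?_
    intro v u τ₁ τ₂ w₁ w₂ w₁' w₂' hR m1 m2 m1' m2' q1 q2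
    have f1 := Prog.frame m1
    have f2 := Prog.frame m2
    have f1' := Prog.frame m1'
    have f2' := Prog.frame m2'
    rw [ca] at f1 ⊢
    rw [cb] at f2
    -- If a component lets time pass, the time is in `X` and unreplaced; then the final times of the
    -- components agree on one side exactly if they do on the other.
    have hmu : Var.r S.mu ∈ a.BV ∨ Var.r S.mu ∈ b.BV →
        Var.r S.mu ∈ X ∧ σ S.mu = .var S.mu := by
      rintro (h | h)
      · exact ⟨hX (.inl (Prog.mu_mem_FV na h)), ha.1.mu_eq na h⟩
      · exact ⟨hX (.inr (Prog.mu_mem_FV nb h)), ha.2.mu_eq nb h⟩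
    constructor
    · by_cases h : Var.r S.mu ∈ a.BV ∨ Var.r S.mu ∈ b.BV
      · rw [q1 _ (.inr (hmu h)), q2 _ (.inr (hmu h))]
      · obtain ⟨ha', hb'⟩ := not_or.1 h
        simp [f1.r _ ha', f2.r _ hb', f1'.r _ ha', f2'.r _ hb']
    · intro x hx
      by_cases hxa : Var.r x ∈ a.BV
      · simp only [mergeState, hxa, if_true]
        obtain (hx | hx) | hx := hx
        · exact q1 x (.inl hx)
        -- A real variable that `b` must bind, but that the merge takes from `a`, is shared; only
        -- the global time may be.
        · obtain e | ⟨h, e⟩ := hba ⟨.inr (b.MBV_subset_BV hx), hxa⟩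
          · cases e
            exact q1 _ (.inr (hmu (.inl hxa)))
          · cases e
        · exact q1 x (.inr hx)
      · simp only [mergeState, hxa, if_false]
        obtain (hx | hx) | hx := hx
        · exact absurd (a.MBV_subset_BV hx) hxa
        · exact q2 x (.inl hx)
        · exact q2 x (.inr hx)

/-! ### Substitution and coincidence for formulas -/

theorem Poly.eval_toR (p : Poly S) (v : State S) : p.toR.eval v = p.eval v.r := by
  induction p with
  | var x => rfl
  | const q => rfl
  | add p q ihp ihq => exact congrArg₂ (· + ·) ihp ihq
  | mul p q ihp ihq => exact congrArg₂ (· * ·) ihp ihq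

theorem FolRA.sat_toFml (χ : FolRA S) (v : State S) : χ.toFml.Sat v ↔ χ.Sat v := by
  induction χ generalizing v with
  | eq p q => simp only [FolRA.toFml, Fml.Sat, FolRA.Sat, Poly.eval_toR]
  | ge p q => simp only [FolRA.toFml, Fml.Sat, FolRA.Sat, Poly.eval_toR]
  | not a ih => exact not_congr (ih v)
  | and a b iha ihb => exact and_congr (iha v) (ihb v)
  | or a b iha ihb => exact or_congr (iha v) (ihb v)
  | imp a b iha ihb => exact imp_congr (iha v) (ihb v)
  | all x a ih => exact forall_congr' fun d => ih _
  | ex x a ih => exact exists_congr fun d => ih _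

@[simp] theorem FolRA.sat_tt (v : State S) : (FolRA.tt : FolRA S).Sat v := by
  simp [FolRA.tt, FolRA.Sat]

@[simp] theorem Fml.sat_tt (v : State S) : (Fml.tt : Fml S).Sat v :=
  (FolRA.sat_toFml _ v).2 (FolRA.sat_tt v)

/-- On `X`, the state `u` has the values of the substituted terms in `v`, the traces being compared
on the channels in `C` only. -/
structure FmlRel (σ : Sub S) (X : Set (Var S)) (C : Set S.Chan) (v u : State S) : Prop where
  r : SubRel σ X v u
  n : ∀ i, Var.n i ∈ X → u.n i = v.n i
  t : ∀ h, Var.t h ∈ X → Trace.proj (u.t h) C = Trace.proj (v.t h) C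

theorem FmlRel.mono {σ : Sub S} {X Y : Set (Var S)} {C D : Set S.Chan} {v u : State S}
    (h : FmlRel σ X C v u) (hY : Y ⊆ X) (hD : D ⊆ C) : FmlRel σ Y D v u :=
  ⟨h.r.mono hY, fun i hi => h.n i (hY hi),
    fun g hg => Trace.proj_eq_of_subset hD (h.t g (hY hg))⟩

/-- An arbitrary outer projection `Y` is needed for the induction: the term under a projection may
access channels outside `C`, and only the intersection with what is kept is controlled. -/
theorem TTerm.proj_eval_subst {te : TTerm S} {σ : Sub S} {X : Set (Var S)} {C Y : Set S.Chan}
    {v u : State S} (h : FmlRel σ X C v u) (hX : te.FV ⊆ X) (hC : te.CN ∩ Y ⊆ C) :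
    Trace.proj ((te.subst σ).eval v) Y = Trace.proj (te.eval u) Y := by
  induction te generalizing Y with
  | var g =>
    exact Trace.proj_eq_of_subset (by simpa [TTerm.CN] using hC) (h.t g (hX rfl)).symm
  | eps => rfl
  | item c p q =>
    simp only [TTerm.subst, TTerm.eval, h.r.eval (Set.subset_union_left.trans hX),
      h.r.eval (Set.subset_union_right.trans hX)]
  | cat a b iha ihb =>
    simp only [TTerm.subst, TTerm.eval, Trace.proj_append]
    rw [iha (Set.subset_union_left.trans hX) fun c hc => hC ⟨.inl hc.1, hc.2⟩,
      ihb (Set.subset_union_right.trans hX) fun c hc => hC ⟨.inr hc.1, hc.2⟩]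
  | proj a Z iha =>
    simp only [TTerm.subst, TTerm.eval, Trace.proj_proj]
    exact iha hX fun c hc => hC ⟨⟨hc.1, hc.2.1⟩, hc.2.2⟩

theorem TTerm.eval_subst {te : TTerm S} {σ : Sub S} {X : Set (Var S)} {C : Set S.Chan}
    {v u : State S} (h : FmlRel σ X C v u) (hX : te.FV ⊆ X) (hC : te.CN ⊆ C) :
    (te.subst σ).eval v = te.eval u := by
  simpa using TTerm.proj_eval_subst (Y := Set.univ) h hX (by simpa using hC)

theorem ITerm.eval_subst {i : ITerm S} {σ : Sub S} {X : Set (Var S)} {C : Set S.Chan}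
    {v u : State S} (h : FmlRel σ X C v u) (hX : i.FV ⊆ X) (hC : i.CN ⊆ C) :
    (i.subst σ).eval v = i.eval u := by
  induction i with
  | var i => exact (h.n i (hX rfl)).symm
  | zero => rfl
  | one => rfl
  | add a b iha ihb =>
    exact congrArg₂ (· + ·)
      (iha (Set.subset_union_left.trans hX) (Set.subset_union_left.trans hC))
      (ihb (Set.subset_union_right.trans hX) (Set.subset_union_right.trans hC))
  | len a => exact congrArg List.length (TTerm.eval_subst h hX hC)

theorem RTerm.eval_subst {e : RTerm S} {σ : Sub S} {X : Set (Var S)} {C : Set S.Chan}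
    {v u : State S} (h : FmlRel σ X C v u) (hX : e.FV ⊆ X) (hC : e.CN ⊆ C) :
    (e.subst σ).eval v = e.eval u := by
  induction e with
  | var x => exact (Poly.eval_toR _ _).trans (h.r x (hX rfl)).symm
  | const q => rfl
  | add a b iha ihb =>
    exact congrArg₂ (· + ·)
      (iha (Set.subset_union_left.trans hX) (Set.subset_union_left.trans hC))
      (ihb (Set.subset_union_right.trans hX) (Set.subset_union_right.trans hC))
  | mul a b iha ihb =>
    exact congrArg₂ (· * ·)
      (iha (Set.subset_union_left.trans hX) (Set.subset_union_left.trans hC))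
      (ihb (Set.subset_union_right.trans hX) (Set.subset_union_right.trans hC))
  | val a i =>
    exact congrArg₂ Trace.valAt
      (TTerm.eval_subst h (Set.subset_union_left.trans hX) (Set.subset_union_left.trans hC))
      (ITerm.eval_subst h (Set.subset_union_right.trans hX) (Set.subset_union_right.trans hC))
  | stamp a i =>
    exact congrArg₂ Trace.timeAt
      (TTerm.eval_subst h (Set.subset_union_left.trans hX) (Set.subset_union_left.trans hC))
      (ITerm.eval_subst h (Set.subset_union_right.trans hX) (Set.subset_union_right.trans hC))

theorem CTerm.eval_subst {e : CTerm S} {σ : Sub S} {X : Set (Var S)} {C : Set S.Chan}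
    {v u : State S} (h : FmlRel σ X C v u) (hX : e.FV ⊆ X) (hC : e.CN ⊆ C) :
    (e.subst σ).eval v = e.eval u := by
  cases e with
  | ch c => rfl
  | chan a i =>
    exact congrArg₂ Trace.chanAt
      (TTerm.eval_subst h (Set.subset_union_left.trans hX) (Set.subset_union_left.trans hC))
      (ITerm.eval_subst h (Set.subset_union_right.trans hX) (Set.subset_union_right.trans hC))

theorem Sub.off_eq_self {σ : Sub S} {X : Set (Var S)} (h : ∀ x, Var.r x ∉ X) : σ.off X = σ :=
  funext fun x => Sub.off_of_not_mem (h x)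

theorem FmlRel.setR {σ : Sub S} {F : Set (Var S)} {C : Set S.Chan} {v u : State S} {x : S.RVar}
    (h : FmlRel σ (F \ {.r x}) C v u) (hc : σ.NoCapture (F \ {.r x}) {.r x}) (d : ℝ) :
    FmlRel (σ.off {.r x}) F C (v.setR x d) (u.setR x d) :=
  ⟨h.r.setR hc d, fun i hi => h.n i ⟨hi, by simp⟩, fun g hg => h.t g ⟨hg, by simp⟩⟩

theorem FmlRel.setN {σ : Sub S} {F : Set (Var S)} {C : Set S.Chan} {v u : State S} {i : S.NVar}
    (h : FmlRel σ (F \ {.n i}) C v u) (d : ℕ) :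
    FmlRel (σ.off {.n i}) F C (v.setN i d) (u.setN i d) := by
  rw [Sub.off_eq_self (by simp)]
  refine ⟨fun x hx => h.r x ⟨hx, by simp⟩, fun j hj => ?_, fun g hg => h.t g ⟨hg, by simp⟩⟩
  by_cases hji : j = i
  · subst hji; simp
  · rw [State.setN_ne _ _ hji, State.setN_ne _ _ hji]
    exact h.n j ⟨hj, by simpa using hji⟩

theorem FmlRel.setT {σ : Sub S} {F : Set (Var S)} {C : Set S.Chan} {v u : State S} {g : S.TVar}
    (h : FmlRel σ (F \ {.t g}) C v u) (d : Trace S) :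
    FmlRel (σ.off {.t g}) F C (v.setT g d) (u.setT g d) := by
  rw [Sub.off_eq_self (by simp)]
  refine ⟨fun x hx => h.r x ⟨hx, by simp⟩, fun i hi => h.n i ⟨hi, by simp⟩, fun j hj => ?_⟩
  by_cases hji : j = g
  · subst hji; simp
  · rw [State.setT_ne _ _ hji, State.setT_ne _ _ hji]
    exact h.t j ⟨hj, by simpa using hji⟩

theorem FmlRel.app {σ : Sub S} {X : Set (Var S)} {C : Set S.Chan} {v u : State S}
    (h : FmlRel σ X C v u) (τ : RecTrace S) : FmlRel σ X C (v.app τ) (u.app τ) :=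
  ⟨h.r, h.n, fun g hg => by simp [h.t g hg]⟩

theorem Prog.n_not_mem_MBV (α : Prog S) (i : S.NVar) : Var.n i ∉ α.MBV := by
  induction α with
  | assign l => rintro ⟨p, -, e⟩; cases e
  | nondet x => rintro ⟨⟩
  | ode l χ => rintro (⟨p, -, e⟩ | e) <;> cases e
  | test χ => exact id
  | seq a b iha ihb => exact fun h => h.elim iha ihb
  | choice a b iha ihb => exact fun h => iha h.1
  | star a iha => exact id
  | send c g p => rintro ⟨⟩
  | recv c g x => rintro (e | e) <;> cases e
  | par a b iha ihb => exact fun h => h.elim iha ihb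

/-- Real variables are covered by `SubRel.next`. Integers and traces are unchanged by the runs, so
only the index set has to be checked: integer variables are never must-bound, and must-bound
recorders are free in `α`. -/
theorem FmlRel.next {α : Prog S} {σ : Sub S} {F : Set (Var S)} {C : Set S.Chan}
    {v u w w' : State S} (h : FmlRel σ (α.FV ∪ (F \ α.MBV)) C v u)
    (hw : Frame α.BV v w) (hw' : Frame α.BV u w')
    (hp : PostRel σ (α.FV ∪ (F \ α.MBV)) α.MBV w w')
    (hc : σ.NoCapture (F \ α.MBV) α.BV) :
    FmlRel (σ.off α.MBV) F C w w' := by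
  refine ⟨(h.r.next hw hw' hp Set.subset_union_right hc).mono Set.subset_union_right, ?_, ?_⟩
  · intro i hi
    rw [hw.n, hw'.n]
    exact h.n i (.inr ⟨hi, α.n_not_mem_MBV i⟩)
  · intro g hg
    rw [hw.t, hw'.t]
    by_cases hm : Var.t g ∈ α.MBV
    · exact h.t g (.inl (Prog.t_mem_FV_of_mem_MBV hm))
    · exact h.t g (.inr ⟨hg, hm⟩)

/-- The substitution lemma for the boxes: whatever holds after the run of the substituted program
is matched by a run of the original one, and conversely. -/
theorem FmlRel.bisim {α : Prog S} {σ : Sub S} {F : Set (Var S)} {C : Set S.Chan}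
    (hwf : α.WF) (ha : α.Adm σ) (hc : σ.NoCapture (F \ α.MBV) α.BV) :
    Bisim (FmlRel σ (α.FV ∪ (F \ α.MBV)) C) (FmlRel (σ.off α.MBV) F C)
      (α.subst σ).sem α.sem := by
  refine (SubRel.bisim (X := α.FV ∪ (F \ α.MBV)) hwf ha Set.subset_union_left).mono
    (fun _ _ h => h.r) ?_
  intro v u τ w w' hR hw hw' hp
  refine hR.next ?_ (Prog.frame hw') hp hc
  have := Prog.frame hw
  rwa [Prog.BV_subst] at this

theorem sat_box_congr {α β : Prog S} {a b : Fml S} {R Q : State S → State S → Prop}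
    {v u : State S} (hb : Bisim R Q α.sem β.sem) (hR : R v u)
    (h : ∀ w w' τ, Q w w' → (a.Sat (w.app τ) ↔ b.Sat (w'.app τ))) :
    (Fml.box α a).Sat v ↔ (Fml.box β b).Sat u := by
  constructor
  · intro hv τ w' hw'
    obtain ⟨o, h1, h2⟩ := hb.2 u v τ _ hR hw'
    cases h2 with
    | some h2 => exact (h _ _ τ h2).1 (hv τ _ h1)
  · intro hu τ w hw
    obtain ⟨o, h1, h2⟩ := hb.1 v u τ _ hR hw
    cases h2 with
    | some h2 => exact (h _ _ τ h2).2 (hu τ _ h1)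

/-- Matching runs have the same communication, and `A` and `C` are evaluated in the initial states.
So they are compared along equal traces, whatever the final states are. -/
theorem sat_acbox_congr {α β : Prog S} {A A' C C' a b : Fml S} {R Q : State S → State S → Prop}
    {v u : State S} (hb : Bisim R Q α.sem β.sem) (hR : R v u)
    (hA : ∀ τ, A.Sat (v.app τ) ↔ A'.Sat (u.app τ))
    (hC : ∀ τ, C.Sat (v.app τ) ↔ C'.Sat (u.app τ))
    (h : ∀ w w' τ, Q w w' → (a.Sat (w.app τ) ↔ b.Sat (w'.app τ))) :
    (Fml.acbox α A C a).Sat v ↔ (Fml.acbox β A' C' b).Sat u := by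
  simp only [Fml.Sat, hA, hC]
  constructor
  · intro hv τ o' ho'
    obtain ⟨o, h1, h2⟩ := hb.2 u v τ _ hR ho'
    refine ⟨(hv τ o h1).1, ?_⟩
    rintro w' rfl hp
    cases h2 with
    | some h2 => exact (h _ _ τ h2).1 ((hv τ _ h1).2 _ rfl hp)
  · intro hu τ o ho
    obtain ⟨o', h1, h2⟩ := hb.1 v u τ _ hR ho
    refine ⟨(hu τ o' h1).1, ?_⟩
    rintro w rfl hp
    cases h2 with
    | some h2 => exact (h _ _ τ h2).2 ((hu τ _ h1).2 _ rfl hp)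

/-- The substitution lemma for formulas. -/
theorem Fml.sat_subst {φ : Fml S} {σ : Sub S} {C : Set S.Chan} {v u : State S} (hwf : φ.WF)
    (ha : φ.Adm σ) (hC : φ.CN ⊆ C) (h : FmlRel σ φ.FV C v u) :
    (φ.subst σ).Sat v ↔ φ.Sat u := by
  induction φ generalizing σ v u with
  | eqR a b =>
    simp only [Fml.subst, Fml.Sat,
      RTerm.eval_subst (e := a) h Set.subset_union_left (Set.subset_union_left.trans hC),
      RTerm.eval_subst (e := b) h Set.subset_union_right (Set.subset_union_right.trans hC)]
  | eqI a b =>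
    simp only [Fml.subst, Fml.Sat,
      ITerm.eval_subst (i := a) h Set.subset_union_left (Set.subset_union_left.trans hC),
      ITerm.eval_subst (i := b) h Set.subset_union_right (Set.subset_union_right.trans hC)]
  | eqC a b =>
    simp only [Fml.subst, Fml.Sat,
      CTerm.eval_subst (e := a) h Set.subset_union_left (Set.subset_union_left.trans hC),
      CTerm.eval_subst (e := b) h Set.subset_union_right (Set.subset_union_right.trans hC)]
  | eqT a b =>
    simp only [Fml.subst, Fml.Sat,
      TTerm.eval_subst (te := a) h Set.subset_union_left (Set.subset_union_left.trans hC),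
      TTerm.eval_subst (te := b) h Set.subset_union_right (Set.subset_union_right.trans hC)]
  | geR a b =>
    simp only [Fml.subst, Fml.Sat,
      RTerm.eval_subst (e := a) h Set.subset_union_left (Set.subset_union_left.trans hC),
      RTerm.eval_subst (e := b) h Set.subset_union_right (Set.subset_union_right.trans hC)]
  | geI a b =>
    simp only [Fml.subst, Fml.Sat,
      ITerm.eval_subst (i := a) h Set.subset_union_left (Set.subset_union_left.trans hC),
      ITerm.eval_subst (i := b) h Set.subset_union_right (Set.subset_union_right.trans hC)]
  | leT a b =>
    simp only [Fml.subst, Fml.Sat,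
      TTerm.eval_subst (te := a) h Set.subset_union_left (Set.subset_union_left.trans hC),
      TTerm.eval_subst (te := b) h Set.subset_union_right (Set.subset_union_right.trans hC)]
  | not a ih => exact not_congr (ih hwf ha hC h)
  | and a b iha ihb =>
    exact and_congr
      (iha hwf.1 ha.1 (Set.subset_union_left.trans hC) (h.mono Set.subset_union_left subset_rfl))
      (ihb hwf.2 ha.2 (Set.subset_union_right.trans hC) (h.mono Set.subset_union_right subset_rfl))
  | or a b iha ihb =>
    exact or_congr
      (iha hwf.1 ha.1 (Set.subset_union_left.trans hC) (h.mono Set.subset_union_left subset_rfl))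
      (ihb hwf.2 ha.2 (Set.subset_union_right.trans hC) (h.mono Set.subset_union_right subset_rfl))
  | imp a b iha ihb =>
    exact imp_congr
      (iha hwf.1 ha.1 (Set.subset_union_left.trans hC) (h.mono Set.subset_union_left subset_rfl))
      (ihb hwf.2 ha.2 (Set.subset_union_right.trans hC) (h.mono Set.subset_union_right subset_rfl))
  | all z a ih =>
    cases z with
    | r x => exact forall_congr' fun d => ih hwf ha.1 hC (FmlRel.setR h ha.2 d)
    | n i => exact forall_congr' fun d => ih hwf ha.1 hC (FmlRel.setN h d)
    | t g => exact forall_congr' fun d => ih hwf ha.1 hC (FmlRel.setT h d)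
  | ex z a ih =>
    cases z with
    | r x => exact exists_congr fun d => ih hwf ha.1 hC (FmlRel.setR h ha.2 d)
    | n i => exact exists_congr fun d => ih hwf ha.1 hC (FmlRel.setN h d)
    | t g => exact exists_congr fun d => ih hwf ha.1 hC (FmlRel.setT h d)
  | box α a ih =>
    obtain ⟨wα, wa⟩ := hwf
    obtain ⟨aα, aa, hc⟩ := ha
    exact sat_box_congr (FmlRel.bisim wα aα hc) h fun w w' τ hw => ih wa aa hC (hw.app τ)
  | acbox α A K a ihA ihK iha =>
    obtain ⟨wα, wA, wK, wa, -⟩ := hwf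
    obtain ⟨aα, aA, aK, aa, hc⟩ := ha
    -- `A` and `C` are substituted with `σ` itself, being evaluated in the initial state; only for
    -- the postcondition are the must-bound variables exempt.
    exact sat_acbox_congr (FmlRel.bisim wα aα hc)
      (h.mono (fun z hz => .inl (.inl hz)) subset_rfl)
      (fun τ => ihA wA aA (fun c hc => hC (.inl (.inr hc)))
        ((h.mono (fun z hz => .inl (.inr hz)) subset_rfl).app τ))
      (fun τ => ihK wK aK (fun c hc => hC (.inr hc))
        ((h.mono (fun z hz => .inr hz) subset_rfl).app τ))
      fun w w' τ hw => iha wa aa (fun c hc => hC (.inl (.inl hc))) (hw.app τ)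

/-! ### The identity substitution -/

/-- The identity substitution. -/
def Sub.id : Sub S := Poly.var

@[simp] theorem Sub.id_apply (x : S.RVar) : (Sub.id : Sub S) x = .var x := rfl

@[simp] theorem Sub.off_id (X : Set (Var S)) : (Sub.id : Sub S).off X = Sub.id := by
  funext x; simp [Sub.off]

theorem Sub.noCapture_id (F B : Set (Var S)) : (Sub.id : Sub S).NoCapture F B :=
  fun _ _ h => absurd rfl h

@[simp] theorem Poly.subst_id (p : Poly S) : p.subst Sub.id = p := by
  induction p <;> simp_all [Poly.subst]

@[simp] theorem TTerm.subst_id (e : TTerm S) : e.subst Sub.id = e := by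
  induction e <;> simp_all [TTerm.subst]

@[simp] theorem ITerm.subst_id (e : ITerm S) : e.subst Sub.id = e := by
  induction e <;> simp_all [ITerm.subst]

@[simp] theorem RTerm.subst_id (e : RTerm S) : e.subst Sub.id = e := by
  induction e <;> simp_all [RTerm.subst, Poly.toR]

@[simp] theorem CTerm.subst_id (e : CTerm S) : e.subst Sub.id = e := by
  cases e <;> simp [CTerm.subst]

@[simp] theorem FolRA.subst_id (χ : FolRA S) : χ.subst Sub.id = χ := by
  induction χ <;> simp_all [FolRA.subst]

@[simp] theorem Prog.subst_id (α : Prog S) : α.subst Sub.id = α := by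
  induction α <;> simp_all [Prog.subst]

@[simp] theorem Fml.subst_id (φ : Fml S) : φ.subst Sub.id = φ := by
  induction φ <;> simp_all [Fml.subst]

theorem FolRA.adm_id (χ : FolRA S) : χ.Adm Sub.id := by
  induction χ <;> simp_all [FolRA.Adm, Sub.noCapture_id]

theorem Prog.adm_id (α : Prog S) : α.Adm Sub.id := by
  induction α <;> simp_all [Prog.Adm, Sub.noCapture_id, FolRA.adm_id]

theorem Fml.adm_id (φ : Fml S) : φ.Adm Sub.id := by
  induction φ <;> simp_all [Fml.Adm, Sub.noCapture_id, Prog.adm_id]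

/-- The coincidence property, with traces compared on the accessed channels only. -/
theorem Fml.sat_congr_proj {φ : Fml S} {v u : State S} (hwf : φ.WF)
    (hr : ∀ x, Var.r x ∈ φ.FV → u.r x = v.r x) (hn : ∀ i, Var.n i ∈ φ.FV → u.n i = v.n i)
    (ht : ∀ h, Var.t h ∈ φ.FV → Trace.proj (u.t h) φ.CN = Trace.proj (v.t h) φ.CN) :
    φ.Sat v ↔ φ.Sat u := by
  have := Fml.sat_subst (v := v) (u := u) hwf φ.adm_id subset_rfl ⟨hr, hn, ht⟩
  rwa [Fml.subst_id] at this

theorem Fml.sat_congr {φ : Fml S} {v u : State S} (hwf : φ.WF)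
    (hr : ∀ x, Var.r x ∈ φ.FV → u.r x = v.r x) (hn : ∀ i, Var.n i ∈ φ.FV → u.n i = v.n i)
    (ht : ∀ h, Var.t h ∈ φ.FV → u.t h = v.t h) :
    φ.Sat v ↔ φ.Sat u :=
  Fml.sat_congr_proj hwf hr hn fun h hh => by rw [ht h hh]

/-- The real variables alone determine the behavior of a program. -/
theorem Prog.bisim_r {α : Prog S} (hwf : α.WF) :
    Bisim (fun v u : State S => u.r = v.r) (fun w w' => w'.r = w.r) α.sem α.sem := by
  have h := SubRel.bisim (X := Set.univ) hwf α.adm_id (Set.subset_univ _)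
  rw [Prog.subst_id] at h
  refine h.mono (fun v u e x _ => congrFun e x) ?_
  exact fun v u τ w w' _ _ _ hp => funext fun x => hp x (.inr ⟨trivial, rfl⟩)

/-- Both start states have the same real variables, hence runs with the same communication and the
same final reals; the frame property then determines the integers and traces of the final states. -/
theorem Prog.mem_sem_app {α : Prog S} (hwf : α.WF) {v : State S} {τ σ : RecTrace S}
    {o : Option (State S)} :
    (v.app σ, τ, o) ∈ α.sem ↔ ∃ o', (v, τ, o') ∈ α.sem ∧ o = o'.map (State.app · σ) := by
  have key : ∀ u w w' : State S, Frame α.BV u w → Frame α.BV (u.app σ) w' → w'.r = w.r →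
      w' = w.app σ := by
    intro u w w' f f' e
    ext1
    · exact e
    · rw [f'.n, State.app_n, State.app_n, f.n]
    · funext h; rw [f'.t, State.app_t, State.app_t, f.t]
  constructor
  · intro h
    obtain ⟨o', h1, h2⟩ := (Prog.bisim_r hwf).1 (v.app σ) v τ o rfl h
    refine ⟨o', h1, ?_⟩
    cases h2 with
    | none => rfl
    | some e => exact congrArg some (key _ _ _ (Prog.frame h1) (Prog.frame h) e.symm)
  · rintro ⟨o', h1, rfl⟩
    obtain ⟨o, h2, h3⟩ := (Prog.bisim_r hwf).1 v (v.app σ) τ o' rfl h1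
    cases h3 with
    | none => exact h2
    | some e =>
      rw [key _ _ _ (Prog.frame h1) (Prog.frame h2) e] at h2
      exact h2

/-! ### Renaming of trace variables -/

/-- Renaming of a recorder variable in a recorded trace. -/
noncomputable def RecTrace.ren (h k : S.TVar) (τ : RecTrace S) : RecTrace S :=
  τ.map fun e => (renVar h k e.1, e.2)

@[simp] theorem RecTrace.ren_append (h k : S.TVar) (τ τ' : RecTrace S) :
    RecTrace.ren h k (τ ++ τ') = RecTrace.ren h k τ ++ RecTrace.ren h k τ' := by
  simp [RecTrace.ren]

theorem RecTrace.proj_ren (h k : S.TVar) (τ : RecTrace S) (C : Set S.Chan) :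
    RecTrace.proj (RecTrace.ren h k τ) C = RecTrace.ren h k (RecTrace.proj τ C) := by
  simp only [RecTrace.proj, RecTrace.ren, List.filter_map]; rfl

theorem renVar_renVar {h k g : S.TVar} (hg : g ≠ k) : renVar k h (renVar h k g) = g := by
  by_cases e : g = h <;> simp [renVar, e, hg]

theorem RecTrace.ren_ren {h k : S.TVar} {τ : RecTrace S} (hk : ∀ e ∈ τ, e.1 ≠ k) :
    RecTrace.ren k h (RecTrace.ren h k τ) = τ := by
  simp only [RecTrace.ren, List.map_map]
  refine (List.map_congr_left fun e he => ?_).trans (List.map_id _)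
  simp [renVar_renVar (hk e he)]

/-- Without `hk`, the events that `k` already recorded would be mixed in. -/
theorem RecTrace.sub_ren_self {h k : S.TVar} {τ : RecTrace S} (hk : ∀ e ∈ τ, e.1 ≠ k) :
    RecTrace.sub (RecTrace.ren h k τ) k = RecTrace.sub τ h := by
  simp only [RecTrace.sub, RecTrace.ren, List.filter_map, List.map_map]
  congr 1
  refine List.filter_congr fun e he => ?_
  have := hk e he
  by_cases e1 : e.1 = h <;> simp [renVar, e1, this]

theorem RecTrace.sub_ren_ne {h k g : S.TVar} {τ : RecTrace S} (hh : g ≠ h) (hk : g ≠ k) :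
    RecTrace.sub (RecTrace.ren h k τ) g = RecTrace.sub τ g := by
  simp only [RecTrace.sub, RecTrace.ren, List.filter_map, List.map_map]
  congr 1
  refine List.filter_congr fun e he => ?_
  by_cases e1 : e.1 = h
  · simp [renVar, e1, hk.symm, hh.symm]
  · simp [renVar, e1]

@[simp] theorem Prog.CN_ren (α : Prog S) (h k : S.TVar) : (α.ren h k).CN = α.CN := by
  induction α <;> simp_all [Prog.ren, Prog.CN]

theorem Prog.r_mem_BV_ren (α : Prog S) (h k : S.TVar) (x : S.RVar) :
    Var.r x ∈ (α.ren h k).BV ↔ Var.r x ∈ α.BV := by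
  induction α <;> simp_all [Prog.ren, Prog.BV]

theorem Prog.t_mem_BV_ren (α : Prog S) {h k : S.TVar} (hk : h ≠ k) :
    Var.t h ∉ (α.ren h k).BV := by
  have : ∀ g, h ≠ renVar h k g := by
    intro g
    by_cases e : g = h
    · simp [renVar, e, hk]
    · simpa [renVar, e] using Ne.symm e
  induction α <;> simp_all [Prog.ren, Prog.BV, lhs]

theorem Prog.ren_ren {α : Prog S} {h k : S.TVar} (hk : Var.t k ∉ α.BV) :
    (α.ren h k).ren k h = α := by
  induction α with
  | send c g p =>
    have : g ≠ k := fun e => hk (by simp [Prog.BV, e])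
    simp [Prog.ren, renVar_renVar this]
  | recv c g x =>
    have : g ≠ k := fun e => hk (by simp [Prog.BV, e])
    simp [Prog.ren, renVar_renVar this]
  | _ => simp_all [Prog.ren, Prog.BV]

/-- Renaming changes the bound trace variables and thus the set on which states are merged. The
integers and traces of both states are those of `v`, so only the real variables in that set matter.
-/
theorem mergeState_congr {B B' : Set (Var S)} {v w₁ w₂ : State S} {D₁ D₂ : Set (Var S)}
    (h₁ : Frame D₁ v w₁) (h₂ : Frame D₂ v w₂) (hB : ∀ x, Var.r x ∈ B ↔ Var.r x ∈ B') :
    mergeState B w₁ w₂ = mergeState B' w₁ w₂ := by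
  ext1
  · funext x
    by_cases hx : Var.r x ∈ B
    · simp [mergeState, hx, (hB x).1 hx]
    · simp [mergeState, hx, mt (hB x).2 hx]
  · simp [mergeState, h₁.n, h₂.n]
  · simp [mergeState, h₁.t, h₂.t]

/-- Recorders are mere labels of events and influence no run. This direction therefore holds even if
the renaming identifies two recorders. -/
theorem Prog.mem_sem_ren_of_mem_sem {α : Prog S} (h k : S.TVar) {v : State S} {τ : RecTrace S}
    {o : Option (State S)} (hs : (v, τ, o) ∈ α.sem) :
    (v, RecTrace.ren h k τ, o) ∈ (α.ren h k).sem := by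
  induction α generalizing v τ o with
  | assign l => obtain ⟨rfl, -⟩ := mem_sem_assign.1 hs; exact hs
  | nondet x => obtain ⟨rfl, -⟩ := mem_sem_nondet.1 hs; exact hs
  | ode l χ => obtain ⟨rfl, -⟩ := mem_sem_ode.1 hs; exact hs
  | test χ => obtain ⟨rfl, -⟩ := mem_sem_test.1 hs; exact hs
  | seq a b iha ihb =>
    obtain ⟨rfl, w, h1⟩ | ⟨τ₁, τ₂, u, h1, h2, rfl⟩ := mem_sem_seq.1 hs
    · exact mem_sem_seq.2 (.inl ⟨rfl, w, iha h1⟩)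
    · exact mem_sem_seq.2 (.inr ⟨_, _, u, iha h1, ihb h2, RecTrace.ren_append _ _ _ _⟩)
  | choice a b iha ihb => exact Or.imp iha ihb hs
  | star a iha =>
    obtain ⟨n, hn⟩ := mem_sem_star.1 hs
    refine mem_sem_star.2 ⟨n, ?_⟩
    clear hs
    induction n generalizing v τ with
    | zero =>
      obtain ⟨rfl, -⟩ := mem_iterOp_zero.1 hn; exact hn
    | succ n ih =>
      obtain ⟨rfl, w, h1⟩ | ⟨τ₁, τ₂, u, h1, h2, rfl⟩ := mem_seqOp.1 hn
      · exact mem_seqOp.2 (.inl ⟨rfl, w, iha h1⟩)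
      · exact mem_seqOp.2 (.inr ⟨_, _, u, iha h1, ih h2, RecTrace.ren_append _ _ _ _⟩)
  | send c g p =>
    obtain ⟨rfl, rfl⟩ | ⟨rfl, ho⟩ := mem_sem_send.1 hs
    · exact Prog.nil_none_mem_sem _ _
    · exact mem_sem_send.2 (.inr ⟨rfl, ho⟩)
  | recv c g x =>
    obtain ⟨a, ⟨rfl, rfl⟩ | ⟨rfl, ho⟩⟩ := mem_sem_recv.1 hs
    · exact Prog.nil_none_mem_sem _ _
    · exact mem_sem_recv.2 ⟨a, .inr ⟨rfl, ho⟩⟩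
  | par a b iha ihb =>
    obtain ⟨w₁, w₂, h1, h2, h3, h4, h5, rfl⟩ := mem_sem_par.1 hs
    refine mem_sem_par.2 ⟨w₁, w₂, ?_, ?_, h3, List.pairwise_map.2 h4, ?_, ?_⟩
    · rw [Prog.CN_ren, RecTrace.proj_ren]; exact iha h1
    · rw [Prog.CN_ren, RecTrace.proj_ren]; exact ihb h2
    · rw [Prog.CN_ren, Prog.CN_ren, RecTrace.proj_ren, ← h5]
    · cases w₁ with
      | none => rfl
      | some w₁ => cases w₂ with
        | none => rfl
        | some w₂ =>
          exact congrArg some (mergeState_congr (Prog.frame h1) (Prog.frame h2)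
            fun x => (a.r_mem_BV_ren h k x).symm)

theorem Prog.recorder_mem_BV {α : Prog S} {v : State S} {τ : RecTrace S}
    {o : Option (State S)} (h : (v, τ, o) ∈ α.sem) : ∀ e ∈ τ, Var.t e.1 ∈ α.BV := by
  induction α generalizing v τ o with
  | assign l => obtain ⟨rfl, -⟩ := mem_sem_assign.1 h; simp
  | nondet x => obtain ⟨rfl, -⟩ := mem_sem_nondet.1 h; simp
  | ode l χ => obtain ⟨rfl, -⟩ := mem_sem_ode.1 h; simp
  | test χ => obtain ⟨rfl, -⟩ := mem_sem_test.1 h; simp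
  | seq a b iha ihb =>
    obtain ⟨-, w, h⟩ | ⟨τ₁, τ₂, u, h1, h2, rfl⟩ := mem_sem_seq.1 h
    · exact fun e he => .inl (iha h e he)
    · intro e he
      exact (List.mem_append.1 he).imp (iha h1 e) (ihb h2 e)
  | choice a b iha ihb => exact fun e he => h.imp (iha · e he) (ihb · e he)
  | star a iha =>
    obtain ⟨k, h⟩ := mem_sem_star.1 h
    induction k generalizing v τ with
    | zero => obtain ⟨rfl, -⟩ := mem_iterOp_zero.1 h; simp
    | succ k ih =>
      obtain ⟨-, w, h⟩ | ⟨τ₁, τ₂, u, h1, h2, rfl⟩ := mem_seqOp.1 h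
      · exact iha h
      · intro e he
        exact (List.mem_append.1 he).elim (iha h1 e) (ih (mem_sem_star.2 ⟨k, h2⟩) h2 e)
  | send c h' p => obtain ⟨rfl, -⟩ | ⟨rfl, -⟩ := mem_sem_send.1 h <;> simp [Prog.BV]
  | recv c h' x => obtain ⟨a, ⟨rfl, -⟩ | ⟨rfl, -⟩⟩ := mem_sem_recv.1 h <;> simp [Prog.BV]
  | par a b iha ihb =>
    obtain ⟨w₁, w₂, h1, h2, -, -, hτ, -⟩ := mem_sem_par.1 h
    intro e he
    have : e.2.ch ∈ a.CN ∨ e.2.ch ∈ b.CN := by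
      simpa using List.filter_eq_self.1 hτ.symm e he
    exact this.imp (fun hc => iha h1 e (List.mem_filter.2 ⟨he, by simpa using hc⟩))
      (fun hc => ihb h2 e (List.mem_filter.2 ⟨he, by simpa using hc⟩))

/-- The converse is obtained by renaming back. The two renamings cancel on programs because `k` is
not bound in `α`, and on traces because `h` records nothing in the renamed program. -/
theorem Prog.mem_sem_ren {α : Prog S} {h k : S.TVar} (hne : h ≠ k) (hk : Var.t k ∉ α.BV)
    {v : State S} {τ' : RecTrace S} {o : Option (State S)} :
    (v, τ', o) ∈ (α.ren h k).sem ↔ ∃ τ, (v, τ, o) ∈ α.sem ∧ τ' = RecTrace.ren h k τ := by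
  constructor
  · intro hs
    refine ⟨RecTrace.ren k h τ', ?_, (RecTrace.ren_ren fun e he eq => ?_).symm⟩
    · have := Prog.mem_sem_ren_of_mem_sem k h hs
      rwa [Prog.ren_ren hk] at this
    · exact α.t_mem_BV_ren hne (eq ▸ Prog.recorder_mem_BV hs e he)
  · rintro ⟨τ, hs, rfl⟩
    exact Prog.mem_sem_ren_of_mem_sem h k hs

/-! ### Evaluation of renamed terms and formulas -/

/-- In `u'`, the variable `k` has the value that `h` has in `u`, and other variables except `h`
agree. -/
structure RenRel (h k : S.TVar) (u' u : State S) : Prop where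
  r : u'.r = u.r
  n : u'.n = u.n
  t_self : u'.t k = u.t h
  t_ne : ∀ g, g ≠ h → g ≠ k → u'.t g = u.t g

theorem RenRel.app {h k : S.TVar} {u' u : State S} (hr : RenRel h k u' u) {τ : RecTrace S}
    (hτ : ∀ e ∈ τ, e.1 ≠ k) : RenRel h k (u'.app (RecTrace.ren h k τ)) (u.app τ) where
  r := hr.r
  n := hr.n
  t_self := by simp [hr.t_self, RecTrace.sub_ren_self hτ]
  t_ne g h1 h2 := by simp [hr.t_ne g h1 h2, RecTrace.sub_ren_ne h1 h2]

theorem RenRel.of_frame {h k : S.TVar} {u' u w' w : State S} (hr : RenRel h k u' u)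
    {B B' : Set (Var S)} (f' : Frame B' u' w') (f : Frame B u w) (e : w'.r = w.r) :
    RenRel h k w' w where
  r := e
  n := by rw [f'.n, f.n, hr.n]
  t_self := by rw [f'.t, f.t, hr.t_self]
  t_ne g h1 h2 := by rw [f'.t, f.t, hr.t_ne g h1 h2]

theorem TTerm.eval_ren {e : TTerm S} {h k : S.TVar} {u' u : State S} (hr : RenRel h k u' u)
    (hk : Var.t k ∉ e.FV) : (e.ren h k).eval u' = e.eval u := by
  induction e with
  | var g =>
    by_cases hg : g = h
    · simp [TTerm.ren, TTerm.eval, renVar, hg, hr.t_self]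
    · simp only [TTerm.ren, TTerm.eval, renVar, hg, if_false]
      exact hr.t_ne g hg fun e => hk (by simp [TTerm.FV, e])
  | eps => rfl
  | item c p q => simp [TTerm.ren, TTerm.eval, hr.r]
  | cat a b iha ihb =>
    exact congrArg₂ (· ++ ·) (iha fun h => hk (.inl h)) (ihb fun h => hk (.inr h))
  | proj a C iha => simp only [TTerm.ren, TTerm.eval, iha hk]

theorem ITerm.eval_ren {e : ITerm S} {h k : S.TVar} {u' u : State S} (hr : RenRel h k u' u)
    (hk : Var.t k ∉ e.FV) : (e.ren h k).eval u' = e.eval u := by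
  induction e with
  | var i => exact congrFun hr.n i
  | zero => rfl
  | one => rfl
  | add a b iha ihb =>
    exact congrArg₂ (· + ·) (iha fun h => hk (.inl h)) (ihb fun h => hk (.inr h))
  | len a => exact congrArg List.length (TTerm.eval_ren hr hk)

theorem RTerm.eval_ren {e : RTerm S} {h k : S.TVar} {u' u : State S} (hr : RenRel h k u' u)
    (hk : Var.t k ∉ e.FV) : (e.ren h k).eval u' = e.eval u := by
  induction e with
  | var x => exact congrFun hr.r x
  | const q => rfl
  | add a b iha ihb =>
    exact congrArg₂ (· + ·) (iha fun h => hk (.inl h)) (ihb fun h => hk (.inr h))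
  | mul a b iha ihb =>
    exact congrArg₂ (· * ·) (iha fun h => hk (.inl h)) (ihb fun h => hk (.inr h))
  | val a i =>
    exact congrArg₂ Trace.valAt (TTerm.eval_ren hr fun h => hk (.inl h))
      (ITerm.eval_ren hr fun h => hk (.inr h))
  | stamp a i =>
    exact congrArg₂ Trace.timeAt (TTerm.eval_ren hr fun h => hk (.inl h))
      (ITerm.eval_ren hr fun h => hk (.inr h))

theorem CTerm.eval_ren {e : CTerm S} {h k : S.TVar} {u' u : State S} (hr : RenRel h k u' u)
    (hk : Var.t k ∉ e.FV) : (e.ren h k).eval u' = e.eval u := by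
  cases e with
  | ch c => rfl
  | chan a i =>
    exact congrArg₂ Trace.chanAt (TTerm.eval_ren hr fun h => hk (.inl h))
      (ITerm.eval_ren hr fun h => hk (.inr h))

theorem Fml.FV_subset_vars (φ : Fml S) : φ.FV ⊆ φ.vars := by
  induction φ with
  | not a ih => exact ih
  | and a b iha ihb => exact Set.union_subset_union iha ihb
  | or a b iha ihb => exact Set.union_subset_union iha ihb
  | imp a b iha ihb => exact Set.union_subset_union iha ihb
  | all z a ih => exact fun x hx => .inr (ih hx.1)
  | ex z a ih => exact fun x hx => .inr (ih hx.1)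
  | box α a ih => exact Set.union_subset_union Set.subset_union_left fun x hx => ih hx.1
  | acbox α A C a ihA ihC iha =>
    rintro x (((hx | hx) | hx) | hx)
    · exact .inl (.inl (.inl (.inl hx)))
    · exact .inr (iha hx.1)
    · exact .inl (.inl (.inr (ihA hx)))
    · exact .inl (.inr (ihC hx))
  | _ => exact subset_rfl

theorem RenRel.sem_right {α : Prog S} (hwf : α.WF) {h k : S.TVar} (hne : h ≠ k)
    (hk : Var.t k ∉ α.BV) {u' u : State S} (hr : RenRel h k u' u) {τ' : RecTrace S}
    {o' : Option (State S)} (hs : (u', τ', o') ∈ (α.ren h k).sem) :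
    ∃ τ o, (u, τ, o) ∈ α.sem ∧ τ' = RecTrace.ren h k τ ∧ (∀ e ∈ τ, e.1 ≠ k) ∧
      Option.Rel (RenRel h k) o' o := by
  obtain ⟨τ, h1, rfl⟩ := (Prog.mem_sem_ren hne hk).1 hs
  obtain ⟨o, h2, h3⟩ := (Prog.bisim_r hwf).1 u' u τ o' hr.r.symm h1
  refine ⟨τ, o, h2, rfl, fun e he eq => hk (eq ▸ Prog.recorder_mem_BV h2 e he), ?_⟩
  cases h3 with
  | none => exact .none
  | some e => exact .some (hr.of_frame (Prog.frame h1) (Prog.frame h2) e.symm)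

theorem RenRel.sem_left {α : Prog S} (hwf : α.WF) {h k : S.TVar}
    (hk : Var.t k ∉ α.BV) {u' u : State S} (hr : RenRel h k u' u) {τ : RecTrace S}
    {o : Option (State S)} (hs : (u, τ, o) ∈ α.sem) :
    (∀ e ∈ τ, e.1 ≠ k) ∧ ∃ o', (u', RecTrace.ren h k τ, o') ∈ (α.ren h k).sem ∧
      Option.Rel (RenRel h k) o' o := by
  refine ⟨fun e he eq => hk (eq ▸ Prog.recorder_mem_BV hs e he), ?_⟩
  obtain ⟨o', h2, h3⟩ := (Prog.bisim_r hwf).1 u u' τ o hr.r hs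
  refine ⟨o', Prog.mem_sem_ren_of_mem_sem h k h2, ?_⟩
  cases h3 with
  | none => exact .none
  | some e => exact .some (hr.of_frame (Prog.frame h2) (Prog.frame hs) e)

/-- The prefixes of a renamed trace are the renamed prefixes. Renaming preserves length, so proper
prefixes correspond as well, without any injectivity. -/
theorem RenRel.forall_prefix {h k : S.TVar} {A A' : Fml S} {u' u : State S} {τ : RecTrace S}
    (hA : ∀ τ' : RecTrace S, (∀ e ∈ τ', e.1 ≠ k) →
      (A'.Sat (u'.app (RecTrace.ren h k τ')) ↔ A.Sat (u.app τ')))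
    (hτ : ∀ e ∈ τ, e.1 ≠ k) :
    ((∀ τ', τ' <+: RecTrace.ren h k τ → A'.Sat (u'.app τ')) ↔
      ∀ τ', τ' <+: τ → A.Sat (u.app τ')) ∧
    ((∀ τ', τ' <+: RecTrace.ren h k τ → τ' ≠ RecTrace.ren h k τ → A'.Sat (u'.app τ')) ↔
      ∀ τ', τ' <+: τ → τ' ≠ τ → A.Sat (u.app τ')) := by
  have hsub : ∀ τ', τ' <+: τ → ∀ e ∈ τ', e.1 ≠ k := fun τ' hp e he => hτ e (hp.subset he)
  refine ⟨⟨fun H τ' hp => ?_, fun H τ' hp => ?_⟩, fun H τ' hp hn => ?_, fun H τ' hp hn => ?_⟩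
  · exact (hA τ' (hsub τ' hp)).1 (H _ (hp.map _))
  · obtain ⟨σ, hσ, rfl⟩ := List.prefix_map_iff.1 hp
    exact (hA σ (hsub σ hσ)).2 (H _ hσ)
  · refine (hA τ' (hsub τ' hp)).1 (H _ (hp.map _) fun e => hn ?_)
    exact hp.eq_of_length (by simpa [RecTrace.ren] using congrArg List.length e)
  · obtain ⟨σ, hσ, rfl⟩ := List.prefix_map_iff.1 hp
    exact (hA σ (hsub σ hσ)).2 (H _ hσ fun e => hn (by rw [e]; rfl))

theorem RenRel.setR {h k : S.TVar} {u' u : State S} (hr : RenRel h k u' u) (x : S.RVar)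
    (d : ℝ) : RenRel h k (u'.setR x d) (u.setR x d) where
  r := by simp only [State.setR, hr.r]
  n := hr.n
  t_self := hr.t_self
  t_ne := hr.t_ne

theorem RenRel.setN {h k : S.TVar} {u' u : State S} (hr : RenRel h k u' u) (i : S.NVar)
    (d : ℕ) : RenRel h k (u'.setN i d) (u.setN i d) where
  r := hr.r
  n := by simp only [State.setN, hr.n]
  t_self := hr.t_self
  t_ne := hr.t_ne

theorem RenRel.setT {h k g : S.TVar} {u' u : State S} (hr : RenRel h k u' u) (hh : g ≠ h)
    (hk : g ≠ k) (d : Trace S) : RenRel h k (u'.setT g d) (u.setT g d) where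
  r := hr.r
  n := hr.n
  t_self := by rw [State.setT_ne _ _ hh.symm, State.setT_ne _ _ hk.symm, hr.t_self]
  t_ne f h1 h2 := by
    by_cases e : f = g
    · subst e; simp
    · rw [State.setT_ne _ _ e, State.setT_ne _ _ e, hr.t_ne f h1 h2]

/-- This serves quantifiers over `h`, below which nothing is renamed: the differing values of `h`
are overwritten, and `k` does not occur in `a`. -/
theorem RenRel.sat_setT {h k : S.TVar} {u' u : State S} (hr : RenRel h k u' u) {a : Fml S}
    (hwf : a.WF) (hk : Var.t k ∉ a.vars) (d : Trace S) :
    a.Sat (u'.setT h d) ↔ a.Sat (u.setT h d) := by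
  refine Fml.sat_congr hwf (fun x _ => by simp [hr.r]) (fun i _ => by simp [hr.n]) fun g hg => ?_
  by_cases e : g = h
  · subst e; simp
  · rw [State.setT_ne _ _ e, State.setT_ne _ _ e]
    exact (hr.t_ne g e fun e' => hk (a.FV_subset_vars (e' ▸ hg))).symm

/-- The renaming lemma for formulas. -/
theorem Fml.sat_ren {φ : Fml S} {h k : S.TVar} (hwf : φ.WF) (hne : h ≠ k)
    (hk : Var.t k ∉ φ.vars) {u' u : State S} (hr : RenRel h k u' u) :
    (φ.ren h k).Sat u' ↔ φ.Sat u := by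
  induction φ generalizing u' u with
  | eqR a b =>
    simp only [Fml.ren, Fml.Sat, RTerm.eval_ren hr fun h => hk (.inl h),
      RTerm.eval_ren hr fun h => hk (.inr h)]
  | eqI a b =>
    simp only [Fml.ren, Fml.Sat, ITerm.eval_ren hr fun h => hk (.inl h),
      ITerm.eval_ren hr fun h => hk (.inr h)]
  | eqC a b =>
    simp only [Fml.ren, Fml.Sat, CTerm.eval_ren hr fun h => hk (.inl h),
      CTerm.eval_ren hr fun h => hk (.inr h)]
  | eqT a b =>
    simp only [Fml.ren, Fml.Sat, TTerm.eval_ren hr fun h => hk (.inl h),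
      TTerm.eval_ren hr fun h => hk (.inr h)]
  | geR a b =>
    simp only [Fml.ren, Fml.Sat, RTerm.eval_ren hr fun h => hk (.inl h),
      RTerm.eval_ren hr fun h => hk (.inr h)]
  | geI a b =>
    simp only [Fml.ren, Fml.Sat, ITerm.eval_ren hr fun h => hk (.inl h),
      ITerm.eval_ren hr fun h => hk (.inr h)]
  | leT a b =>
    simp only [Fml.ren, Fml.Sat, TTerm.eval_ren hr fun h => hk (.inl h),
      TTerm.eval_ren hr fun h => hk (.inr h)]
  | not a ih => exact not_congr (ih hwf hk hr)
  | and a b iha ihb =>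
    exact and_congr (iha hwf.1 (fun h => hk (.inl h)) hr)
      (ihb hwf.2 (fun h => hk (.inr h)) hr)
  | or a b iha ihb =>
    exact or_congr (iha hwf.1 (fun h => hk (.inl h)) hr)
      (ihb hwf.2 (fun h => hk (.inr h)) hr)
  | imp a b iha ihb =>
    exact imp_congr (iha hwf.1 (fun h => hk (.inl h)) hr)
      (ihb hwf.2 (fun h => hk (.inr h)) hr)
  | all z a ih =>
    by_cases hz : z = .t h
    · subst hz
      simp only [Fml.ren, if_true]
      exact forall_congr' fun d => hr.sat_setT (a := a) hwf (fun h => hk (.inr h)) d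
    · simp only [Fml.ren, hz, if_false]
      cases z with
      | r x => exact forall_congr' fun d => ih hwf (fun h => hk (.inr h)) (hr.setR x d)
      | n i => exact forall_congr' fun d => ih hwf (fun h => hk (.inr h)) (hr.setN i d)
      | t g =>
        exact forall_congr' fun d => ih hwf (fun h => hk (.inr h))
          (hr.setT (fun e => hz (by rw [e])) (fun e => hk (.inl (by rw [e]; rfl))) d)
  | ex z a ih =>
    by_cases hz : z = .t h
    · subst hz
      simp only [Fml.ren, if_true]
      exact exists_congr fun d => hr.sat_setT (a := a) hwf (fun h => hk (.inr h)) d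
    · simp only [Fml.ren, hz, if_false]
      cases z with
      | r x => exact exists_congr fun d => ih hwf (fun h => hk (.inr h)) (hr.setR x d)
      | n i => exact exists_congr fun d => ih hwf (fun h => hk (.inr h)) (hr.setN i d)
      | t g =>
        exact exists_congr fun d => ih hwf (fun h => hk (.inr h))
          (hr.setT (fun e => hz (by rw [e])) (fun e => hk (.inl (by rw [e]; rfl))) d)
  | box α a ih =>
    have hB : Var.t k ∉ α.BV := fun h => hk (.inl (.inr h))
    constructor
    · intro H τ w hw
      obtain ⟨hτ, o', h1, h2⟩ := hr.sem_left hwf.1 hB hw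
      cases h2 with
      | some h2 => exact (ih hwf.2 (fun h => hk (.inr h)) (h2.app hτ)).1 (H _ _ h1)
    · intro H τ' w' hw
      obtain ⟨τ, o, h1, rfl, hτ, h2⟩ := hr.sem_right hwf.1 hne hB hw
      cases h2 with
      | some h2 => exact (ih hwf.2 (fun h => hk (.inr h)) (h2.app hτ)).2 (H _ _ h1)
  | acbox α A C a ihA ihC iha =>
    obtain ⟨wα, wA, wC, wa, -⟩ := hwf
    have hB : Var.t k ∉ α.BV := fun h => hk (.inl (.inl (.inl (.inr h))))
    have hA := fun (τ : RecTrace S) (hτ : ∀ e ∈ τ, e.1 ≠ k) =>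
      ihA wA (fun h => hk (.inl (.inl (.inr h)))) (hr.app hτ)
    have hC := fun (τ : RecTrace S) (hτ : ∀ e ∈ τ, e.1 ≠ k) =>
      ihC wC (fun h => hk (.inl (.inr h))) (hr.app hτ)
    constructor
    · intro H τ o ho
      obtain ⟨hτ, o', h1, h2⟩ := hr.sem_left wα hB ho
      obtain ⟨p1, p2⟩ := RenRel.forall_prefix hA hτ
      refine ⟨fun hp => (hC τ hτ).1 ((H _ _ h1).1 (p2.2 hp)), ?_⟩
      rintro w rfl hp
      cases h2 with
      | some h2 =>
        exact (iha wa (fun h => hk (.inr h)) (h2.app hτ)).1 ((H _ _ h1).2 _ rfl (p1.2 hp))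
    · intro H τ' o' ho
      obtain ⟨τ, o, h1, rfl, hτ, h2⟩ := hr.sem_right wα hne hB ho
      obtain ⟨p1, p2⟩ := RenRel.forall_prefix hA hτ
      refine ⟨fun hp => (hC τ hτ).2 ((H _ _ h1).1 (p2.1 hp)), ?_⟩
      rintro w' rfl hp
      cases h2 with
      | some h2 =>
        exact (iha wa (fun h => hk (.inr h)) (h2.app hτ)).2 ((H _ _ h1).2 _ rfl (p1.1 hp))

/-! ### Uniqueness of the solutions of differential equations -/

theorem Poly.contDiff_eval {E : Type*} [NormedAddCommGroup E] [NormedSpace ℝ E] (p : Poly S)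
    {g : E → S.RVar → ℝ} (hg : ∀ x, ContDiff ℝ 1 fun y => g y x) :
    ContDiff ℝ 1 fun y => p.eval (g y) := by
  induction p with
  | var x => exact hg x
  | const q => exact contDiff_const
  | add p q ihp ihq => exact ihp.add ihq
  | mul p q ihp ihq => exact ihp.mul ihq

-- The polynomial vector field is C¹, hence Lipschitz on the compact set swept out by the two
-- curves, and the Lipschitz uniqueness theorem applies. To work in a normed space, the states are
-- cut down to the finitely many variables on the left-hand sides; since `mu` is among them, all
-- others are constant. The domain constraints play no role.
open Classical in
theorem SolvesODE.unique {l : List (S.RVar × Poly S)} {χ χ' : FolRA S} {d : ℝ}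
    {φ ψ : ℝ → State S} (hφ : SolvesODE l χ d φ) (hψ : SolvesODE l χ' d ψ)
    (hmu : Var.r S.mu ∈ lhs l) (h0 : φ 0 = ψ 0) : ∀ s ∈ Set.Icc (0 : ℝ) d, φ s = ψ s := by
  let I : Finset S.RVar := (l.map Prod.fst).toFinset
  have hI : ∀ x, x ∈ I ↔ Var.r x ∈ lhs l := by
    intro x
    simp only [I, List.mem_toFinset, List.mem_map, lhs]
    exact ⟨fun ⟨p, hp, e⟩ => ⟨p, hp, by rw [e]⟩, fun ⟨p, hp, e⟩ => ⟨p, hp, (Var.r.inj e).symm⟩⟩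
  have hoff : lhs l ∪ {Var.r S.mu} = lhs l :=
    Set.union_eq_self_of_subset_right (Set.singleton_subset_iff.2 hmu)
  -- Variables that do not evolve enter the right-hand sides with their initial values.
  let ext : (I → ℝ) → S.RVar → ℝ := fun y x => if h : x ∈ I then y ⟨x, h⟩ else (φ 0).r x
  let F : (I → ℝ) → I → ℝ := fun y i => (listSub l i.1).eval (ext y)
  have hF : ContDiff ℝ 1 F := by
    refine contDiff_pi.2 fun i => Poly.contDiff_eval _ fun x => ?_
    by_cases h : x ∈ I
    · simp only [ext, h, dif_pos]; exact contDiff_apply ℝ ℝ _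
    · simp only [ext, h, dif_neg, not_false_iff]; exact contDiff_const
  have key : ∀ {θ : ℝ → State S} {χ : FolRA S}, SolvesODE l χ d θ → θ 0 = φ 0 →
      ∀ s ∈ Set.Icc (0 : ℝ) d,
        HasDerivWithinAt (fun s (i : I) => (θ s).r i.1) (F fun i => (θ s).r i.1)
          (Set.Icc 0 d) s := by
    intro θ χ hθ hθ0 s hs
    have hext : ext (fun i => (θ s).r i.1) = (θ s).r := by
      funext x
      by_cases h : x ∈ I
      · simp [ext, h]
      · simp only [ext, h, dif_neg, not_false_iff]
        rw [(hθ s hs).2.2.2.1 x (by rw [hoff]; exact fun h' => h ((hI x).2 h')), hθ0]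
    refine hasDerivWithinAt_pi.2 fun i => ?_
    have := (hθ s hs).2.1 _ (listSub_mem ((hI i.1).1 i.2))
    simpa only [F, hext] using this
  have kφ := key hφ rfl
  have kψ := key hψ h0.symm
  have cφ : ContinuousOn (fun s (i : I) => (φ s).r i.1) (Set.Icc 0 d) :=
    fun s hs => (kφ s hs).continuousWithinAt
  have cψ : ContinuousOn (fun s (i : I) => (ψ s).r i.1) (Set.Icc 0 d) :=
    fun s hs => (kψ s hs).continuousWithinAt
  let T : Set (I → ℝ) := (fun s (i : I) => (φ s).r i.1) '' Set.Icc 0 d ∪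
    (fun s (i : I) => (ψ s).r i.1) '' Set.Icc 0 d
  have hT : IsCompact T := (isCompact_Icc.image_of_continuousOn cφ).union
    (isCompact_Icc.image_of_continuousOn cψ)
  obtain ⟨K, hK⟩ := hF.locallyLipschitz.locallyLipschitzOn (s := T)
    |>.exists_lipschitzOnWith_of_compact hT
  -- The uniqueness theorem asks for derivatives from the right; before the end of the interval
  -- these follow from derivatives within it.
  have right : ∀ {f : ℝ → I → ℝ} {f' : I → ℝ} {s : ℝ}, s ∈ Set.Ico 0 d →
      HasDerivWithinAt f f' (Set.Icc 0 d) s → HasDerivWithinAt f f' (Set.Ici s) s := by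
    intro f f' s hs h
    refine h.mono_of_mem_nhdsWithin ?_
    exact Filter.mem_of_superset (Icc_mem_nhdsGE hs.2) (Set.Icc_subset_Icc_left hs.1)
  have sub : Set.Ico (0 : ℝ) d ⊆ Set.Icc 0 d := Set.Ico_subset_Icc_self
  have main := ODE_solution_unique_of_mem_Icc_right (v := fun _ => F) (s := fun _ => T)
    (fun _ _ => hK) cφ (fun s hs => right hs (kφ s (sub hs)))
    (fun s hs => .inl ⟨s, sub hs, rfl⟩) cψ (fun s hs => right hs (kψ s (sub hs)))
    (fun s hs => .inr ⟨s, sub hs, rfl⟩) (by simp only [h0])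
  intro s hs
  ext1
  · funext x
    by_cases hx : x ∈ I
    · exact congrFun (main hs) ⟨x, hx⟩
    · have hx' : Var.r x ∉ lhs l ∪ {Var.r S.mu} := by
        rw [hoff]; exact fun h' => hx ((hI x).2 h')
      rw [(hφ s hs).2.2.2.1 x hx', (hψ s hs).2.2.2.1 x hx', h0]
  · rw [(hφ s hs).2.2.2.2.1, (hψ s hs).2.2.2.2.1, h0]
  · rw [(hφ s hs).2.2.2.2.2, (hψ s hs).2.2.2.2.2, h0]

theorem lhs_zip {l : List (S.RVar × Poly S)} {ys : List (Poly S)}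
    (hlen : ys.length = l.length) : lhs ((l.map Prod.fst).zip ys) = lhs l := by
  have : ((l.map Prod.fst).zip ys).map Prod.fst = l.map Prod.fst :=
    List.map_fst_zip (by simp [hlen])
  have key : ∀ m : List (S.RVar × Poly S), lhs m = {z | ∃ x ∈ m.map Prod.fst, z = Var.r x} := by
    intro m; ext z; simp [lhs]
  rw [key, this, key]

open Classical in
/-- The states reached by assigning a symbolic solution follow the differential equations. -/
theorem IsSolution.exists_solvesODE {l : List (S.RVar × Poly S)} {ys : List (Poly S)}
    {t : S.RVar} (hlen : ys.length = l.length) (hmu : Var.r S.mu ∈ lhs l)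
    (ht : Var.r t ∉ lhs l ∪ rhsFV l) (hsol : IsSolution l ys t)
    (hwf : ∀ p, (S.mu, p) ∈ l → p = .const 1) (v : State S) (d : ℝ) :
    ∃ φ : ℝ → State S, SolvesODE l .tt d φ ∧ φ 0 = v ∧
      ∀ s x, x ≠ t → (φ s).r x = ((v.setR t s).assign ((l.map Prod.fst).zip ys)).r x := by
  set m := (l.map Prod.fst).zip ys with hm
  have hlm : lhs m = lhs l := lhs_zip hlen
  have htl : Var.r t ∉ lhs l := fun h => ht (.inl h)
  -- The symbolic solution is evaluated with `t` set to `s`, but evolution keeps `t` constant; so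
  -- `t` is reset to its value in `v`.
  let φ : ℝ → State S := fun s =>
    { v with r := fun x => if x = t then v.r t else ((v.setR t s).assign m).r x }
  have hφ : ∀ s x, x ≠ t → (φ s).r x = ((v.setR t s).assign m).r x :=
    fun s x hx => by simp [φ, hx]
  have hset : ∀ s, (v.setR t s).r = Function.update v.r t s := fun s => rfl
  have hoff : ∀ s x, Var.r x ∉ lhs l → (φ s).r x = v.r x := by
    intro s x hx
    by_cases hxt : x = t
    · simp [φ, hxt]
    · rw [hφ s x hxt, State.assign_r, listSub_of_not_mem (by rwa [hlm])]
      exact State.setR_ne _ _ hxt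
  have hne : ∀ x, Var.r x ∈ lhs l → x ≠ t := fun x hx e => htl (e ▸ hx)
  have hder : ∀ s, 0 ≤ s → ∀ p ∈ l,
      HasDerivAt (fun s' => (φ s').r p.1) (p.2.eval (φ s).r) s := by
    intro s hs p hp
    have hpl : Var.r p.1 ∈ lhs l := ⟨p, hp, rfl⟩
    have h1 := (hsol v.r p hp).2 s hs
    have h2 : (fun s' => (φ s').r p.1) =
        fun s' => (listSub m p.1).eval (Function.update v.r t s') :=
      funext fun s' => hφ s' p.1 (hne _ hpl)
    rw [h2]
    convert! h1 using 1
    refine Poly.eval_congr fun x hx => ?_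
    -- No right-hand side mentions `t`, so resetting it is invisible here.
    exact hφ s x fun e => ht (.inr ⟨p, hp, e ▸ hx⟩)
  refine ⟨φ, fun s hs => ⟨?_, ?_, FolRA.sat_tt _, ?_, rfl, rfl⟩, ?_, hφ⟩
  -- By well-formedness the right-hand side given for the time is `1`, which is the time condition
  -- in `SolvesODE`.
  · obtain ⟨p, hp, e⟩ := hmu
    have := hder s hs.1 p hp
    have e1 : p = (S.mu, p.2) := by rw [Var.r.inj e]
    rw [hwf p.2 (e1 ▸ hp), ← Var.r.inj e] at this
    simpa [Poly.eval] using this.hasDerivWithinAt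
  · exact fun p hp => (hder s hs.1 p hp).hasDerivWithinAt
  · intro x hx
    rw [hoff s x fun h => hx (.inl h), hoff 0 x fun h => hx (.inl h)]
  · ext1
    · funext x
      by_cases hx : Var.r x ∈ lhs l
      · obtain ⟨p, hp, e⟩ := hx
        rw [hφ 0 x (hne x ⟨p, hp, e⟩), Var.r.inj e]
        exact (hsol v.r p hp).1
      · exact hoff 0 x hx
    · rfl
    · rfl

/-! ### Soundness of the axioms and rules -/

theorem Fml.valid_iff_iff {a b : Fml S} : (Fml.iff a b).Valid ↔ ∀ v, a.Sat v ↔ b.Sat v :=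
  forall_congr' fun _ => iff_iff_implies_and_implies.symm

/-- A formula that does not refer to what a program changes, traces excepted. -/
theorem Fml.sat_frame {φ : Fml S} (hwf : φ.WF) {B : Set (Var S)} (hB : φ.FV ∩ B ⊆ TV S)
    {v w : State S} (h : Frame B v w) (τ : RecTrace S) :
    φ.Sat (v.app τ) ↔ φ.Sat (w.app τ) := by
  refine Fml.sat_congr hwf (fun x hx => h.r x fun hxB => ?_) (fun i _ => by simp [h.n])
    (fun g _ => by simp [h.t])
  obtain ⟨g, e⟩ := hB ⟨hx, hxB⟩
  cases e

/-- An instance of the substitution lemma: the real values after the assignment are by definition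
those of the substituted terms. -/
theorem sound_assign (l : List (S.RVar × Poly S)) (ψ : Fml S) (ha : ψ.Adm (listSub l))
    (hwf : ψ.WF) (v : State S) :
    (Fml.box (.assign l) ψ).Sat v ↔ (ψ.subst (listSub l)).Sat v := by
  rw [Fml.sat_subst (u := v.assign l) hwf ha subset_rfl
    ⟨fun x _ => rfl, fun i _ => rfl, fun h _ => rfl⟩]
  constructor
  · intro H
    simpa using H [] _ (mem_sem_assign.2 ⟨rfl, .inr rfl⟩)
  · intro H τ w hw
    obtain ⟨rfl, h | h⟩ := mem_sem_assign.1 hw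
    · cases h
    · cases h; simpa using H

theorem sat_box_nondet (x : S.RVar) (ψ : Fml S) (v : State S) :
    (Fml.box (.nondet x) ψ).Sat v ↔ ∀ d, ψ.Sat (v.setR x d) := by
  constructor
  · intro H d
    simpa using H [] _ (mem_sem_nondet.2 ⟨rfl, .inr ⟨d, rfl⟩⟩)
  · intro H τ w hw
    obtain ⟨rfl, h | ⟨d, h⟩⟩ := mem_sem_nondet.1 hw
    · cases h
    · cases h; simpa using H d

theorem sound_test (χ : FolRA S) (ψ : Fml S) (v : State S) :
    (Fml.box (.test χ) ψ).Sat v ↔ (Fml.imp χ.toFml ψ).Sat v := by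
  change _ ↔ (χ.toFml.Sat v → ψ.Sat v)
  rw [FolRA.sat_toFml]
  constructor
  · intro H hχ
    simpa using H [] _ (mem_sem_test.2 ⟨rfl, .inr ⟨rfl, hχ⟩⟩)
  · intro H τ w hw
    obtain ⟨rfl, h | ⟨h, hχ⟩⟩ := mem_sem_test.1 hw
    · cases h
    · cases h; simpa using H hχ

theorem sound_boxesDual (α : Prog S) (ψ : Fml S) (v : State S) :
    (Fml.box α ψ).Sat v ↔ (Fml.acbox α .tt .tt ψ).Sat v := by
  constructor
  · intro H τ o ho
    exact ⟨fun _ => Fml.sat_tt _, fun w e _ => H τ w (e ▸ ho)⟩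
  · intro H τ w hw
    exact (H τ _ hw).2 w rfl fun _ _ => Fml.sat_tt _

theorem sound_acChoice (α β : Prog S) (A C ψ : Fml S) (v : State S) :
    (Fml.acbox (.choice α β) A C ψ).Sat v ↔
      (Fml.acbox α A C ψ).Sat v ∧ (Fml.acbox β A C ψ).Sat v := by
  constructor
  · exact fun H => ⟨fun τ o ho => H τ o (.inl ho), fun τ o ho => H τ o (.inr ho)⟩
  · rintro ⟨H1, H2⟩ τ o (ho | ho)
    · exact H1 τ o ho
    · exact H2 τ o ho

/-! ### Sequential composition and iteration -/

/-- Satisfaction of an ac-box in a later state `u.app τ`, in terms of runs from `u` and of formulas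
evaluated in the initial state. -/
theorem sat_acbox_app {α β : Prog S} {A C ψ : Fml S} (hα : α.WF) (hA : A.WF) (hC : C.WF)
    (hAC : (A.FV ∪ C.FV) ∩ β.BV ⊆ TV S) {v u : State S} {τ : RecTrace S} (hu : Frame β.BV v u) :
    (Fml.acbox α A C ψ).Sat (u.app τ) ↔ ∀ τ' o, (u, τ', o) ∈ α.sem →
      ((∀ σ, σ <+: τ' → σ ≠ τ' → A.Sat (v.app (τ ++ σ))) → C.Sat (v.app (τ ++ τ'))) ∧
      (∀ w, o = some w → (∀ σ, σ <+: τ' → A.Sat (v.app (τ ++ σ))) → ψ.Sat (w.app (τ ++ τ'))) := by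
  have eA : ∀ σ, A.Sat ((u.app τ).app σ) ↔ A.Sat (v.app (τ ++ σ)) := fun σ => by
    rw [State.app_app]
    exact (Fml.sat_frame hA (fun z hz => hAC ⟨.inl hz.1, hz.2⟩) hu _).symm
  have eC : ∀ σ, C.Sat ((u.app τ).app σ) ↔ C.Sat (v.app (τ ++ σ)) := fun σ => by
    rw [State.app_app]
    exact (Fml.sat_frame hC (fun z hz => hAC ⟨.inr hz.1, hz.2⟩) hu _).symm
  simp only [Fml.Sat, eA, eC, Prog.mem_sem_app hα]
  constructor
  · intro H τ' o ho
    refine ⟨(H τ' _ ⟨o, ho, rfl⟩).1, ?_⟩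
    rintro w rfl hp
    have := (H τ' _ ⟨_, ho, rfl⟩).2 _ rfl hp
    rwa [State.app_app] at this
  · rintro H τ' _ ⟨o, ho, rfl⟩
    refine ⟨(H τ' _ ho).1, ?_⟩
    intro w hw hp
    obtain ⟨w, rfl, rfl⟩ := Option.map_eq_some_iff.1 hw
    rw [State.app_app]
    exact (H τ' _ ho).2 _ rfl hp

/-- Seen from `v`, the inner box speaks about the prefixes of `τ ++ τ'` that extend `τ`. The shorter
ones are covered by the assumption under which the outer box asserts its postcondition. -/
theorem sound_acComposition (α β : Prog S) (A C ψ : Fml S) (hβ : β.WF) (hA : A.WF) (hC : C.WF)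
    (hAC : (A.FV ∪ C.FV) ∩ α.BV ⊆ TV S) (v : State S) :
    (Fml.acbox (.seq α β) A C ψ).Sat v ↔ (Fml.acbox α A C (.acbox β A C ψ)).Sat v := by
  constructor
  · intro H τ o ho
    refine ⟨(H τ none (mem_sem_seq.2 (.inl ⟨rfl, _, ho⟩))).1, ?_⟩
    rintro u rfl hτ
    rw [sat_acbox_app hβ hA hC hAC (Prog.frame ho)]
    intro τ' o' ho'
    obtain ⟨h1, h2⟩ := H _ _ (mem_sem_seq.2 (.inr ⟨τ, τ', u, ho, ho', rfl⟩))
    constructor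
    · intro hp
      refine h1 fun σ hσ hne => ?_
      obtain hσ | ⟨σ, hσ', rfl⟩ := prefix_append_iff.1 hσ
      · exact hτ σ hσ
      · exact hp σ hσ' fun e => hne (by rw [e])
    · intro w hw hp
      refine h2 w hw fun σ hσ => ?_
      obtain hσ | ⟨σ, hσ', rfl⟩ := prefix_append_iff.1 hσ
      · exact hτ σ hσ
      · exact hp σ hσ'
  · intro H τ o ho
    obtain ⟨rfl, w, hw⟩ | ⟨τ₁, τ₂, u, h1, h2, rfl⟩ := mem_sem_seq.1 ho
    · exact ⟨(H τ w hw).1, fun w h => by cases h⟩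
    · have hpre : ∀ {σ}, σ <+: τ₁ → σ <+: τ₁ ++ τ₂ := fun h => h.trans (List.prefix_append _ _)
      have key : (∀ σ, σ <+: τ₁ → A.Sat (v.app σ)) → _ := fun hp =>
        (sat_acbox_app hβ hA hC hAC (Prog.frame h1)).1 ((H _ _ h1).2 u rfl hp) τ₂ o h2
      constructor
      · intro hp
        -- For empty `τ₂`, nothing is assumed at `τ₁` itself, so the inner box is unavailable and
        -- the commitment comes from `α`. Otherwise all prefixes of `τ₁`, including `τ₁`, are proper
        -- prefixes of `τ₁ ++ τ₂`.
        by_cases hnil : τ₂ = []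
        · subst hnil
          rw [List.append_nil] at hp ⊢
          exact (H _ _ h1).1 hp
        · refine (key fun σ hσ => hp σ (hpre hσ) ?_).1 fun σ hσ hne =>
            hp _ ((List.prefix_append_right_inj _).2 hσ) fun e => hne (List.append_cancel_left e)
          rintro rfl
          have := hσ.length_le
          have := List.length_pos_iff.2 hnil
          simp only [List.length_append] at *
          omega
      · intro w hw hp
        exact (key fun σ hσ => hp σ (hpre hσ)).2 w hw fun σ hσ =>
          hp _ ((List.prefix_append_right_inj _).2 hσ)

theorem mem_sem_progZero {v : State S} {τ : RecTrace S} {o : Option (State S)} :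
    (v, τ, o) ∈ (progZero : Prog S).sem ↔ τ = [] ∧ (o = none ∨ o = some v) := by
  simp [progZero, mem_sem_test]

theorem mem_sem_star_iff {α : Prog S} {v : State S} {τ : RecTrace S} {o : Option (State S)} :
    (v, τ, o) ∈ (Prog.star α).sem ↔
      (v, τ, o) ∈ (Prog.choice progZero (.seq α (.star α))).sem := by
  rw [mem_sem_choice, mem_sem_progZero, mem_sem_seq, mem_sem_star]
  constructor
  · rintro ⟨k, hk⟩
    cases k with
    | zero => exact .inl (mem_iterOp_zero.1 hk)
    | succ k =>
      refine .inr ((mem_seqOp.1 hk).imp_right ?_)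
      rintro ⟨τ₁, τ₂, u, h1, h2, rfl⟩
      exact ⟨τ₁, τ₂, u, h1, mem_sem_star.2 ⟨k, h2⟩, rfl⟩
  · rintro (h | ⟨rfl, w, hw⟩ | ⟨τ₁, τ₂, u, h1, h2, rfl⟩)
    · exact ⟨0, mem_iterOp_zero.2 h⟩
    · exact ⟨1, mem_seqOp.2 (.inl ⟨rfl, w, hw⟩)⟩
    · obtain ⟨k, hk⟩ := mem_sem_star.1 h2
      exact ⟨k + 1, mem_seqOp.2 (.inr ⟨τ₁, τ₂, u, h1, hk, rfl⟩)⟩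

/-- The loop has the same runs as `progZero` or one iteration followed by the loop, so this is
acChoice combined with acComposition. -/
theorem sound_acIteration (α : Prog S) (A C ψ : Fml S) (hα : α.WF) (hA : A.WF) (hC : C.WF)
    (hAC : (A.FV ∪ C.FV) ∩ α.BV ⊆ TV S) (v : State S) :
    (Fml.acbox (.star α) A C ψ).Sat v ↔
      (Fml.acbox progZero A C ψ).Sat v ∧ (Fml.acbox α A C (.acbox (.star α) A C ψ)).Sat v := by
  rw [← sound_acComposition α (.star α) A C ψ hα hA hC hAC, ← sound_acChoice]
  simp only [Fml.Sat, mem_sem_star_iff]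

/-- One more iteration at the end. -/
theorem mem_sem_star_append {α : Prog S} {v u : State S} {τ τ' : RecTrace S}
    {o : Option (State S)} (h : (v, τ, some u) ∈ (Prog.star α).sem) (h' : (u, τ', o) ∈ α.sem) :
    (v, τ ++ τ', o) ∈ (Prog.star α).sem := by
  obtain ⟨k, hk⟩ := mem_sem_star.1 h
  refine mem_sem_star.2 ⟨k + 1, ?_⟩
  clear h
  induction k generalizing v τ with
  | zero =>
    obtain ⟨rfl, h | h⟩ := mem_iterOp_zero.1 hk
    · cases h
    · cases h
      -- Iteration unrolls at the front. An unfinished last run is already contained in the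
      -- interrupted part of `seqOp`, whereas a finished one needs an empty iteration behind it.
      cases o with
      | none => exact mem_seqOp.2 (.inl ⟨rfl, _, h'⟩)
      | some w =>
        exact mem_seqOp.2 (.inr ⟨τ', [], w, h', mem_iterOp_zero.2 ⟨rfl, .inr rfl⟩, by simp⟩)
  | succ k ih =>
    obtain ⟨h, -⟩ | ⟨τ₁, τ₂, z, h1, h2, rfl⟩ := mem_seqOp.1 hk
    · cases h
    · exact mem_seqOp.2 (.inr ⟨τ₁, τ₂ ++ τ', z, h1, ih h2, List.append_assoc _ _ _⟩)

theorem sat_acbox_progZero {A C ψ : Fml S} {v : State S} :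
    (Fml.acbox progZero A C ψ).Sat v ↔ C.Sat v ∧ (A.Sat v → ψ.Sat v) := by
  simp only [Fml.Sat, mem_sem_progZero]
  constructor
  · intro H
    obtain ⟨h1, h2⟩ := H [] (some v) ⟨rfl, .inr rfl⟩
    refine ⟨by simpa using h1, fun hA => ?_⟩
    simpa [hA] using h2
  · rintro ⟨h1, h2⟩ τ o ⟨rfl, ho⟩
    refine ⟨fun _ => by simpa using h1, ?_⟩
    rintro w rfl hp
    obtain ho | ho := ho
    · cases ho
    · cases ho
      simpa using h2 (by simpa using hp [] List.prefix_rfl)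

/-- Forwards, a finished run of the loop followed by a run of `α` is again a run of the loop.
Backwards, `key` is an induction on the remaining iterations, started after any finished run `(v,
τ₀, u)` of the loop along which `A` holds and after which `C` and `ψ` hold. There the second
conjunct supplies the ac-box for the next iteration, which re-establishes these conditions at `τ₀ ++
τ₁`. The condition on `C` is needed when no further event occurs. -/
theorem sound_acInduction (α : Prog S) (A C ψ : Fml S) (hα : α.WF) (hA : A.WF) (hC : C.WF)
    (hAC : (A.FV ∪ C.FV) ∩ α.BV ⊆ TV S) (v : State S) :
    (Fml.acbox (.star α) A C ψ).Sat v ↔ (Fml.acbox progZero A C ψ).Sat v ∧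
      (Fml.acbox (.star α) A .tt (.imp ψ (.acbox α A C ψ))).Sat v := by
  constructor
  · intro H
    refine ⟨((sound_acIteration α A C ψ hα hA hC hAC v).1 H).1, fun τ o ho =>
      ⟨fun _ => Fml.sat_tt _, ?_⟩⟩
    rintro u rfl hτ -
    have hf : Frame (Prog.star α).BV v u := Prog.frame ho
    rw [sat_acbox_app hα hA hC hAC hf]
    intro τ' o' ho'
    obtain ⟨h1, h2⟩ := H _ _ (mem_sem_star_append ho ho')
    constructor
    · intro hp
      refine h1 fun σ hσ hne => ?_
      obtain hσ | ⟨σ, hσ', rfl⟩ := prefix_append_iff.1 hσ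
      · exact hτ σ hσ
      · exact hp σ hσ' fun e => hne (by rw [e])
    · intro w hw hp
      refine h2 w hw fun σ hσ => ?_
      obtain hσ | ⟨σ, hσ', rfl⟩ := prefix_append_iff.1 hσ
      · exact hτ σ hσ
      · exact hp σ hσ'
  · rintro ⟨H0, H⟩
    obtain ⟨hCv, hψ⟩ := sat_acbox_progZero.1 H0
    have key : ∀ k τ₀ u, (v, τ₀, some u) ∈ (Prog.star α).sem →
        (∀ σ, σ <+: τ₀ → A.Sat (v.app σ)) → C.Sat (v.app τ₀) → ψ.Sat (u.app τ₀) →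
        ∀ τ o, (u, τ, o) ∈ iterOp α.sem k →
        ((∀ σ, σ <+: τ → σ ≠ τ → A.Sat (v.app (τ₀ ++ σ))) → C.Sat (v.app (τ₀ ++ τ))) ∧
        (∀ w, o = some w → (∀ σ, σ <+: τ → A.Sat (v.app (τ₀ ++ σ))) →
          ψ.Sat (w.app (τ₀ ++ τ))) := by
      intro k
      induction k with
      | zero =>
        intro τ₀ u hu hA₀ hC₀ hψ₀ τ o ho
        obtain ⟨rfl, ho'⟩ := mem_iterOp_zero.1 ho
        rw [List.append_nil]
        refine ⟨fun _ => hC₀, ?_⟩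
        rintro w rfl -
        obtain ho' | ho' := ho'
        · cases ho'
        · cases ho'; exact hψ₀
      | succ k ih =>
        intro τ₀ u hu hA₀ hC₀ hψ₀ τ o ho
        have hf : Frame (Prog.star α).BV v u := Prog.frame hu
        have step := (sat_acbox_app hα hA hC hAC hf).1
          ((H τ₀ _ hu).2 u rfl hA₀ hψ₀)
        obtain ⟨rfl, w, hw⟩ | ⟨τ₁, τ₂, z, h1, h2, rfl⟩ := mem_seqOp.1 ho
        · exact ⟨(step τ w hw).1, fun w h => by cases h⟩
        · have hpre : ∀ {σ}, σ <+: τ₁ → σ <+: τ₁ ++ τ₂ :=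
            fun h => h.trans (List.prefix_append _ _)
          have hz := mem_sem_star_append hu h1
          have next : (∀ σ, σ <+: τ₁ → A.Sat (v.app (τ₀ ++ σ))) → _ := fun hp =>
            ih (τ₀ ++ τ₁) z hz
              (fun σ hσ => (prefix_append_iff.1 hσ).elim (hA₀ σ) fun ⟨σ', h, e⟩ => e ▸ hp σ' h)
              ((step τ₁ _ h1).1 fun σ hσ _ => hp σ hσ)
              ((step τ₁ _ h1).2 z rfl hp) τ₂ o h2
          constructor
          · intro hp
            by_cases hnil : τ₂ = []
            · subst hnil
              rw [List.append_nil] at hp ⊢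
              exact (step τ₁ _ h1).1 hp
            · rw [← List.append_assoc]
              refine (next fun σ hσ => hp σ (hpre hσ) ?_).1 fun σ hσ hne => ?_
              · rintro rfl
                have := hσ.length_le
                have := List.length_pos_iff.2 hnil
                simp only [List.length_append] at *
                omega
              · rw [List.append_assoc]
                exact hp _ ((List.prefix_append_right_inj _).2 hσ)
                  fun e => hne (List.append_cancel_left e)
          · intro w hw hp
            rw [← List.append_assoc]
            refine (next fun σ hσ => hp σ (hpre hσ)).2 w hw fun σ hσ => ?_
            rw [List.append_assoc]
            exact hp _ ((List.prefix_append_right_inj _).2 hσ)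
    intro τ o ho
    obtain ⟨k, hk⟩ := mem_sem_star.1 ho
    have start : A.Sat v → _ := fun hAv => key k [] v
      (mem_sem_star.2 ⟨0, mem_iterOp_zero.2 ⟨rfl, .inr rfl⟩⟩)
      (fun σ hσ => by rw [List.prefix_nil.1 hσ, State.app_nil]; exact hAv)
      (by simpa using hCv) (by simpa using hψ hAv) τ o hk
    have nil : ∀ {P : RecTrace S → Prop}, (∀ σ, σ <+: τ → P σ) → P [] :=
      fun h => h [] (List.nil_prefix)
    constructor
    · intro hp
      -- With no communication not even `A` in `v` is assumed; the commitment then comes from the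
      -- box over `progZero`.
      by_cases hτ : τ = []
      · subst hτ; simpa using hCv
      · exact (start (by simpa using hp [] List.nil_prefix (Ne.symm hτ))).1 hp
    · intro w hw hp
      exact (start (by simpa using hp [] List.nil_prefix)).2 w hw hp

/-! ### Continuous evolution -/

/-- Every evolution obeys `μ' = 1` anyway, so the added equation only repeats a condition. -/
theorem sound_gtime (l : List (S.RVar × Poly S)) (χ : FolRA S) (ψ : Fml S) (v : State S) :
    (Fml.box (.ode l χ) ψ).Sat v ↔ (Fml.box (.ode ((S.mu, .const 1) :: l) χ) ψ).Sat v := by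
  have hl : lhs ((S.mu, .const 1) :: l) ∪ {Var.r S.mu} = lhs l ∪ {Var.r S.mu} := by
    ext z
    simp [lhs]
  have hs : ∀ d φ, SolvesODE ((S.mu, .const 1) :: l) χ d φ ↔ SolvesODE l χ d φ := by
    intro d φ
    simp only [SolvesODE, hl, List.forall_mem_cons, Poly.eval, Rat.cast_one]
    refine forall₂_congr fun s hs => ?_
    tauto
  simp only [Fml.Sat, mem_sem_ode, hs]

/-- For each duration the symbolic solution is a flow from `v`, and by uniqueness the only one. Its
end state and the state after the assignment can differ at `t` only, which `ψ` does not read. -/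
theorem sound_solution (l : List (S.RVar × Poly S)) (ys : List (Poly S)) (t : S.RVar) (ψ : Fml S)
    (hlen : ys.length = l.length) (hmu : Var.r S.mu ∈ lhs l)
    (ht : Var.r t ∉ lhs l ∪ rhsFV l ∪ ψ.FV) (hsol : IsSolution l ys t)
    (hwf : (Prog.ode l .tt).WF) (hψ : ψ.WF) (v : State S) :
    (Fml.box (.ode l .tt) ψ).Sat v ↔ (Fml.all (.r t) (.imp (.geR (.var t) (.const 0))
      (.box (.assign ((l.map Prod.fst).zip ys)) ψ))).Sat v := by
  have htψ : Var.r t ∉ ψ.FV := fun h => ht (.inr h)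
  have eq : ∀ (φ : ℝ → State S) d, SolvesODE l .tt d φ → 0 ≤ d → φ 0 = v →
      (∀ s x, x ≠ t → (φ s).r x = ((v.setR t s).assign ((l.map Prod.fst).zip ys)).r x) →
      (ψ.Sat ((v.setR t d).assign ((l.map Prod.fst).zip ys)) ↔ ψ.Sat (φ d)) := by
    rintro φ d hφ hd rfl h
    refine Fml.sat_congr hψ (fun x hx => h d x fun e => htψ (e ▸ hx)) (fun i _ => ?_)
      fun g _ => ?_
    · rw [(hφ d ⟨hd, le_rfl⟩).2.2.2.2.1]; rfl
    · rw [(hφ d ⟨hd, le_rfl⟩).2.2.2.2.2]; rfl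
  have flow := fun d => hsol.exists_solvesODE hlen hmu (fun h => ht (.inl h)) hwf.2 v d
  constructor
  · intro H d hd
    have hd : 0 ≤ d := by simpa [Fml.Sat, RTerm.eval] using hd
    intro τ w hw
    obtain ⟨rfl, h | h⟩ := mem_sem_assign.1 hw
    · cases h
    · cases h
      obtain ⟨φ, h1, h2, h3⟩ := flow d
      rw [State.app_nil, eq φ d h1 hd h2 h3, ← State.app_nil (φ d)]
      exact H [] _ (mem_sem_ode.2 ⟨rfl, .inr ⟨d, hd, φ, h1, h2.symm, rfl⟩⟩)
  · intro H τ w hw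
    obtain ⟨rfl, h | ⟨d, hd, φ', h', rfl, h⟩⟩ := mem_sem_ode.1 hw
    · cases h
    · obtain rfl := Option.some.inj h
      obtain ⟨φ, h1, h2, h3⟩ := flow d
      rw [State.app_nil, ← h1.unique h' hmu h2 d ⟨hd, le_rfl⟩, ← eq φ d h1 hd h2 h3,
        ← State.app_nil (State.assign _ _)]
      exact H d (by simpa [Fml.Sat, RTerm.eval] using hd) [] _ (mem_sem_assign.2 ⟨rfl, .inr rfl⟩)

/-! ### Communication -/

theorem sat_box_send {c : S.Chan} {h : S.TVar} {p : Poly S} {ψ : Fml S} {v : State S} :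
    (Fml.box (.send c h p) ψ).Sat v ↔
      ψ.Sat (v.app [(h, ⟨c, p.eval v.r, v.r S.mu⟩)]) := by
  constructor
  · exact fun H => H _ _ (mem_sem_send.2 (.inr ⟨rfl, .inr rfl⟩))
  · intro H τ w hw
    obtain ⟨-, h⟩ | ⟨rfl, h | h⟩ := mem_sem_send.1 hw
    · cases h
    · cases h
    · cases h; exact H

/-- Recording the event in `h` and storing the extended history in `h₀` give states related by
`RenRel`. They disagree on `h`, which retains its old history in the second; the relation permits
this since the renamed formula does not read the outer `h`. -/
theorem sound_send (c : S.Chan) (h h₀ : S.TVar) (p : Poly S) (ψ : Fml S)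
    (hne : h₀ ≠ h) (hfresh : Var.t h₀ ∉ ψ.vars) (hψ : ψ.WF) (v : State S) :
    (Fml.box (.send c h p) ψ).Sat v ↔ (Fml.all (.t h₀) (.imp
      (.eqT (.var h₀) (.cat (.var h) (.item c p (.var S.mu)))) (ψ.ren h h₀))).Sat v := by
  rw [sat_box_send]
  set e : Event S := ⟨c, p.eval v.r, v.r S.mu⟩ with he
  have hrel : RenRel h h₀ (v.setT h₀ (v.t h ++ [e])) (v.app [(h, e)]) :=
    ⟨rfl, rfl, by simp [RecTrace.sub],
      fun g h1 h2 => by simp [State.setT_ne _ _ h2, RecTrace.sub, Ne.symm h1]⟩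
  rw [← Fml.sat_ren hψ hne.symm hfresh hrel]
  have hc : ∀ d, (Fml.eqT (.var h₀) (.cat (.var h) (.item c p (.var S.mu)))).Sat (v.setT h₀ d) ↔
      d = v.t h ++ [e] := by
    intro d
    simp only [Fml.Sat, TTerm.eval, State.setT_self, State.setT_ne v d hne.symm, Poly.eval]
    exact Iff.rfl
  constructor
  · intro H d hd
    rw [(hc d).1 hd]; exact H
  · exact fun H => H _ ((hc _).2 rfl)

theorem forall_prefix_singleton {α : Type*} {e : α} {P : List α → Prop} :
    ((∀ τ, τ <+: [e] → P τ) ↔ P [] ∧ P [e]) ∧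
    ((∀ τ, τ <+: [e] → τ ≠ [e] → P τ) ↔ P []) := by
  simp [List.prefix_cons_iff]

/-- The empty communication gives the commitment before the event. For the full one, `A` before the
event guards the commitment after it, while `A` after the event guards the postcondition only. -/
theorem sat_acbox_send {c : S.Chan} {h : S.TVar} {p : Poly S} {A C ψ : Fml S} {v : State S} :
    (Fml.acbox (.send c h p) A C ψ).Sat v ↔ C.Sat v ∧ (A.Sat v →
      let v' := v.app [(h, ⟨c, p.eval v.r, v.r S.mu⟩)]
      C.Sat v' ∧ (A.Sat v' → ψ.Sat v')) := by
  constructor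
  · intro H
    obtain ⟨h1, h2⟩ := H _ _ (mem_sem_send.2 (.inr ⟨rfl, .inr rfl⟩))
    have h0 := (H [] none (Prog.nil_none_mem_sem _ _)).1
    refine ⟨by simpa using h0, fun hA => ⟨h1 ?_, fun hA' => h2 v rfl ?_⟩⟩
    · exact forall_prefix_singleton.2.2 (by simpa using hA)
    · exact forall_prefix_singleton.1.2 ⟨by simpa using hA, hA'⟩
  · rintro ⟨h0, h1⟩ τ o ho
    obtain ⟨rfl, rfl⟩ | ⟨rfl, ho'⟩ := mem_sem_send.1 ho
    · exact ⟨fun _ => by simpa using h0, fun w h => by cases h⟩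
    · constructor
      · intro hp
        exact (h1 (by simpa using forall_prefix_singleton.2.1 hp)).1
      · rintro w rfl hp
        obtain ho' | ho' := ho'
        · cases ho'
        · cases ho'
          obtain ⟨hA, hA'⟩ := forall_prefix_singleton.1.1 hp
          exact (h1 (by simpa using hA)).2 hA'

theorem sound_acCom (c : S.Chan) (h : S.TVar) (p : Poly S) (A C ψ : Fml S) (v : State S) :
    (Fml.acbox (.send c h p) A C ψ).Sat v ↔
      (Fml.and C (.imp A (.box (.send c h p) (.and C (.imp A ψ))))).Sat v := by
  rw [sat_acbox_send]
  change _ ↔ C.Sat v ∧ (A.Sat v → (Fml.box (.send c h p) (.and C (.imp A ψ))).Sat v)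
  rw [sat_box_send]
  exact Iff.rfl

/-- Guessing the value first and then sending it produces the same events and final states; the
timestamp is unaffected because `x ≠ S.mu`. Assumption and commitment are now read after the guess,
but `x` is not free in them. -/
theorem sound_comDual (c : S.Chan) (h : S.TVar) (x : S.RVar) (A C ψ : Fml S) (hx : x ≠ S.mu)
    (hA : A.WF) (hC : C.WF) (hAC : (A.FV ∪ C.FV) ∩ {.t h, .r x} ⊆ TV S) (v : State S) :
    (Fml.acbox (.recv c h x) A C ψ).Sat v ↔
      (Fml.box (.nondet x) (.acbox (.send c h (.var x)) A C ψ)).Sat v := by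
  have hf : ∀ a, Frame (Prog.recv c h x).BV v (v.setR x a) := fun a =>
    ⟨fun y hy => State.setR_ne _ _ fun e => hy (by simp [Prog.BV, e]), rfl, rfl⟩
  have eA : ∀ a τ, A.Sat (v.app τ) ↔ A.Sat ((v.setR x a).app τ) := fun a τ =>
    Fml.sat_frame hA (fun z hz => hAC ⟨.inl hz.1, hz.2⟩) (hf a) τ
  have eC : ∀ a τ, C.Sat (v.app τ) ↔ C.Sat ((v.setR x a).app τ) := fun a τ =>
    Fml.sat_frame hC (fun z hz => hAC ⟨.inr hz.1, hz.2⟩) (hf a) τ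
  have ev : ∀ a, (Poly.var x).eval (v.setR x a).r = a := fun a => State.setR_self v x a
  have emu : ∀ a, (v.setR x a).r S.mu = v.r S.mu := fun a => State.setR_ne _ _ hx.symm
  rw [sat_box_nondet]
  constructor
  · intro H a τ o ho
    simp only [← eA a, ← eC a]
    refine H τ o (mem_sem_recv.2 ⟨a, ?_⟩)
    rw [mem_sem_send, ev, emu] at ho
    exact ho
  · intro H τ o ho
    obtain ⟨a, ho⟩ := mem_sem_recv.1 ho
    have := H a τ o (by rw [mem_sem_send, ev, emu]; exact ho)
    simpa only [← eA a, ← eC a] using this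

/-! ### Universal closures and the axiom K -/

/-- The quantifiers are instantiated in turn with the values in `u`; repetitions in the list are
harmless. -/
theorem Fml.sat_allList {zs : List (Var S)} {a : Fml S} {v u : State S}
    (h : (Fml.allList zs a).Sat v) (hr : ∀ x, Var.r x ∉ zs → u.r x = v.r x)
    (hn : ∀ i, Var.n i ∉ zs → u.n i = v.n i) (ht : ∀ g, Var.t g ∉ zs → u.t g = v.t g) :
    a.Sat u := by
  induction zs generalizing v with
  | nil =>
    have : u = v := by
      ext1
      · exact funext fun x => hr x (by simp)
      · exact funext fun x => hn x (by simp)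
      · exact funext fun x => ht x (by simp)
    rw [this]; exact h
  | cons z zs ih =>
    cases z with
    | r y =>
      refine ih (h (u.r y)) (fun x hx => ?_) (fun i hi => hn i (by simp [hi]))
        fun g hg => ht g (by simp [hg])
      by_cases e : x = y
      · subst e; simp
      · rw [State.setR_ne _ _ e]; exact hr x (by simp [hx, e])
    | n y =>
      refine ih (h (u.n y)) (fun x hx => hr x (by simp [hx])) (fun i hi => ?_)
        fun g hg => ht g (by simp [hg])
      by_cases e : i = y
      · subst e; simp
      · rw [State.setN_ne _ _ e]; exact hn i (by simp [hi, e])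
    | t y =>
      refine ih (h (u.t y)) (fun x hx => hr x (by simp [hx])) (fun i hi => hn i (by simp [hi]))
        fun g hg => ?_
      by_cases e : g = y
      · subst e; simp
      · rw [State.setT_ne _ _ e]; exact ht g (by simp [hg, e])

open Classical in
/-- A formula whose universal closure holds in some state is valid. -/
theorem Fml.valid_of_sat_allList {zs : List (Var S)} {a : Fml S} {v : State S} (hwf : a.WF)
    (hzs : ∀ z ∈ a.FV, z ∈ zs) (h : (Fml.allList zs a).Sat v) : a.Valid := by
  intro u
  -- The closure at `v` reaches this mixture of `u` and `v`, and coincidence carries the formula on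
  -- to `u`.
  let w : State S :=
    { r := fun x => if Var.r x ∈ zs then u.r x else v.r x
      n := fun x => if Var.n x ∈ zs then u.n x else v.n x
      t := fun x => if Var.t x ∈ zs then u.t x else v.t x }
  have hw : a.Sat w := Fml.sat_allList h (fun x hx => by simp [w, hx]) (fun x hx => by simp [w, hx])
    fun x hx => by simp [w, hx]
  refine (Fml.sat_congr hwf (fun x hx => ?_) (fun x hx => ?_) fun x hx => ?_).2 hw
  all_goals simp [w, hzs _ hx]

/-- The reasoning looks circular: the assumptions follow from the commitments and these from the
assumptions. It is not, because the commitment at a trace needs the assumptions at proper prefixes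
only. An induction on length thus establishes both, each prefix being treated as the communication
of an unfinished run. -/
theorem sound_K (α : Prog S) (A A₁ A₂ C₁ C₂ ψ : Fml S) (v : State S)
    (hK : (compCond A A₁ A₂ C₁ C₂).Valid)
    (H : (Fml.acbox α (.and A₁ A₂) (.and C₁ C₂) ψ).Sat v) :
    (Fml.acbox α A (.and C₁ C₂) ψ).Sat v := by
  have hA : ∀ u, A.Sat u → (Fml.and C₁ C₂).Sat u → (Fml.and A₁ A₂).Sat u :=
    fun u h1 h2 => ⟨(hK u).2 ⟨h1, h2.2⟩, (hK u).1 ⟨h1, h2.1⟩⟩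
  have key : ∀ n, ∀ τ o, τ.length = n → (v, τ, o) ∈ α.sem →
      (∀ σ, σ <+: τ → σ ≠ τ → A.Sat (v.app σ)) →
      (∀ σ, σ <+: τ → σ ≠ τ → (Fml.and A₁ A₂).Sat (v.app σ)) := by
    intro n
    induction n using Nat.strong_induction_on with
    | _ n ih =>
      intro τ o hn ho hp σ hσ hne
      have hlt : σ.length < n :=
        hn ▸ lt_of_le_of_ne hσ.length_le fun e => hne (hσ.eq_of_length e)
      have hσs := Prog.prefix_none_mem_sem ho hσ
      refine hA _ (hp σ hσ hne) ((H σ none hσs).1 ?_)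
      refine ih _ hlt σ none rfl hσs fun ρ hρ hρ' => hp ρ (hρ.trans hσ) ?_
      rintro rfl
      exact hρ' (hρ.eq_of_length (le_antisymm hρ.length_le hσ.length_le))
  intro τ o ho
  have commit := fun hp => (H τ o ho).1 (key _ τ o rfl ho hp)
  refine ⟨commit, fun w hw hp => (H τ o ho).2 w hw fun σ hσ => ?_⟩
  -- The postcondition also needs the assumptions at `τ` itself; there they follow from the
  -- commitment just obtained.
  by_cases e : σ = τ
  · subst e
    exact hA _ (hp _ hσ) (commit fun ρ hρ _ => hp ρ hρ)
  · exact key _ τ o rfl ho (fun ρ hρ _ => hp ρ hρ) σ hσ e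

/-! ### Parallel composition -/

/-- Projected to the channels of `α`, a run of the parallel program is a run of `α`. The dropped
events lie on channels of `β` alone, which by non-interference none of `A`, `C`, `ψ` accesses, so
coincidence up to accessed channels transfers satisfaction. Prefixes of the projected trace lift to
prefixes of `τ`. -/
theorem sound_acDropComp (α β : Prog S) (A C ψ : Fml S) (h : NonInterfering α β A C ψ)
    (hA : A.WF) (hC : C.WF) (hψ : ψ.WF) (v : State S) (H : (Fml.acbox α A C ψ).Sat v) :
    (Fml.acbox (.par α β) A C ψ).Sat v := by
  intro τ o ho
  obtain ⟨w₁, w₂, h1, h2, h3, -, h5, rfl⟩ := mem_sem_par.1 ho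
  have hch : ∀ {D : Set S.Chan} {σ : RecTrace S}, D ∩ β.CN ⊆ α.CN → σ <+: τ →
      ∀ e ∈ σ, e.2.ch ∈ D → e.2.ch ∈ α.CN := by
    intro D σ hD hσ e he heD
    have : e.2.ch ∈ α.CN ∨ e.2.ch ∈ β.CN := by
      simpa using List.filter_eq_self.1 h5.symm e (hσ.subset he)
    exact this.elim id fun hb => hD ⟨heD, hb⟩
  have proj : ∀ {φ : Fml S} {σ : RecTrace S}, φ.WF → φ.CN ∩ β.CN ⊆ α.CN → σ <+: τ →
      (φ.Sat (v.app (RecTrace.proj σ α.CN)) ↔ φ.Sat (v.app σ)) := by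
    intro φ σ hφ hD hσ
    refine Fml.sat_congr_proj hφ (fun _ _ => rfl) (fun _ _ => rfl) fun g _ => ?_
    simp [RecTrace.proj_sub_proj σ g (hch hD hσ)]
  obtain ⟨H1, H2⟩ := H _ _ h1
  constructor
  · intro hp
    refine (proj hC h.chanC List.prefix_rfl).1 (H1 fun σ' hσ' hne => ?_)
    obtain ⟨σ, hσ, rfl⟩ := RecTrace.exists_prefix_proj τ σ' α.CN hσ'
    exact (proj hA h.chanA hσ).2 (hp σ hσ fun e => hne (by rw [e]))
  · intro w hw hp
    obtain ⟨z₁, z₂, rfl, rfl, rfl⟩ := merge_eq_some.1 hw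
    have := H2 z₁ rfl fun σ' hσ' => by
      obtain ⟨σ, hσ, rfl⟩ := RecTrace.exists_prefix_proj τ σ' α.CN hσ'
      exact (proj hA h.chanA hσ).2 (hp σ hσ)
    have f1 := Prog.frame h1
    have f2 := Prog.frame h2
    refine (Fml.sat_congr_proj hψ (fun x hx => ?_) (fun i _ => ?_) fun g _ => ?_).1 this
    · by_cases hxα : Var.r x ∈ α.BV
      · simp [mergeState, hxα]
      · simp only [State.app_r, mergeState, hxα, if_false]
        by_cases hxβ : Var.r x ∈ β.BV
        -- A real variable of `ψ` that only `β` binds is the global time, on which the two final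
        -- states agree.
        · obtain e | ⟨g, e⟩ := h.post ⟨hx, hxβ⟩
          · cases e; exact (h3 _ _ rfl rfl).symm
          · cases e
        · rw [f2.r x hxβ, f1.r x hxα]
    · simp [mergeState, f1.n, f2.n]
    · simp [mergeState, f1.t, f2.t, RecTrace.proj_sub_proj τ g (hch h.chanPost List.prefix_rfl)]

/-! ### Silent programs, weakening and distribution -/

theorem sound_acNoCom (α : Prog S) (A C ψ : Fml S) (h : α.CN = ∅) (v : State S) :
    (Fml.acbox α A C ψ).Sat v ↔ (Fml.and C (.imp A (.box α ψ))).Sat v := by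
  have hnil : ∀ {τ o}, (v, τ, o) ∈ α.sem → τ = [] := by
    intro τ o ho
    refine List.eq_nil_iff_forall_not_mem.2 fun e he => ?_
    have := Prog.ch_mem_CN ho e he
    rw [h] at this; exact this
  constructor
  · intro H
    refine ⟨by simpa using (H [] none (Prog.nil_none_mem_sem _ _)).1, fun hA τ w hw => ?_⟩
    obtain rfl := hnil hw
    exact (H _ _ hw).2 w rfl fun σ hσ => by
      rw [List.prefix_nil.1 hσ, State.app_nil]; exact hA
  · rintro ⟨hC, H⟩ τ o ho
    obtain rfl := hnil ho
    refine ⟨fun _ => by simpa using hC, ?_⟩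
    rintro w rfl hp
    exact H (by simpa using hp [] List.prefix_rfl) _ _ ho

/-- The commitment at the end of a run and the assumption there hold in the initial state if and
only if they hold in the final one, so they can be moved into the postcondition and back. -/
theorem sound_acWeak (α : Prog S) (A C ψ : Fml S) (hA : A.WF) (hC : C.WF)
    (hAC : (A.FV ∪ C.FV) ∩ α.BV ⊆ TV S) (v : State S) :
    (Fml.acbox α A C ψ).Sat v ↔ (Fml.and C (.acbox α A C (.and C (.imp A ψ)))).Sat v := by
  constructor
  · intro H
    refine ⟨by simpa using (H [] none (Prog.nil_none_mem_sem _ _)).1, fun τ o ho => ?_⟩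
    obtain ⟨h1, h2⟩ := H τ o ho
    refine ⟨h1, ?_⟩
    rintro w rfl hp
    exact ⟨(Fml.sat_frame hC (fun z hz => hAC ⟨.inr hz.1, hz.2⟩) (Prog.frame ho) τ).1
      (h1 fun σ hσ _ => hp σ hσ), fun _ => h2 w rfl hp⟩
  · rintro ⟨-, H⟩ τ o ho
    obtain ⟨h1, h2⟩ := H τ o ho
    refine ⟨h1, ?_⟩
    rintro w rfl hp
    exact (h2 w rfl hp).2 ((Fml.sat_frame hA (fun z hz => hAC ⟨.inl hz.1, hz.2⟩)
      (Prog.frame ho) τ).1 (hp τ List.prefix_rfl))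

theorem sound_acBoxesDist (α : Prog S) (A C₁ C₂ ψ₁ ψ₂ : Fml S) (v : State S) :
    (Fml.acbox α A (.and C₁ C₂) (.and ψ₁ ψ₂)).Sat v ↔
      (Fml.acbox α A C₁ ψ₁).Sat v ∧ (Fml.acbox α A C₂ ψ₂).Sat v := by
  constructor
  · intro H
    exact ⟨fun τ o ho => ⟨fun hp => ((H τ o ho).1 hp).1, fun w hw hp => ((H τ o ho).2 w hw hp).1⟩,
      fun τ o ho => ⟨fun hp => ((H τ o ho).1 hp).2, fun w hw hp => ((H τ o ho).2 w hw hp).2⟩⟩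
  · rintro ⟨H1, H2⟩ τ o ho
    exact ⟨fun hp => ⟨(H1 τ o ho).1 hp, (H2 τ o ho).1 hp⟩,
      fun w hw hp => ⟨(H1 τ o ho).2 w hw hp, (H2 τ o ho).2 w hw hp⟩⟩

/-! ### Collecting the axioms and rules -/

/-- The two sides of an axiom carry different well-formedness conditions; what each case needs is
taken from the side that has it. For comDual, `x ≠ S.mu` is the condition on the receive. -/
theorem Ax.valid {φ : Fml S} (h : Ax φ) (hwf : φ.WF) : φ.Valid := by
  cases h with
  | assign l ψ ha => exact Fml.valid_iff_iff.2 (sound_assign l ψ ha hwf.1.1.2)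
  | nondetAssign x ψ => exact Fml.valid_iff_iff.2 (sat_box_nondet x ψ)
  | test χ ψ => exact Fml.valid_iff_iff.2 (sound_test χ ψ)
  | boxesDual α ψ => exact Fml.valid_iff_iff.2 (sound_boxesDual α ψ)
  | acComposition α β A C ψ =>
    obtain ⟨⟨-, hα, hA, hC, ⟨hβ, -⟩, hAC⟩, -⟩ := hwf
    exact Fml.valid_iff_iff.2 (sound_acComposition α β A C ψ hβ hA hC hAC)
  | acChoice α β A C ψ => exact Fml.valid_iff_iff.2 (sound_acChoice α β A C ψ)
  | acIteration α A C ψ =>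
    obtain ⟨⟨⟨hα, hA, hC, -, hAC⟩, -⟩, -⟩ := hwf
    exact Fml.valid_iff_iff.2 (sound_acIteration α A C ψ hα hA hC hAC)
  | acInduction α A C ψ =>
    obtain ⟨⟨⟨hα, hA, hC, -, hAC⟩, -⟩, -⟩ := hwf
    exact Fml.valid_iff_iff.2 (sound_acInduction α A C ψ hα hA hC hAC)
  | gtime l χ ψ => exact Fml.valid_iff_iff.2 (sound_gtime l χ ψ)
  | solution l ys t ψ hlen hmu ht hsol =>
    obtain ⟨⟨⟨hl, hψ⟩, -⟩, -⟩ := hwf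
    exact Fml.valid_iff_iff.2 (sound_solution l ys t ψ hlen hmu ht hsol hl hψ)
  | send c h h₀ p ψ hne hfresh =>
    obtain ⟨⟨⟨-, hψ⟩, -⟩, -⟩ := hwf
    exact Fml.valid_iff_iff.2 (sound_send c h h₀ p ψ hne hfresh hψ)
  | acCom c h p A C ψ => exact Fml.valid_iff_iff.2 (sound_acCom c h p A C ψ)
  | comDual c h x A C ψ =>
    obtain ⟨⟨⟨hx, hA, hC, -, hAC⟩, -⟩, -⟩ := hwf
    exact Fml.valid_iff_iff.2 (sound_comDual c h x A C ψ hx hA hC hAC)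
  | K α A A₁ A₂ C₁ C₂ ψ zs hzs =>
    rintro v ⟨hK, H⟩
    obtain ⟨⟨-, -, ⟨hA₁, hA₂⟩, ⟨hC₁, hC₂⟩, -⟩, -, hA, -⟩ := hwf
    exact sound_K α A A₁ A₂ C₁ C₂ ψ v
      (Fml.valid_of_sat_allList (a := compCond A A₁ A₂ C₁ C₂)
        ⟨⟨⟨hA, hC₁⟩, hA₂⟩, ⟨hA, hC₂⟩, hA₁⟩ (fun z hz => (hzs z).2 hz) hK) H
  | acDropComp α β A C ψ hni =>
    obtain ⟨⟨-, hA, hC, hψ, -⟩, -⟩ := hwf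
    exact fun v H => sound_acDropComp α β A C ψ hni hA hC hψ v H
  | acNoCom α A C ψ hn => exact Fml.valid_iff_iff.2 (sound_acNoCom α A C ψ hn)
  | acWeak α A C ψ =>
    obtain ⟨⟨⟨-, hA, hC, -, hAC⟩, -⟩, -⟩ := hwf
    exact Fml.valid_iff_iff.2 (sound_acWeak α A C ψ hA hC hAC)
  | acBoxesDist α A C₁ C₂ ψ₁ ψ₂ =>
    exact Fml.valid_iff_iff.2 (sound_acBoxesDist α A C₁ C₂ ψ₁ ψ₂)

theorem Rule.valid {Γ : List (Fml S)} {φ : Fml S} (h : Rule Γ φ) (hΓ : ∀ γ ∈ Γ, γ.Valid) :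
    φ.Valid := by
  cases h with
  | acMono α A₁ A₂ C₁ C₂ ψ₁ ψ₂ =>
    simp only [List.forall_mem_cons] at hΓ
    obtain ⟨hA, hC, hψ, -⟩ := hΓ
    intro v H τ o ho
    exact ⟨fun hp => hC _ ((H τ o ho).1 fun σ hσ hne => hA _ (hp σ hσ hne)),
      fun w hw hp => hψ _ ((H τ o ho).2 w hw fun σ hσ => hA _ (hp σ hσ))⟩
  | acG α A C ψ =>
    have h := hΓ _ (List.mem_singleton_self _)
    exact fun v τ o _ => ⟨fun _ => (h _).1, fun w _ _ => (h _).2⟩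

end DLCHP

theorem theorem1 (S : DLCHP.Sig) :
    (∀ φ : DLCHP.Fml S, DLCHP.Ax φ → φ.WF → φ.Valid) ∧
    (∀ (Γ : List (DLCHP.Fml S)) (φ : DLCHP.Fml S), DLCHP.Rule Γ φ → φ.WF →
      (∀ γ ∈ Γ, γ.Valid) → φ.Valid) := by
  exact ⟨fun _ h hwf => h.valid hwf, fun _ _ h _ hΓ => h.valid hΓ⟩
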